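/- **Notation.** For $j\ge 1$ let $(a;q)_0=1$, $(a;q)_j=\prod_{i=0}^{j-1}(1-aq^i)$ and $(a;q)_{-j}=1/\prod_{i=1}^{j}(1-aq^{-i})$, and read $1/(q;q)_j=0$ for $j<0$. Let $${}_r\phi_s(a_1,\dots,a_r;b_1,\dots,b_s;q,x)=\sum_{j\ge 0}\frac{(a_1;q)_j\cdots(a_r;q)_j}{(q;q)_j(b_1;q)_j\cdots(b_s;q)_j}\left\{(-1)^jq^{\binom j2}\right\}^{1+s-r}x^j .$$ **Theorem.** Let $k,m,n$ be integers. (i) There is exactly one pair $(S,T)=(S(k,m,n;a,c,x;q),\,T(k,m,n;a,c,x;q))$ of rational functions in $a,c,x,q$ with complex coefficients such that $${}_1\phi_1(aq^k;cq^m;q,xq^n)=S\cdot{}_1\phi_1(aq;cq;q,xq)+T\cdot{}_1\phi_1(a;c;q,x)$$ for all complex $a,c,x,q$ with $0<|q|<1$ such that none of the lower parameters $c,cq,cq^m$ equals $q^{-j}$ for some integer $j\ge 0$, and such that $S$ and $T$ are defined at $(a,c,x,q)$. (ii) As rational functions, $$T(k,m,n;a,c,x;q)=-\frac{(1-c)(1-cq)}{(1-aq)(c-axq)xq}\,S(k-1,m-1,n-1;aq,cq,xq;q).$$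 (iii) As rational functions, $$S(k,m,n;a,c,x;q)=\frac{(1-a)(c-ax)}{(q-c)(1-c)}\,\frac{x^{1-\max\{m,0\}}}{(ax/c;q)_{\max\{k-m+n,0\}}}\,P^{(1,1)}(k,m,n;a,c,x;q),$$ where $P^{(1,1)}$ is a polynomial in $x$, with coefficients rational in $a,c,q$, of degree at most $\max\{|k|,|m-k|,|n|,|m-n|\}-1$ (it is $0$ if this bound is $-1$), given by $$P^{(1,1)}(k,m,n;a,c,x;q)=\begin{cases}\displaystyle\sum_{j=0}^{d}\left(A_{j+\min\{m,0\}}-B_{j-\max\{m,0\}}\right)x^j,&k-m+n\ge 0,\\ \displaystyle\sum_{j=0}^{d}\left(\tilde A_{j+\min\{m,0\}}-\tilde B_{j-\max\{m,0\}}\right)x^j,&k-m+n<0,\end{cases}$$ with $d=\max\{k-m+n,0\}+\max\{m,0\}-\min\{k,n\}-1$, where $A_j=B_j=\tilde A_j=\tilde B_j=0$ for $j<0$ and, for $j\ge 0$, $$A_j=\frac{(aq/c;q)_{k-m}(c;q)_m(c/q;q)_{m-j}}{(q;q)_j(a;q)_{k-j}}\,c^{-n}q^{(j-m+1)(n-1)+1}\,{}_3\phi_2\left(q^{-j},cq^{m-j-1},a;\;c,aq^{k-j};\;q,q^{j-n+1}\right),$$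 $$B_j=\frac{(aq/c;q)_j}{(q;q)_j(q^2/c;q)_j}\,(-1)^jc^{-j}q^{\binom{j+1}2}\,{}_3\phi_2\left(q^{-j},cq^{-j-1},cq^{m-k}/a;\;cq^m,cq^{-j}/a;\;q,q^{k-m+n+1}\right),$$ $$\tilde A_j=\frac{(aq/c;q)_{j+k-m}(c;q)_m(c/q;q)_{m-j}}{(q;q)_j(a;q)_k}\,c^{-n}q^{(j-m+1)(n-1)+1}\,{}_3\phi_2\left(q^{-j},cq^{m-j-1},c/a;\;c,cq^{m-k-j}/a;\;q,q^{m-k-n+1}\right),$$ $$\tilde B_j=\frac{(q/a;q)_j}{(q;q)_j(q^2/c;q)_j}\,a^jc^{-j}\,{}_3\phi_2\left(q^{-j},cq^{-j-1},aq^k;\;cq^m,aq^{-j};\;q,q^{j+n+1}\right).$$ -/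

import Mathlib

noncomputable section

namespace QHyp

open Finset

/-- The `q`-shifted factorial `(a; q)_j` for an integer `j`:
`(a; q)_j = ∏_{i < j} (1 - a q^i)` and `(a; q)_{-j} = 1 / ∏_{1 ≤ i ≤ j} (1 - a q^{-i})`. -/
def qPoch {F : Type*} [Field F] (a q : F) : ℤ → F
  | Int.ofNat j => ∏ i ∈ range j, (1 - a * q ^ i)
  | Int.negSucc j => (∏ i ∈ range (j + 1), (1 - a * q ^ (-((i : ℤ) + 1))))⁻¹

/-- The `j`-th term of the basic hypergeometric series `ᵣφₛ(as; bs; q, x)`. -/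
def phiTerm {F : Type*} [Field F] (as bs : List F) (q x : F) (j : ℕ) : F :=
  (as.map fun a => qPoch a q j).prod / (qPoch q q j * (bs.map fun b => qPoch b q j).prod)
    * ((-1) ^ j * q ^ (j.choose 2)) ^ (1 + (bs.length : ℤ) - (as.length : ℤ)) * x ^ j

/-- The basic hypergeometric series `ᵣφₛ(as; bs; q, x)` of complex arguments. -/
def phi (as bs : List ℂ) (q x : ℂ) : ℂ := ∑' j : ℕ, phiTerm as bs q x j

/-- The terminating series `₃φ₂(q^{-j}, b, d; e, f; q, z)` with `j ≥ 0`, over any field; its terms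
of index larger than `j` contain the factor `(q^{-j}; q)_i = 0`. -/
def phi32 {F : Type*} [Field F] (j : ℤ) (b d e f q z : F) : F :=
  ∑ i ∈ range (j.toNat + 1), phiTerm [q ^ (-j), b, d] [e, f] q z i

section Coefficients

variable {F : Type*} [Field F]

/-- The coefficient `A_j`; it vanishes for `j < 0`, by the convention `1 / (q; q)_j = 0`. -/
def coeffA (k m n : ℤ) (a c q : F) (j : ℤ) : F :=
  if j < 0 then 0 else
    qPoch (a * q / c) q (k - m) * qPoch c q m * qPoch (c / q) q (m - j)
      / (qPoch q q j * qPoch a q (k - j))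
      * c ^ (-n) * q ^ ((j - m + 1) * (n - 1) + 1)
      * phi32 j (c * q ^ (m - j - 1)) a c (a * q ^ (k - j)) q (q ^ (j - n + 1))

/-- The coefficient `B_j`; it vanishes for `j < 0`. -/
def coeffB (k m n : ℤ) (a c q : F) (j : ℤ) : F :=
  if j < 0 then 0 else
    qPoch (a * q / c) q j / (qPoch q q j * qPoch (q ^ 2 / c) q j)
      * (-1) ^ j * c ^ (-j) * q ^ ((j + 1).toNat.choose 2)
      * phi32 j (c * q ^ (-j - 1)) (c * q ^ (m - k) / a) (c * q ^ m) (c * q ^ (-j) / a) q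
          (q ^ (k - m + n + 1))

/-- The coefficient `Ã_j`; it vanishes for `j < 0`. -/
def coeffA' (k m n : ℤ) (a c q : F) (j : ℤ) : F :=
  if j < 0 then 0 else
    qPoch (a * q / c) q (j + k - m) * qPoch c q m * qPoch (c / q) q (m - j)
      / (qPoch q q j * qPoch a q k)
      * c ^ (-n) * q ^ ((j - m + 1) * (n - 1) + 1)
      * phi32 j (c * q ^ (m - j - 1)) (c / a) c (c * q ^ (m - k - j) / a) q (q ^ (m - k - n + 1))

/-- The coefficient `B̃_j`; it vanishes for `j < 0`. -/
def coeffB' (k m n : ℤ) (a c q : F) (j : ℤ) : F :=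
  if j < 0 then 0 else
    qPoch (q / a) q j / (qPoch q q j * qPoch (q ^ 2 / c) q j)
      * a ^ j * c ^ (-j)
      * phi32 j (c * q ^ (-j - 1)) (a * q ^ k) (c * q ^ m) (a * q ^ (-j)) q (q ^ (j + n + 1))

/-- `P^{(1,1)}(k, m, n; a, c, x; q)`, as a polynomial in `x` with coefficients built from
`a, c, q`. The sum runs over `0 ≤ j ≤ d`, where
`d = max (k - m + n) 0 + max m 0 - min k n - 1 ≥ -1`. -/
def P11 (k m n : ℤ) (a c q : F) : Polynomial F :=
  ∑ j ∈ range (max (k - m + n) 0 + max m 0 - min k n).toNat,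
    Polynomial.monomial j
      (if 0 ≤ k - m + n then
        coeffA k m n a c q ((j : ℤ) + min m 0) - coeffB k m n a c q ((j : ℤ) - max m 0)
      else
        coeffA' k m n a c q ((j : ℤ) + min m 0) - coeffB' k m n a c q ((j : ℤ) - max m 0))

end Coefficients

/-- Polynomials in the four indeterminates `a, c, x, q` (numbered `0, 1, 2, 3`). -/
abbrev Poly4 : Type := MvPolynomial (Fin 4) ℂ

/-- The field `ℂ(a, c, x, q)` of rational functions in `a, c, x, q`. -/
abbrev Rat4 : Type := FractionRing Poly4

/-- The indeterminate `a`. -/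
def va : Rat4 := algebraMap Poly4 Rat4 (MvPolynomial.X 0)
/-- The indeterminate `c`. -/
def vc : Rat4 := algebraMap Poly4 Rat4 (MvPolynomial.X 1)
/-- The indeterminate `x`. -/
def vx : Rat4 := algebraMap Poly4 Rat4 (MvPolynomial.X 2)
/-- The indeterminate `q`. -/
def vq : Rat4 := algebraMap Poly4 Rat4 (MvPolynomial.X 3)

/-- `f` is defined at `(a, c, x, q) ∈ ℂ⁴`, with the value `v` there. -/
def HasValueAt (f : Rat4) (a c x q v : ℂ) : Prop :=
  ∃ N D : Poly4, MvPolynomial.eval ![a, c, x, q] D ≠ 0 ∧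
    f = algebraMap Poly4 Rat4 N / algebraMap Poly4 Rat4 D ∧
    v = MvPolynomial.eval ![a, c, x, q] N / MvPolynomial.eval ![a, c, x, q] D

/-- The pair `(S, T)` of rational functions satisfies
`₁φ₁(a q^k; c q^m; q, x q^n) = S · ₁φ₁(a q; c q; q, x q) + T · ₁φ₁(a; c; q, x)`
at all complex `a, c, x, q`, `0 < |q| < 1`, for which no lower parameter is a nonpositive integer
power of `q` (for `c q` this follows from the condition on `c`) and `S`, `T` are defined. -/
def ThreeTerm (k m n : ℤ) (S T : Rat4) : Prop :=
  ∀ a c x q s t : ℂ, q ≠ 0 → ‖q‖ < 1 →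
    (∀ j : ℕ, c * q ^ j ≠ 1) → (∀ j : ℕ, c * q ^ m * q ^ j ≠ 1) →
    HasValueAt S a c x q s → HasValueAt T a c x q t →
    phi [a * q ^ k] [c * q ^ m] q (x * q ^ n) =
      s * phi [a * q] [c * q] q (x * q) + t * phi [a] [c] q x

/-- The substitution `(a, c, x, q) ↦ (a q, c q, x q, q)` on polynomials. -/
def shiftPoly : Poly4 →ₐ[ℂ] Poly4 :=
  MvPolynomial.aeval ![MvPolynomial.X 0 * MvPolynomial.X 3, MvPolynomial.X 1 * MvPolynomial.X 3,
    MvPolynomial.X 2 * MvPolynomial.X 3, MvPolynomial.X 3]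

theorem shiftPoly_injective : Function.Injective shiftPoly := by
  rw [injective_iff_map_eq_zero]
  intro p hp
  have key : p * MvPolynomial.X 3 = 0 := by
    apply MvPolynomial.funext
    intro v
    by_cases hv : v 3 = 0
    · simp [hv]
    · have h1 : MvPolynomial.eval ![v 0 / v 3, v 1 / v 3, v 2 / v 3, v 3] (shiftPoly p) = 0 := by
        rw [hp, map_zero]
      have h2 : ((MvPolynomial.aeval (R := ℂ) ![v 0 / v 3, v 1 / v 3, v 2 / v 3, v 3]).comp
          shiftPoly) = MvPolynomial.aeval (R := ℂ) v := by
        apply MvPolynomial.algHom_ext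
        intro i
        fin_cases i <;> simp [shiftPoly, hv]
      have h3 := DFunLike.congr_fun h2 p
      simp only [AlgHom.comp_apply, MvPolynomial.aeval_eq_eval] at h3
      have h4 : MvPolynomial.eval v p = 0 := by
        rw [← h1]; exact h3.symm
      simp [h4]
  exact (mul_eq_zero.mp key).resolve_right (MvPolynomial.X_ne_zero 3)

/-- The substitution `(a, c, x, q) ↦ (a q, c q, x q, q)` on rational functions. -/
def shift : Rat4 →+* Rat4 :=
  IsFractionRing.lift (A := Poly4) (K := Rat4) (L := Rat4)
    (g := (algebraMap Poly4 Rat4).comp (shiftPoly : Poly4 →+* Poly4))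
    ((IsFractionRing.injective Poly4 Rat4).comp shiftPoly_injective)

end QHyp

end

noncomputable section

/-! ### Contiguous relations and the solutions they determine. -/

namespace QHyp

open Finset

/-! As a function of (k, m, n), the series ₁φ₁(aq^k; cq^m; q, xq^n) solves a system of contiguous
relations. For generic parameters a solution is determined by its values at (0,0,0) and (1,1,1)
(`IsContig.eq_zero`). Hence S must be the solution with values 0 and 1 at these points. A diagonal
translate of S, with all parameters shifted, vanishes at (1,1,1); rescaled, it gives T. This is the
formula of (ii) (`IsContig.three_term`).

To find S explicitly, x is replaced by a formal variable X. The system has two formal solutions, the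
series ₁φ₁ itself and X^(-m) times another ₁φ₁, the classical second solution at the origin. Their
Casoratian, with one argument frozen at (0,0,0), is again a solution in (k, m, n), and it vanishes
at (0,0,0). After division by (aX/c;q)_∞ it becomes rational in X: its value at (0,0,1) is a
constant over 1 - aX/c, and the contiguous relations carry rationality to all (k, m, n). Following
the relations also controls the poles (`IsContig.mul_pochPoly_mem`) and the growth at infinity
(`IsContig.degLE`). Heine's transformation, on the other hand, removes the infinite product and
makes each Taylor coefficient a convolution, which is a terminating ₃φ₂; these are A_j, B_j, or Ã_j,
B̃_j according to the sign of k-m+n (`casoratian_eq`). A power series that is a polynomial of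
bounded degree equals its truncation, and this truncation is P^(1,1) (`casoratian_mul_eq`).
Evaluating at a point and normalising gives S (`formS_contig`).

The relation thus holds at generic complex points, and continuity of ₁φ₁ extends it to every
admissible point (`threeTerm_form`).

For uniqueness, two different pairs would give a nontrivial polynomial relation P·₁φ₁(aq;cq;q,xq) +
R·₁φ₁(a;c;q,x) = 0. At a = 1 the second series is 1, while the first is a power series in x whose
coefficients decay too fast for a rational function. So P and R vanish at a = 1, are divisible by a
- 1, and the quotient relation starts an infinite descent (`IsRelation.eq_zero`). -/

/-- The contiguous relations of `₁φ₁(a q^k; c q^m; q, x q^n)`. -/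
structure IsContig {F : Type*} [Field F] (a c q x : F) (u : ℤ → ℤ → ℤ → F) : Prop where
  raise_num : ∀ k m n, u k m n - a * q ^ k * u k m (n + 1) = (1 - a * q ^ k) * u (k + 1) m n
  lower_den : ∀ k m n, u k m n - c * q ^ (m - 1) * u k m (n + 1)
    = (1 - c * q ^ (m - 1)) * u k (m - 1) n
  raise_all : ∀ k m n, (1 - c * q ^ m) * (u k m n - u k m (n + 1))
    = -(x * q ^ n * (1 - a * q ^ k)) * u (k + 1) (m + 1) (n + 1)

/-- Parameters avoiding the zeros of all the denominators that do not involve `x`. -/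
structure Generic {F : Type*} [Field F] (a c q : F) : Prop where
  a0 : a ≠ 0
  c0 : c ≠ 0
  q0 : q ≠ 0
  qn : ∀ i : ℤ, i ≠ 0 → q ^ i ≠ 1
  an : ∀ i : ℤ, a * q ^ i ≠ 1
  cn : ∀ i : ℤ, c * q ^ i ≠ 1
  acn : ∀ i : ℤ, a * q ^ i ≠ c

/-- A property of pairs of integers that is preserved by three kinds of steps holds everywhere. -/
theorem int_pair_induction {Q : ℤ → ℤ → Prop} (h0 : Q 0 0)
    (h1 : ∀ k m, Q k m → Q (k + 1) (m + 1)) (h2 : ∀ k m, Q k m → Q k (m - 1))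
    (h3 : ∀ k m, Q (k + 1) m → Q k m) (k m : ℤ) : Q k m := by
  have g1 : ∀ i : ℕ, Q i i := by
    intro i
    induction i with
    | zero => simpa using h0
    | succ i ih => simpa using h1 _ _ ih
  have g2 : ∀ (i : ℕ) (k m : ℤ), Q k m → Q k (m - i) := by
    intro i
    induction i with
    | zero => intro k m h; simpa using h
    | succ i ih =>
      intro k m h
      have := h2 _ _ (ih k m h)
      convert this using 1; push_cast; ring
  have g3 : ∀ (i : ℕ) (k m : ℤ), Q k m → Q (k - i) m := by
    intro i
    induction i with
    | zero => intro k m h; simpa using h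
    | succ i ih =>
      intro k m h
      refine h3 _ _ ?_
      have := ih k m h
      convert this using 1; push_cast; ring
  -- Climb the diagonal to (M, M) with M = max(k, m, 0), then lower m, then lower k.
  have := g3 ((max k m).toNat + 0 - k).toNat _ _
    (g2 ((max k m).toNat - m).toNat _ _ (g1 (max k m).toNat))
  convert this using 1
  all_goals omega

section
variable {F : Type*} [Field F] {a c q x : F} {u v : ℤ → ℤ → ℤ → F}

theorem IsContig.add (hu : IsContig a c q x u) (hv : IsContig a c q x v) :
    IsContig a c q x (fun k m n => u k m n + v k m n) where
  raise_num k m n := by linear_combination hu.raise_num k m n + hv.raise_num k m n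
  lower_den k m n := by linear_combination hu.lower_den k m n + hv.lower_den k m n
  raise_all k m n := by linear_combination hu.raise_all k m n + hv.raise_all k m n

theorem IsContig.smul (r : F) (hu : IsContig a c q x u) :
    IsContig a c q x (fun k m n => r * u k m n) where
  raise_num k m n := by linear_combination r * hu.raise_num k m n
  lower_den k m n := by linear_combination r * hu.lower_den k m n
  raise_all k m n := by linear_combination r * hu.raise_all k m n

/-- Translation along the diagonal absorbs the factors q in the parameters and in the argument. This
is what makes T a shifted copy of S. -/
theorem IsContig.shift (hq : q ≠ 0) (hu : IsContig (a * q) (c * q) q (x * q) u) :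
    IsContig a c q x (fun k m n => u (k - 1) (m - 1) (n - 1)) where
  raise_num k m n := by
    have := hu.raise_num (k - 1) (m - 1) (n - 1)
    have e : q * q ^ (k - 1) = q ^ k := by rw [← zpow_one_add₀ hq]; ring_nf
    rw [mul_assoc a, e] at this
    convert this using 3 <;> ring_nf
  lower_den k m n := by
    have := hu.lower_den (k - 1) (m - 1) (n - 1)
    have e : q * q ^ (m - 1 - 1) = q ^ (m - 1) := by rw [← zpow_one_add₀ hq]; ring_nf
    rw [mul_assoc c, e] at this
    convert this using 3
    ring_nf
  raise_all k m n := by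
    have := hu.raise_all (k - 1) (m - 1) (n - 1)
    have e1 : q * q ^ (k - 1) = q ^ k := by rw [← zpow_one_add₀ hq]; ring_nf
    have e2 : q * q ^ (m - 1) = q ^ m := by rw [← zpow_one_add₀ hq]; ring_nf
    have e3 : q * q ^ (n - 1) = q ^ n := by rw [← zpow_one_add₀ hq]; ring_nf
    rw [mul_assoc a, mul_assoc c, mul_assoc x, e1, e2, e3] at this
    convert this using 3 <;> ring_nf

/-- The second order `q`-difference equation in the argument. -/
theorem IsContig.difference (hu : IsContig a c q x u) (k m n : ℤ) :
    (c * q ^ (m - 1) - a * q ^ k * (x * q ^ n)) * u k m (n + 2)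
      + (x * q ^ n - 1 - c * q ^ (m - 1)) * u k m (n + 1) + u k m n = 0 := by
  have h1 := hu.raise_all k (m - 1) n
  have h2 := hu.lower_den k m n
  have h3 := hu.lower_den k m (n + 1)
  have h4 := hu.raise_num k m (n + 1)
  rw [sub_add_cancel] at h1
  rw [add_assoc n 1 1, one_add_one_eq_two] at h3 h4
  linear_combination h1 + h2 - h3 + x * q ^ n * h4

/-- Lowering k is the one step needed by `int_pair_induction` that is not a defining relation. After
multiplication by 1 - aq^k, two instances of `raise_num` and the difference equation give it. -/
theorem IsContig.lower_num (hu : IsContig a c q x u) (k m n : ℤ)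
    (hk : a * q ^ k ≠ 1) :
    (c * q ^ (m - 1) - a * q ^ k) * u k m n
      = (c * q ^ (m - 1) - a * q ^ k - a * q ^ k * (c * q ^ (m - 1))) * u (k + 1) m n
        + a * q ^ k * (c * q ^ (m - 1) - a * q ^ k * (x * q ^ n)) * u (k + 1) m (n + 1) := by
  have h0 := hu.raise_num k m n
  have h1 := hu.raise_num k m (n + 1)
  have h2 := hu.difference k m n
  rw [add_assoc n 1 1, one_add_one_eq_two] at h1
  have hk' : 1 - a * q ^ k ≠ 0 := sub_ne_zero.mpr (Ne.symm hk)
  apply mul_left_cancel₀ hk'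
  generalize a * q ^ k = α at *
  generalize c * q ^ (m - 1) = C at *
  generalize x * q ^ n = z at *
  linear_combination (C - α - α * C) * h0 + α ^ 2 * h2 + α * (C - α * z) * h1

/-- The same step with n + 1 traded for n - 1 by the difference equation. This form suits the
control of poles, which appear as k - m + n grows; `lower_num` suits the bound on degrees. -/
theorem IsContig.lower_num' (hq : q ≠ 0) (hu : IsContig a c q x u) (k m n : ℤ)
    (hk : a * q ^ k ≠ 1) :
    (c * q ^ (m - 1) - a * q ^ k) * u k m n
      = (c * q ^ (m - 1) - a * q ^ k * (x * q ^ (n - 1))) * u (k + 1) m n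
        - a * q ^ k * u (k + 1) m (n - 1) := by
  have h1 := hu.lower_num k m n hk
  have h2 := hu.difference (k + 1) m (n - 1)
  have e1 : a * q ^ (k + 1) * (x * q ^ (n - 1)) = a * q ^ k * (x * q ^ n) := by
    rw [zpow_add_one₀ hq, zpow_sub_one₀ hq]; field_simp
  rw [e1, show n - 1 + 2 = n + 1 by ring, sub_add_cancel] at h2
  linear_combination h1 + a * q ^ k * h2

/-- The values at (0,0,0) and (1,1,1) give u(0,0,1) by `raise_all`. The second order equation then
fills the line (0,0,n) in both directions: downwards its last coefficient is 1, upwards its leading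
coefficient vanishes only if axq^i = c for some i. The remaining relations leave this line. -/
theorem IsContig.eq_zero (hG : Generic a c q) (hx : x ≠ 0) (hax : ∀ i : ℤ, a * x * q ^ i ≠ c)
    (hu : IsContig a c q x u) (h0 : u 0 0 0 = 0) (h1 : u 1 1 1 = 0) (k m n : ℤ) :
    u k m n = 0 := by
  have hq := hG.q0
  have hA : ∀ k : ℤ, 1 - a * q ^ k ≠ 0 := fun k => sub_ne_zero.mpr (hG.an k).symm
  have hC : ∀ k : ℤ, 1 - c * q ^ k ≠ 0 := fun k => sub_ne_zero.mpr (hG.cn k).symm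
  suffices h : ∀ k m : ℤ, ∀ n, u k m n = 0 from h k m n
  apply int_pair_induction
  · have h01 : u 0 0 1 = 0 := by
      have := hu.raise_all 0 0 0
      simp only [zero_add, h1, h0, zero_sub, mul_zero] at this
      simpa [hC 0] using (mul_eq_zero.mp this).resolve_left (hC 0)
    have step : ∀ i : ℕ, u 0 0 i = 0 ∧ u 0 0 (i + 1) = 0 := by
      intro i
      induction i with
      | zero => simp [h0, h01]
      | succ i ih =>
        refine ⟨by simpa using ih.2, ?_⟩
        have := hu.difference 0 0 i
        rw [ih.1, ih.2, mul_zero, add_zero, add_zero] at this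
        have hne : c * q ^ ((0 : ℤ) - 1) - a * q ^ (0 : ℤ) * (x * q ^ (i : ℤ)) ≠ 0 := by
          intro h
          apply hax (i + 1)
          rw [zpow_add_one₀ hq]
          rw [zero_sub, zpow_neg_one, zpow_zero] at h
          field_simp at h
          linear_combination -h
        have := (mul_eq_zero.mp this).resolve_left hne
        push_cast
        rw [add_assoc, one_add_one_eq_two]; exact this
    have step' : ∀ i : ℕ, u 0 0 (-i) = 0 ∧ u 0 0 (-i + 1) = 0 := by
      intro i
      induction i with
      | zero => simp [h0, h01]
      | succ i ih =>
        have e : -((i + 1 : ℕ) : ℤ) = -i - 1 := by push_cast; ring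
        rw [e, sub_add_cancel]
        refine ⟨?_, ih.1⟩
        have := hu.difference 0 0 (-i - 1)
        rw [sub_add_cancel, show (-(i : ℤ) - 1 + 2) = -i + 1 by ring, ih.1, ih.2] at this
        simpa using this
    intro n
    obtain ⟨i, rfl | rfl⟩ := n.eq_nat_or_neg
    · exact (step i).1
    · exact (step' i).1
  · intro k m h n
    have := hu.raise_all k m (n - 1)
    rw [h, h, sub_zero, mul_zero, sub_add_cancel] at this
    refine (mul_eq_zero.mp this.symm).resolve_left ?_
    exact neg_ne_zero.mpr (mul_ne_zero (mul_ne_zero hx (zpow_ne_zero _ hq)) (hA k))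
  · intro k m h n
    have := hu.lower_den k m n
    rw [h, h, mul_zero, sub_zero] at this
    exact (mul_eq_zero.mp this.symm).resolve_left (hC _)
  · intro k m h n
    have := hu.lower_num k m n (hG.an k)
    rw [h, h, mul_zero, mul_zero, add_zero] at this
    refine (mul_eq_zero.mp this).resolve_left ?_
    intro h'
    apply hG.acn (k - (m - 1))
    rw [zpow_sub₀ hq]
    field_simp
    linear_combination -h'

/-- The three-term relation along the diagonal, at a solution vanishing at `(1, 1, 1)`. -/
theorem IsContig.diagonal (hG : Generic a c q) (hx : x ≠ 0) (hu : IsContig a c q x u)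
    (h1 : u 1 1 1 = 0) :
    -((1 - c) * (1 - c * q)) * u 0 0 0 = (1 - a * q) * (c - a * x * q) * x * q * u 2 2 2 := by
  have hq := hG.q0
  have e1 := hu.raise_all 0 0 0
  have e2 := hu.raise_all 1 1 1
  have e3 := hu.raise_all 0 0 1
  have e4 := hu.difference 0 0 0
  have hC : 1 - c ≠ 0 := by simpa using sub_ne_zero.mpr (hG.cn 0).symm
  have hA : 1 - a ≠ 0 := by simpa using sub_ne_zero.mpr (hG.an 0).symm
  norm_num [h1] at e1 e2 e3 e4
  have e5 : u 0 0 1 = u 0 0 0 := by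
    rcases e1 with h | h
    · exact absurd h hC
    · linear_combination -h
  rw [e5] at e3 e4
  have e6 : (c - a * x * q) * u 0 0 2 = (c - x * q) * u 0 0 0 := by
    field_simp at e4
    linear_combination e4
  have e7 : (c - a * x * q) * u 1 1 2 = -((1 - c) * u 0 0 0) := by
    apply mul_left_cancel₀ (mul_ne_zero (mul_ne_zero hx hq) hA)
    linear_combination (c - a * x * q) * e3 + (1 - c) * e6
  linear_combination (c - a * x * q) * e2 - (1 - c * q) * e7
end
end QHyp

/-! ### Shifted factorials and term-by-term relations for ₁φ₁. -/

namespace QHyp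

open Finset

section
variable {F : Type*} [Field F] {a c q x : F}

@[simp] theorem qPoch_zero (a q : F) : qPoch a q 0 = 1 := by
  change ∏ i ∈ range 0, (1 - a * q ^ i) = 1
  simp

theorem qPoch_natCast (a q : F) (j : ℕ) : qPoch a q j = ∏ i ∈ range j, (1 - a * q ^ i) := rfl

theorem qPoch_negSucc (a q : F) (j : ℕ) :
    qPoch a q (Int.negSucc j) = (∏ i ∈ range (j + 1), (1 - a * q ^ (-((i : ℤ) + 1))))⁻¹ := rfl

theorem qPoch_succ (a q : F) (j : ℕ) :
    qPoch a q ((j : ℤ) + 1) = qPoch a q j * (1 - a * q ^ j) := by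
  have := qPoch_natCast a q (j + 1)
  push_cast at this
  rw [this, prod_range_succ, qPoch_natCast]

theorem qPoch_succ' (a q : F) (j : ℕ) :
    qPoch a q ((j : ℤ) + 1) = (1 - a) * qPoch (a * q) q j := by
  have := qPoch_natCast a q (j + 1)
  push_cast at this
  rw [this, prod_range_succ', qPoch_natCast, mul_comm]
  congr 1
  · simp
  · refine prod_congr rfl fun i _ => ?_
    rw [pow_succ]; ring

/-- At negative j the new factor cancels one in the denominator, so it must be nonzero; this is why
all integer powers of q are excluded. -/
theorem qPoch_add_one (ha : ∀ i : ℤ, a * q ^ i ≠ 1) (j : ℤ) :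
    qPoch a q (j + 1) = qPoch a q j * (1 - a * q ^ j) := by
  have h : ∀ i : ℤ, 1 - a * q ^ i ≠ 0 := fun i => sub_ne_zero.mpr (ha i).symm
  obtain j | j := j
  · simpa using qPoch_succ a q j
  · rcases j with _ | j
    · have e : (Int.negSucc 0 + 1 : ℤ) = 0 := rfl
      rw [e, qPoch_zero, qPoch_negSucc]
      have := h (-1)
      simp only [Int.reduceNegSucc, zero_add, range_one, prod_singleton, Nat.cast_zero]
      exact (inv_mul_cancel₀ this).symm
    · have e : (Int.negSucc (j + 1) + 1 : ℤ) = Int.negSucc j := rfl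
      rw [e, qPoch_negSucc, qPoch_negSucc, prod_range_succ _ (j + 1)]
      have e2 : Int.negSucc (j + 1) = -(((j + 1 : ℕ) : ℤ) + 1) := by
        rw [Int.negSucc_eq]
      rw [e2, mul_inv]
      have := h (-(((j + 1 : ℕ) : ℤ) + 1))
      field_simp

theorem qPoch_natCast_ne_zero {j : ℕ} (h : ∀ i < j, a * q ^ i ≠ 1) : qPoch a q j ≠ 0 := by
  rw [qPoch_natCast, prod_ne_zero_iff]
  intro i hi
  exact sub_ne_zero.mpr (h i (mem_range.mp hi)).symm

theorem qPoch_ne_zero (h : ∀ i : ℤ, a * q ^ i ≠ 1) (j : ℤ) : qPoch a q j ≠ 0 := by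
  obtain j | j := j
  · exact qPoch_natCast_ne_zero fun i _ => by simpa using h i
  · rw [qPoch_negSucc]
    refine inv_ne_zero (prod_ne_zero_iff.mpr fun i _ => sub_ne_zero.mpr (h _).symm)

theorem qPoch_self_ne_zero (h : ∀ i : ℕ, q ^ (i + 1) ≠ 1) (j : ℕ) : qPoch q q j ≠ 0 :=
  qPoch_natCast_ne_zero fun i _ => by rw [← pow_succ']; exact h i

theorem phiTerm_one_one (a c q x : F) (j : ℕ) : phiTerm [a] [c] q x j
    = qPoch a q j / (qPoch q q j * qPoch c q j) * ((-1) ^ j * q ^ (j.choose 2)) * x ^ j := by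
  simp [phiTerm]

theorem phiTerm_one_one_mul_right (a c q x y : F) (j : ℕ) :
    phiTerm [a] [c] q (x * y) j = y ^ j * phiTerm [a] [c] q x j := by
  simp only [phiTerm_one_one, mul_pow]; ring

/-- With `phiTerm_one_one_lower_den` and `phiTerm_one_one_raise_all`, this is the termwise content
of the contiguous relations. It serves both the formal series and the convergent ones, since passing
from n to n + 1 multiplies the j-th term by q^j. -/
theorem phiTerm_one_one_raise_num (a c q x : F) (j : ℕ) :
    (1 - a * q ^ j) * phiTerm [a] [c] q x j = (1 - a) * phiTerm [a * q] [c] q x j := by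
  have h : (1 - a * q ^ j) * qPoch a q j = (1 - a) * qPoch (a * q) q j := by
    rw [← qPoch_succ', qPoch_succ, mul_comm]
  simp only [phiTerm_one_one]
  linear_combination (q ^ (j.choose 2) * (-1) ^ j * x ^ j / (qPoch q q j * qPoch c q j)) * h

theorem phiTerm_one_one_lower_den (a q x : F) {c : F} (hc : ∀ i : ℕ, c * q ^ i ≠ 1) (j : ℕ) :
    (1 - c * q ^ j) * phiTerm [a] [c * q] q x j = (1 - c) * phiTerm [a] [c] q x j := by
  have h : (1 - c * q ^ j) * qPoch c q j = (1 - c) * qPoch (c * q) q j := by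
    rw [← qPoch_succ', qPoch_succ, mul_comm]
  have h1 : qPoch c q j ≠ 0 := qPoch_natCast_ne_zero fun i _ => hc i
  have h2 : qPoch (c * q) q j ≠ 0 := qPoch_natCast_ne_zero fun i _ => by
    rw [mul_assoc, ← pow_succ']; exact hc _
  have h3 : (1 - c * q ^ j) * (qPoch (c * q) q j)⁻¹ = (1 - c) * (qPoch c q j)⁻¹ := by
    field_simp
    linear_combination h
  simp only [phiTerm_one_one, div_eq_mul_inv, mul_inv]
  linear_combination (q ^ (j.choose 2) * (-1) ^ j * x ^ j * qPoch a q j * (qPoch q q j)⁻¹) * h3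

theorem phiTerm_one_one_succ (a x : F) {c q : F} (hq : ∀ i : ℕ, q ^ (i + 1) ≠ 1)
    (hc : ∀ i : ℕ, c * q ^ i ≠ 1) (j : ℕ) :
    (1 - q ^ (j + 1)) * (1 - c * q ^ j) * phiTerm [a] [c] q x (j + 1)
      = -((1 - a * q ^ j) * q ^ j * x) * phiTerm [a] [c] q x j := by
  have h1 : 1 - c * q ^ j ≠ 0 := sub_ne_zero.mpr (hc j).symm
  have h2 : 1 - q ^ (j + 1) ≠ 0 := sub_ne_zero.mpr (hq j).symm
  have h3 : qPoch c q j ≠ 0 := qPoch_natCast_ne_zero fun i _ => hc i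
  have h4 : qPoch q q j ≠ 0 := qPoch_self_ne_zero hq j
  have e : 1 - q * q ^ j = 1 - q ^ (j + 1) := by rw [pow_succ']
  simp only [phiTerm_one_one, Nat.cast_add, Nat.cast_one, qPoch_succ, e]
  rw [Nat.choose_succ_succ' j 1, Nat.choose_one_right, pow_add q j (j.choose (1 + 1)), pow_succ (-1 : F) j,
    pow_succ x j]
  generalize 1 - q ^ (j + 1) = r at *
  generalize 1 - c * q ^ j = t at *
  field_simp

theorem phiTerm_one_one_raise_all (a x : F) {c q : F} (hq : ∀ i : ℕ, q ^ (i + 1) ≠ 1)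
    (hc : ∀ i : ℕ, c * q ^ i ≠ 1) (j : ℕ) :
    (1 - c) * ((1 - q ^ (j + 1)) * phiTerm [a] [c] q x (j + 1))
      = -((1 - a) * x) * phiTerm [a * q] [c * q] q (x * q) j := by
  have h1 : 1 - c * q ^ j ≠ 0 := sub_ne_zero.mpr (hc j).symm
  have e1 := phiTerm_one_one_succ a x hq hc j
  have e2 := phiTerm_one_one_raise_num a (c * q) q x j
  have e3 := phiTerm_one_one_lower_den a q x hc j
  rw [phiTerm_one_one_mul_right]
  apply mul_left_cancel₀ h1
  linear_combination (1 - c) * e1 - x * q ^ j * (1 - c * q ^ j) * e2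
    + x * q ^ j * (1 - a * q ^ j) * e3

end

/-! ### The two formal solutions of the contiguous relations. -/

section
open PowerSeries
variable {K : Type*} [Field K] {a c q : K}

theorem Generic.pow_ne (h : Generic a c q) (i : ℕ) : q ^ (i + 1) ≠ 1 := by
  have := h.qn (i + 1) (by omega)
  exact_mod_cast this

theorem Generic.cn_shift (h : Generic a c q) (m : ℤ) (i : ℕ) : c * q ^ m * q ^ i ≠ 1 := by
  have := h.cn (m + i)
  rwa [zpow_add₀ h.q0, zpow_natCast, ← mul_assoc] at this

/-- The formal series `₁φ₁(a; c; q, z X)`. -/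
def serPhi (a c q z : K) : K⟦X⟧ := mk fun j => phiTerm [a] [c] q z j

theorem serPhi_raise_num (h : Generic a c q) (k m n : ℤ) :
    serPhi (a * q ^ k) (c * q ^ m) q (q ^ n)
        - C (a * q ^ k) * serPhi (a * q ^ k) (c * q ^ m) q (q ^ (n + 1))
      = C (1 - a * q ^ k) * serPhi (a * q ^ (k + 1)) (c * q ^ m) q (q ^ n) := by
  ext j
  simp only [serPhi, LinearMap.map_sub, coeff_C_mul, coeff_mk, zpow_add_one₀ h.q0,
    phiTerm_one_one_mul_right, ← mul_assoc]
  linear_combination phiTerm_one_one_raise_num (a * q ^ k) (c * q ^ m) q (q ^ n) j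

theorem serPhi_lower_den (h : Generic a c q) (k m n : ℤ) :
    serPhi (a * q ^ k) (c * q ^ m) q (q ^ n)
        - C (c * q ^ (m - 1)) * serPhi (a * q ^ k) (c * q ^ m) q (q ^ (n + 1))
      = C (1 - c * q ^ (m - 1)) * serPhi (a * q ^ k) (c * q ^ (m - 1)) q (q ^ n) := by
  have e : c * q ^ m = c * q ^ (m - 1) * q := by
    rw [mul_assoc, ← zpow_add_one₀ h.q0, sub_add_cancel]
  ext j
  simp only [e, serPhi, LinearMap.map_sub, coeff_C_mul, coeff_mk, zpow_add_one₀ h.q0,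
    phiTerm_one_one_mul_right]
  linear_combination phiTerm_one_one_lower_den (a * q ^ k) q (q ^ n) (h.cn_shift (m - 1)) j

theorem serPhi_raise_all (h : Generic a c q) (k m n : ℤ) :
    C (1 - c * q ^ m) * (serPhi (a * q ^ k) (c * q ^ m) q (q ^ n)
        - serPhi (a * q ^ k) (c * q ^ m) q (q ^ (n + 1)))
      = -(C (q ^ n * (1 - a * q ^ k)) * X)
        * serPhi (a * q ^ (k + 1)) (c * q ^ (m + 1)) q (q ^ (n + 1)) := by
  ext j
  rw [neg_mul, map_neg, mul_assoc, coeff_C_mul, coeff_C_mul]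
  rcases j with _ | j
  · simp [serPhi, phiTerm_one_one]
  · simp only [coeff_succ_X_mul, serPhi, LinearMap.map_sub, coeff_mk, zpow_add_one₀ h.q0,
      ← mul_assoc, phiTerm_one_one_mul_right (a * q ^ k) (c * q ^ m)]
    linear_combination phiTerm_one_one_raise_all (a * q ^ k) (q ^ n) h.pow_ne (h.cn_shift m) j

/-- The coefficients of the second solution. -/
def secondCoeff (a c q : K) (k m n j : ℤ) : K :=
  qPoch (a * q / c) q (j + k - m) * qPoch c q m * qPoch (c / q) q (m - j)
      / (qPoch q q j * qPoch a q k) * c ^ (-n) * q ^ ((j - m + 1) * (n - 1) + 1)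

/-- The second solution is `X ^ (-m) * serSecond a c q k m n`. -/
def serSecond (a c q : K) (k m n : ℤ) : K⟦X⟧ := mk fun j => secondCoeff a c q k m n j

theorem Generic.an' (h : Generic a c q) (i : ℤ) : a * q / c * q ^ i ≠ 1 := by
  have := h.acn (i + 1)
  have hc := h.c0
  intro h'
  apply this
  rw [zpow_add_one₀ h.q0]
  field_simp at h'
  linear_combination h'

theorem Generic.cn' (h : Generic a c q) (i : ℤ) : c / q * q ^ i ≠ 1 := by
  have := h.cn (i - 1)
  rwa [zpow_sub_one₀ h.q0, ← div_eq_mul_inv, ← mul_div_assoc, mul_div_right_comm] at this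

/-- The classical second solution carries a factor x^(1-γ) with q^γ = c. Only its multiplier q/c
under x ↦ qx matters, and the powers of c and q in `secondCoeff` record it, so that no fractional
power is needed. -/
theorem secondCoeff_scale (h : Generic a c q) (k m n j : ℤ) :
    secondCoeff a c q k m (n + 1) j = q ^ (j - m + 1) / c * secondCoeff a c q k m n j := by
  have hc := h.c0
  have e : (j - m + 1) * (n + 1 - 1) + 1 = (j - m + 1) + ((j - m + 1) * (n - 1) + 1) := by ring
  rw [secondCoeff, secondCoeff, e, zpow_add₀ h.q0, neg_add, zpow_add₀ hc, zpow_neg_one]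
  ring

theorem secondCoeff_raise_num (h : Generic a c q) (k m n j : ℤ) :
    (1 - a * q ^ k * (q ^ (j - m + 1) / c)) * secondCoeff a c q k m n j
      = (1 - a * q ^ k) * secondCoeff a c q (k + 1) m n j := by
  have h1 := qPoch_add_one h.an' (j + k - m)
  have h2 := qPoch_add_one h.an k
  have h3 : 1 - a * q ^ k ≠ 0 := sub_ne_zero.mpr (h.an k).symm
  have h4 := qPoch_ne_zero h.an k
  have e : a * q ^ k * (q ^ (j - m + 1) / c) = a * q / c * q ^ (j + k - m) := by
    rw [show j + k - m = k + (j - m) by ring, zpow_add₀ h.q0 k, zpow_add_one₀ h.q0]; ring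
  rw [secondCoeff, secondCoeff, e, show j + (k + 1) - m = j + k - m + 1 by ring, h1, h2]
  simp only [div_eq_mul_inv, mul_inv]
  field_simp

theorem secondCoeff_lower_den (h : Generic a c q) (k m n : ℤ) (j : ℕ) :
    (1 - q ^ ((j : ℤ) + 1)) * secondCoeff a c q k m n (j + 1)
      = (1 - c * q ^ (m - 1)) * secondCoeff a c q k (m - 1) n j := by
  have h1 := qPoch_add_one h.cn (m - 1)
  have h2 := qPoch_succ q q j
  have h3 : 1 - q ^ (j + 1) ≠ 0 := sub_ne_zero.mpr (h.pow_ne j).symm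
  have h4 := qPoch_self_ne_zero h.pow_ne j
  have e : q ^ ((j : ℤ) + 1) = q ^ (j + 1) := by exact_mod_cast rfl
  rw [sub_add_cancel] at h1
  rw [secondCoeff, secondCoeff, e, h1, h2, ← pow_succ',
    show (j : ℤ) + 1 + k - m = j + k - (m - 1) by ring, show m - (j + 1 : ℤ) = m - 1 - j by ring,
    show (j : ℤ) + 1 - m + 1 = j - (m - 1) + 1 by ring]
  simp only [div_eq_mul_inv, mul_inv]
  field_simp

theorem secondCoeff_raise_all (h : Generic a c q) (k m n j : ℤ) :
    (1 - c * q ^ m) * ((1 - q ^ (j - m + 1) / c) * secondCoeff a c q k m n j)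
      = -(q ^ n * (1 - a * q ^ k)) * secondCoeff a c q (k + 1) (m + 1) (n + 1) j := by
  have h1 := qPoch_add_one h.cn m
  have h2 := qPoch_add_one h.an k
  have h5 := qPoch_add_one h.cn' (m - j)
  have h3 : 1 - a * q ^ k ≠ 0 := sub_ne_zero.mpr (h.an k).symm
  have h4 := qPoch_ne_zero h.an k
  have hc := h.c0
  have hq := h.q0
  have e1 : q ^ ((j - (m + 1) + 1) * (n + 1 - 1) + 1) * q ^ n
      = q ^ ((j - m + 1) * (n - 1) + 1) * q ^ (j - m + 1) := by
    rw [← zpow_add₀ hq, ← zpow_add₀ hq]; ring_nf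
  have e2 : q ^ (m - j) * q ^ (j - m + 1) = q := by
    rw [← zpow_add₀ hq, show m - j + (j - m + 1) = 1 by ring, zpow_one]
  have e3 : c ^ (-n) = c ^ (-(n + 1)) * c := by rw [← zpow_add_one₀ hc]; ring_nf
  rw [secondCoeff, secondCoeff, show j + (k + 1) - (m + 1) = j + k - m by ring,
    show m + 1 - j = m - j + 1 by ring, h1, h2, h5, e3]
  generalize q ^ ((j - (m + 1) + 1) * (n + 1 - 1) + 1) = E1 at *
  generalize q ^ ((j - m + 1) * (n - 1) + 1) = E at *
  generalize q ^ (j - m + 1) = Z at *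
  generalize q ^ (m - j) = M at *
  generalize 1 - a * q ^ k = t at *
  simp only [div_eq_mul_inv, mul_inv]
  generalize (qPoch q q j)⁻¹ = Q
  field_simp
  linear_combination (1 - c * q ^ m) * qPoch (a * q / c) q (j + k - m) * qPoch c q m
    * qPoch (c / q) q (m - j) * Q * ((q - c * M) * e1 - c * E * e2)

theorem serSecond_raise_num (h : Generic a c q) (k m n : ℤ) :
    serSecond a c q k m n - C (a * q ^ k) * serSecond a c q k m (n + 1)
      = C (1 - a * q ^ k) * serSecond a c q (k + 1) m n := by
  ext j
  simp only [serSecond, LinearMap.map_sub, coeff_C_mul, coeff_mk, secondCoeff_scale h]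
  linear_combination secondCoeff_raise_num h k m n j

/-- The extra X comes from X^(-m) at m - 1. At index 0 the left side vanishes because its factor is
1 - q^0. -/
theorem serSecond_lower_den (h : Generic a c q) (k m n : ℤ) :
    serSecond a c q k m n - C (c * q ^ (m - 1)) * serSecond a c q k m (n + 1)
      = C (1 - c * q ^ (m - 1)) * (X * serSecond a c q k (m - 1) n) := by
  have hc := h.c0
  have e : ∀ j : ℤ, c * q ^ (m - 1) * (q ^ (j - m + 1) / c) = q ^ j := fun j => by
    have : q ^ (m - 1) * q ^ (j - m + 1) = q ^ j := by
      rw [← zpow_add₀ h.q0]; ring_nf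
    rw [← this]
    field_simp
  ext j
  rw [coeff_C_mul]
  rcases j with _ | j
  · simp only [serSecond, LinearMap.map_sub, coeff_C_mul, coeff_mk, secondCoeff_scale h, ← mul_assoc, e]
    simp
  · simp only [serSecond, LinearMap.map_sub, coeff_C_mul, coeff_mk, secondCoeff_scale h, coeff_succ_X_mul,
      ← mul_assoc, e]
    push_cast
    linear_combination secondCoeff_lower_den h k m n j

theorem serSecond_raise_all (h : Generic a c q) (k m n : ℤ) :
    C (1 - c * q ^ m) * (serSecond a c q k m n - serSecond a c q k m (n + 1))
      = -C (q ^ n * (1 - a * q ^ k)) * serSecond a c q (k + 1) (m + 1) (n + 1) := by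
  ext j
  rw [neg_mul, map_neg]
  simp only [serSecond, LinearMap.map_sub, coeff_C_mul, coeff_mk, secondCoeff_scale h k m]
  linear_combination secondCoeff_raise_all h k m n j

variable {L : Type*} [Field L] (ι : K⟦X⟧ →+* L)

theorem isContig_serPhi (h : Generic a c q) :
    IsContig (ι (C a)) (ι (C c)) (ι (C q)) (ι X)
      (fun k m n => ι (serPhi (a * q ^ k) (c * q ^ m) q (q ^ n))) := by
  have e : ∀ n : ℤ, ι (C q) ^ n = ι (C (q ^ n)) := fun n =>
    (map_zpow₀ (ι.comp (C : K →+* K⟦X⟧)) q n).symm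
  refine ⟨fun k m n => ?_, fun k m n => ?_, fun k m n => ?_⟩
  · have := congrArg ι (serPhi_raise_num h k m n)
    simpa only [map_sub, map_mul, map_one, ← e] using this
  · have := congrArg ι (serPhi_lower_den h k m n)
    simpa only [map_sub, map_mul, map_one, ← e] using this
  · have := congrArg ι (serPhi_raise_all h k m n)
    simp only [map_sub, map_mul, map_one, ← e, map_neg] at this ⊢
    linear_combination this

theorem isContig_serSecond (h : Generic a c q) (hX : ι X ≠ 0) :
    IsContig (ι (C a)) (ι (C c)) (ι (C q)) (ι X)
      (fun k m n => ι X ^ (-m) * ι (serSecond a c q k m n)) := by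
  have e : ∀ n : ℤ, ι (C q) ^ n = ι (C (q ^ n)) := fun n =>
    (map_zpow₀ (ι.comp (C : K →+* K⟦X⟧)) q n).symm
  refine ⟨fun k m n => ?_, fun k m n => ?_, fun k m n => ?_⟩
  · have := congrArg ι (serSecond_raise_num h k m n)
    simp only [map_sub, map_mul, map_one, ← e] at this
    linear_combination ι X ^ (-m) * this
  · have := congrArg ι (serSecond_lower_den h k m n)
    simp only [map_sub, map_mul, map_one, ← e] at this
    rw [show -(m - 1) = -m + 1 by ring, zpow_add_one₀ hX]
    linear_combination ι X ^ (-m) * this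
  · have := congrArg ι (serSecond_raise_all h k m n)
    simp only [map_sub, map_mul, map_one, ← e, map_neg] at this ⊢
    rw [show -(m + 1) = -m - 1 by ring, zpow_sub_one₀ hX]
    field_simp
    linear_combination this

end
end QHyp

/-! ### The formal q-exponential and Heine's transformation. -/

namespace QHyp

open Finset PowerSeries

section
variable {K : Type*} [Field K] {a c q : K}

/-- The formal `q`-exponential `∑ (-1)^j q^(j choose 2) z^j X^j / (q; q)_j`, that is
`(z X; q)_∞`. -/
def expSer (q z : K) : K⟦X⟧ := mk fun j => (-1) ^ j * q ^ (j.choose 2) * z ^ j / qPoch q q j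

theorem coeff_expSer_succ (hq : ∀ i : ℕ, q ^ (i + 1) ≠ 1) (z : K) (j : ℕ) :
    (1 - q ^ (j + 1)) * coeff (j + 1) (expSer q z) = -(z * q ^ j) * coeff j (expSer q z) := by
  have h2 : 1 - q ^ (j + 1) ≠ 0 := sub_ne_zero.mpr (hq j).symm
  have h4 : qPoch q q j ≠ 0 := qPoch_self_ne_zero hq j
  have e : 1 - q * q ^ j = 1 - q ^ (j + 1) := by rw [pow_succ']
  simp only [expSer, coeff_mk, Nat.cast_add, Nat.cast_one, qPoch_succ, e]
  rw [Nat.choose_succ_succ' j 1, Nat.choose_one_right, pow_add q j (j.choose (1 + 1)),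
    pow_succ (-1 : K) j, pow_succ z j]
  generalize 1 - q ^ (j + 1) = r at *
  field_simp

theorem expSer_coeff_zero (q z : K) : coeff 0 (expSer q z) = 1 := by
  simp [expSer]

/-- The functional equation is a first order recurrence for the coefficients, and 1 - q^(j+1) ≠ 0
makes it solvable. This identifies the Casoratian up to its constant term. -/
theorem eq_expSer (hq : ∀ i : ℕ, q ^ (i + 1) ≠ 1) {z : K} {W : K⟦X⟧}
    (hW : W = (1 - C z * X) * rescale q W) : W = C (coeff 0 W) * expSer q z := by
  ext j
  rw [coeff_C_mul]
  induction j with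
  | zero => rw [expSer_coeff_zero, mul_one]
  | succ j ih =>
    have h2 : 1 - q ^ (j + 1) ≠ 0 := sub_ne_zero.mpr (hq j).symm
    have := congrArg (coeff (j + 1)) hW
    rw [sub_mul, one_mul, LinearMap.map_sub, mul_assoc, coeff_C_mul, coeff_succ_X_mul,
      coeff_rescale, coeff_rescale] at this
    apply mul_left_cancel₀ h2
    rw [mul_left_comm, coeff_expSer_succ hq]
    linear_combination this - z * q ^ j * ih

theorem expSer_rescale (q z y : K) : rescale y (expSer q z) = expSer q (z * y) := by
  ext j
  simp only [coeff_rescale, expSer, coeff_mk, mul_pow]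
  ring

theorem expSer_eq (hq : ∀ i : ℕ, q ^ (i + 1) ≠ 1) (z : K) :
    expSer q z = (1 - C z * X) * expSer q (z * q) := by
  rw [← expSer_rescale]
  ext j
  rw [sub_mul, one_mul, LinearMap.map_sub, mul_assoc, coeff_C_mul]
  rcases j with _ | j
  · simp [coeff_rescale]
  · rw [coeff_succ_X_mul, coeff_rescale, coeff_rescale]
    linear_combination coeff_expSer_succ hq z j

theorem expSer_ne_zero (q z : K) : expSer q z ≠ 0 := by
  intro h
  have := expSer_coeff_zero q z
  simp [h] at this

theorem coeff_serPhi_zero (a c q z : K) : coeff 0 (serPhi a c q z) = 1 := by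
  simp [serPhi, phiTerm_one_one]

theorem eq_serPhi {z : K} (hq : ∀ i : ℕ, q ^ (i + 1) ≠ 1) (hc : ∀ i : ℕ, c * q ^ i ≠ 1)
    {f : K⟦X⟧} (hf : ∀ j, (1 - q ^ (j + 1)) * (1 - c * q ^ j) * coeff (j + 1) f
      = -((1 - a * q ^ j) * q ^ j * z) * coeff j f) :
    f = C (coeff 0 f) * serPhi a c q z := by
  ext j
  rw [coeff_C_mul]
  induction j with
  | zero => rw [coeff_serPhi_zero, mul_one]
  | succ j ih =>
    have h1 : 1 - c * q ^ j ≠ 0 := sub_ne_zero.mpr (hc j).symm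
    have h2 : 1 - q ^ (j + 1) ≠ 0 := sub_ne_zero.mpr (hq j).symm
    apply mul_left_cancel₀ (mul_ne_zero h2 h1)
    have := phiTerm_one_one_succ a z hq hc j
    rw [hf, mul_left_comm]
    simp only [serPhi, coeff_mk] at this ih ⊢
    rw [this]
    linear_combination -((1 - a * q ^ j) * q ^ j * z) * ih

/-- The formal series `₂φ₁(c / a, 0; c; q, a z X / c)`. -/
def serEuler (a c q z : K) : K⟦X⟧ :=
  mk fun j => qPoch (c / a) q j / (qPoch q q j * qPoch c q j) * (a * z / c) ^ j

theorem coeff_serEuler_zero (a c q z : K) : coeff 0 (serEuler a c q z) = 1 := by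
  simp [serEuler]

theorem coeff_serEuler_succ (a z : K) (hq : ∀ i : ℕ, q ^ (i + 1) ≠ 1)
    (hc : ∀ i : ℕ, c * q ^ i ≠ 1) (j : ℕ) :
    (1 - q ^ (j + 1)) * (1 - c * q ^ j) * coeff (j + 1) (serEuler a c q z)
      = (1 - c / a * q ^ j) * (a * z / c) * coeff j (serEuler a c q z) := by
  have h1 : 1 - c * q ^ j ≠ 0 := sub_ne_zero.mpr (hc j).symm
  have h2 : 1 - q ^ (j + 1) ≠ 0 := sub_ne_zero.mpr (hq j).symm
  have h3 : qPoch c q j ≠ 0 := qPoch_natCast_ne_zero fun i _ => hc i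
  have h4 : qPoch q q j ≠ 0 := qPoch_self_ne_zero hq j
  have e : 1 - q * q ^ j = 1 - q ^ (j + 1) := by rw [pow_succ']
  simp only [serEuler, coeff_mk, Nat.cast_add, Nat.cast_one, qPoch_succ, e]
  generalize 1 - q ^ (j + 1) = r at *
  generalize 1 - c * q ^ j = t at *
  generalize 1 - c / a * q ^ j = s at *
  rw [pow_succ]
  generalize a * z / c = y at *
  field_simp

/-- Heine's (Euler's) transformation of `₁φ₁`. -/
theorem serPhi_eq_expSer_mul (ha : a ≠ 0) (hc0 : c ≠ 0) (hq0 : q ≠ 0) (z : K)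
    (hq : ∀ i : ℕ, q ^ (i + 1) ≠ 1) (hc : ∀ i : ℕ, c * q ^ i ≠ 1) :
    serPhi a c q z = expSer q (a * z / c) * serEuler a c q z := by
  set Z := a * z / c with hZ
  have hzZ : z = Z * (c / a) := by rw [hZ]; field_simp
  set g := serEuler a c q z with hg
  set E := expSer q Z with hE
  have hE1 : E = (1 - C Z * X) * rescale q E := by rw [hE, expSer_rescale, ← expSer_eq hq]
  have hE2 : rescale q E = (1 - C (Z * q) * X) * rescale q (rescale q E) := by
    rw [hE, expSer_rescale, expSer_rescale, ← expSer_eq hq]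
  -- The q-difference equation of `serEuler`. Multiplying by the q-exponential, which contributes
  -- one factor 1 - ZX per rescaling, turns it into that of ₁φ₁.
  have hg2 : C (c / q) * rescale q (rescale q g) + (C z * X - 1 - C (c / q)) * rescale q g
      + (1 - C Z * X) * g = 0 := by
    ext j
    simp only [sub_mul, one_mul, mul_assoc, LinearMap.map_add, LinearMap.map_sub, coeff_C_mul,
      coeff_rescale, map_zero]
    rcases j with _ | j
    · simp
    · simp only [coeff_succ_X_mul, coeff_rescale]
      have h1 := coeff_serEuler_succ a z hq hc j
      rw [← hg, ← hZ] at h1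
      have h2 : c / q * q ^ (j + 1) = c * q ^ j := by rw [pow_succ]; field_simp
      have h3 : z = Z * (c / a) := hzZ
      linear_combination h1 + (q ^ (j + 1) - 1) * coeff (j + 1) g * h2 + q ^ j * coeff j g * h3
  have hy : C (c / q) * (1 - C (Z * q) * X) * rescale q (rescale q (E * g))
      + (C z * X - 1 - C (c / q)) * rescale q (E * g) + E * g = 0 := by
    simp only [map_mul (rescale q)]
    linear_combination (rescale q E) * hg2 + g * hE1
      - C (c / q) * rescale q (rescale q g) * hE2
  have h0 : coeff 0 (E * g) = 1 := by
    have h1 := expSer_coeff_zero q Z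
    have h2 := coeff_serEuler_zero a c q z
    rw [coeff_zero_eq_constantCoeff_apply] at h1 h2 ⊢
    rw [map_mul, hE, hg, h1, h2, one_mul]
  -- Read coefficientwise, the difference equation `hy` is the recurrence that characterises ₁φ₁ up
  -- to its constant term, here 1.
  have := eq_serPhi (a := a) (z := z) hq hc (f := E * g) (by
    intro j
    have h1 := congrArg (coeff (j + 1)) hy
    simp only [sub_mul, mul_sub, mul_one, one_mul, mul_assoc, LinearMap.map_add,
      LinearMap.map_sub, coeff_C_mul, map_zero, coeff_succ_X_mul, coeff_rescale] at h1
    have h2 : c / q * q ^ (j + 1) = c * q ^ j := by rw [pow_succ]; field_simp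
    have h3 : c / q * (Z * q) = a * z := by rw [hZ]; field_simp
    linear_combination h1 + (1 - q ^ (j + 1)) * coeff (j + 1) (E * g) * h2
      + q ^ (2 * j) * coeff j (E * g) * h3)
  rw [this, h0, map_one, one_mul]

theorem secondCoeff_succ (h : Generic a c q) (k m n : ℤ) (j : ℕ) :
    (1 - q ^ (j + 1)) * (1 - q ^ (2 - m) / c * q ^ j) * secondCoeff a c q k m n (j + 1)
      = -((1 - a * q ^ (k - m + 1) / c * q ^ j) * q ^ j * (q ^ (n - m + 1) / c))
        * secondCoeff a c q k m n j := by
  have hc := h.c0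
  have hq := h.q0
  have h1 := qPoch_succ q q j
  have h2 := qPoch_add_one h.an' (j + k - m)
  have h3 := qPoch_add_one h.cn' (m - (j + 1))
  have h4 : 1 - q ^ (j + 1) ≠ 0 := sub_ne_zero.mpr (h.pow_ne j).symm
  have h5 := qPoch_self_ne_zero h.pow_ne j
  have e1 : q ^ (((j : ℤ) + 1 - m + 1) * (n - 1) + 1)
      = q ^ (((j : ℤ) - m + 1) * (n - 1) + 1) * q ^ (n - 1) := by
    rw [← zpow_add₀ hq]; ring_nf
  have e2 : a * q / c * q ^ ((j : ℤ) + k - m) = a * q ^ (k - m + 1) / c * q ^ j := by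
    rw [show (j : ℤ) + k - m = (k - m) + j by ring, zpow_add₀ hq, zpow_add_one₀ hq, zpow_natCast]
    ring
  have e3 : q ^ j * q ^ (n - m + 1) = q ^ (2 - m) * q ^ j * q ^ (n - 1) := by
    rw [mul_right_comm, ← zpow_add₀ hq, mul_comm]; ring_nf
  have e4 : c / q * q ^ (m - ((j : ℤ) + 1)) * (q ^ (2 - m) * q ^ j) = c := by
    have : q ^ (m - ((j : ℤ) + 1)) * (q ^ (2 - m) * q ^ j) = q := by
      rw [← zpow_natCast, ← zpow_add₀ hq, ← zpow_add₀ hq]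
      ring_nf; simp
    rw [mul_assoc, this]; field_simp
  rw [show m - ((j : ℤ) + 1) + 1 = m - j by ring] at h3
  rw [e2] at h2
  rw [secondCoeff, secondCoeff, show (j : ℤ) + 1 + k - m = j + k - m + 1 by ring, h1, h2, h3, e1,
    ← pow_succ']
  generalize q ^ (((j : ℤ) - m + 1) * (n - 1) + 1) = E at *
  generalize c / q * q ^ (m - ((j : ℤ) + 1)) = M at *
  generalize a * q ^ (k - m + 1) / c * q ^ j = B at *
  generalize q ^ (n - m + 1) = D at *
  generalize q ^ (2 - m) = Z at *
  generalize 1 - q ^ (j + 1) = r at *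
  generalize q ^ (n - 1) = N at *
  simp only [div_eq_mul_inv, mul_inv]
  generalize (qPoch a q k)⁻¹ = Q
  field_simp
  linear_combination qPoch (a * q / c) q (j + k - m) * (1 - B) * qPoch c q m
    * qPoch (c / q) q (m - (j + 1)) * Q * E * ((1 - M) * e3 - N * e4)

theorem Generic.second_cn (h : Generic a c q) (m : ℤ) (i : ℕ) : q ^ (2 - m) / c * q ^ i ≠ 1 := by
  have hc := h.c0
  have hq := h.q0
  intro h'
  apply h.cn (m - 2 - i)
  have e : q ^ (m - 2 - i) * (q ^ (2 - m) * q ^ i) = 1 := by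
    rw [← zpow_natCast, ← zpow_add₀ hq, ← zpow_add₀ hq]; ring_nf; simp
  field_simp at h'
  rwa [h', mul_comm] at e

/-- The second solution is itself a ₁φ₁, so Heine's transformation applies to it as well. -/
theorem serSecond_eq (h : Generic a c q) (k m n : ℤ) : serSecond a c q k m n
    = C (secondCoeff a c q k m n 0)
      * serPhi (a * q ^ (k - m + 1) / c) (q ^ (2 - m) / c) q (q ^ (n - m + 1) / c) := by
  have := eq_serPhi (a := a * q ^ (k - m + 1) / c) (c := q ^ (2 - m) / c)
    (z := q ^ (n - m + 1) / c) h.pow_ne (h.second_cn m) (f := serSecond a c q k m n) (by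
      intro j
      simp only [serSecond, coeff_mk]
      exact_mod_cast secondCoeff_succ h k m n j)
  rw [this]
  simp [serSecond]

end
end QHyp

/-! ### Coefficients of products as terminating ₃φ₂ series. -/

namespace QHyp

open Finset PowerSeries

section
variable {K : Type*} [Field K] {a c q : K}

theorem phiTerm_three_two (a b d e f q z : K) (i : ℕ) : phiTerm [a, b, d] [e, f] q z i
    = qPoch a q i * qPoch b q i * qPoch d q i / (qPoch q q i * qPoch e q i * qPoch f q i)
      * z ^ i := by
  simp [phiTerm, mul_assoc]

theorem phiTerm_three_two_succ (a b d z : K) {e f q : K} (hq : ∀ i : ℕ, q ^ (i + 1) ≠ 1)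
    (he : ∀ i : ℕ, e * q ^ i ≠ 1) (hf : ∀ i : ℕ, f * q ^ i ≠ 1) (i : ℕ) :
    (1 - q ^ (i + 1)) * (1 - e * q ^ i) * (1 - f * q ^ i)
        * phiTerm [a, b, d] [e, f] q z (i + 1)
      = (1 - a * q ^ i) * (1 - b * q ^ i) * (1 - d * q ^ i) * z
        * phiTerm [a, b, d] [e, f] q z i := by
  have h1 : 1 - e * q ^ i ≠ 0 := sub_ne_zero.mpr (he i).symm
  have h2 : 1 - q ^ (i + 1) ≠ 0 := sub_ne_zero.mpr (hq i).symm
  have h3 : 1 - f * q ^ i ≠ 0 := sub_ne_zero.mpr (hf i).symm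
  have h4 : qPoch e q i ≠ 0 := qPoch_natCast_ne_zero fun i _ => he i
  have h5 : qPoch f q i ≠ 0 := qPoch_natCast_ne_zero fun i _ => hf i
  have h6 : qPoch q q i ≠ 0 := qPoch_self_ne_zero hq i
  simp only [phiTerm_three_two, Nat.cast_add, Nat.cast_one, qPoch_succ, ← pow_succ' q i]
  rw [pow_succ z]
  generalize 1 - q ^ (i + 1) = r at *
  generalize 1 - e * q ^ i = s at *
  generalize 1 - f * q ^ i = t at *
  field_simp

/-- A convolution of two hypergeometric sequences is a terminating `₃φ₂`. -/
theorem sum_antidiagonal_eq_phi32 (hq0 : q ≠ 0) (hq : ∀ i : ℕ, q ^ (i + 1) ≠ 1)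
    {U V ρ v : ℕ → K} {γ δ b d e f z : K} {j : ℕ} (hV0 : V 0 = 1)
    (hU : ∀ i, (1 - q ^ (i + 1)) * (1 - γ * q ^ i) * U (i + 1) = (1 - δ * q ^ i) * ρ i * U i)
    (hV : ∀ i, (1 - q ^ (i + 1)) * (1 - e * q ^ i) * V (i + 1) = (1 - d * q ^ i) * v i * V i)
    (he : ∀ i : ℕ, e * q ^ i ≠ 1) (hδ : ∀ i : ℤ, δ * q ^ i ≠ 1) (hρ : ∀ i, ρ i ≠ 0)
    (hb : b * γ * q ^ j = q) (hf : f * δ * q ^ j = q)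
    (hz : ∀ i N, i + N + 1 = j → z * δ * ρ N = -(q ^ (N + 1) * γ * v i)) :
    ∑ p ∈ antidiagonal j, V p.1 * U p.2 = U j * phi32 j b d e f q z := by
  have hf' : ∀ i : ℕ, f * q ^ i ≠ 1 := by
    intro i h
    apply hδ ((j : ℤ) - 1 - i)
    rw [zpow_sub₀ hq0, zpow_sub_one₀ hq0, zpow_natCast, zpow_natCast]
    have : q ^ i ≠ 0 := pow_ne_zero _ hq0
    field_simp
    linear_combination (-δ * q ^ j) * h + q ^ i * hf
  have key : ∀ i, i ≤ j → V i * U (j - i)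
      = U j * phiTerm [q ^ (-(j : ℤ)), b, d] [e, f] q z i := by
    intro i
    induction i with
    | zero => intro _; simp [hV0, phiTerm_three_two]
    | succ i ih =>
      intro hi
      obtain ⟨N, hN⟩ : ∃ N, i + N + 1 = j := ⟨j - (i + 1), by omega⟩
      have ih := ih (by omega)
      rw [show j - (i + 1) = N by omega]
      rw [show j - i = N + 1 by omega] at ih
      have e1 := phiTerm_three_two_succ (q ^ (-(j : ℤ))) b d z hq he hf' i
      have hA : q ^ (-(j : ℤ)) * q ^ i * q ^ (N + 1) = 1 := by
        rw [mul_assoc, ← pow_add, show i + (N + 1) = j by omega, ← zpow_natCast,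
          ← zpow_add₀ hq0]
        simp
      have hb' : b * q ^ i * (γ * q ^ N) = 1 := by
        apply mul_left_cancel₀ hq0
        have h' := hb
        rw [← hN] at h'
        linear_combination h'
      have hf'' : f * q ^ i * (δ * q ^ N) = 1 := by
        apply mul_left_cancel₀ hq0
        have h' := hf
        rw [← hN] at h'
        linear_combination h'
      have hz' := hz i N hN
      have n1 : 1 - e * q ^ i ≠ 0 := sub_ne_zero.mpr (he i).symm
      have n2 : 1 - q ^ (i + 1) ≠ 0 := sub_ne_zero.mpr (hq i).symm
      have n3 : 1 - f * q ^ i ≠ 0 := sub_ne_zero.mpr (hf' i).symm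
      have n4 : 1 - δ * q ^ N ≠ 0 := by
        have := hδ N
        rw [zpow_natCast] at this
        exact sub_ne_zero.mpr this.symm
      have hU' := hU N
      have hV' := hV i
      generalize phiTerm [q ^ (-(j : ℤ)), b, d] [e, f] q z i = t0 at *
      generalize phiTerm [q ^ (-(j : ℤ)), b, d] [e, f] q z (i + 1) = t1 at *
      -- Equality of the two ratios. Reversal turns each factor 1 - yq^N into a monomial times 1 -
      -- y'q^i with yy'q^(N+i) = 1; `hb` and `hf` say that b and f are the reversed parameters, and
      -- `hz` collects the monomials into z.
      have main : (1 - q ^ (N + 1)) * (1 - γ * q ^ N) * v i * (1 - f * q ^ i)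
          = (1 - δ * q ^ N) * ρ N * (1 - q ^ (-(j : ℤ)) * q ^ i) * (1 - b * q ^ i) * z := by
        have r1 : 1 - q ^ (N + 1) = -q ^ (N + 1) * (1 - q ^ (-(j : ℤ)) * q ^ i) := by
          linear_combination -hA
        have r2 : 1 - γ * q ^ N = -(γ * q ^ N) * (1 - b * q ^ i) := by
          linear_combination -hb'
        have r3 : 1 - δ * q ^ N = -(δ * q ^ N) * (1 - f * q ^ i) := by
          linear_combination -hf''
        rw [r1, r2, r3]
        linear_combination (q ^ N * (1 - f * q ^ i) * (1 - q ^ (-(j : ℤ)) * q ^ i)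
          * (1 - b * q ^ i)) * hz'
      apply mul_left_cancel₀ (mul_ne_zero (mul_ne_zero n4 (hρ N))
        (mul_ne_zero (mul_ne_zero n2 n1) n3))
      linear_combination (1 - δ * q ^ N) * ρ N * (1 - f * q ^ i) * U N * hV'
        - (1 - d * q ^ i) * v i * V i * (1 - f * q ^ i) * hU'
        + (1 - d * q ^ i) * V i * U (N + 1) * main
        + (1 - δ * q ^ N) * ρ N * (1 - q ^ (-(j : ℤ)) * q ^ i) * (1 - b * q ^ i)
          * (1 - d * q ^ i) * z * ih
        - (1 - δ * q ^ N) * ρ N * U j * e1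
  rw [Finset.Nat.sum_antidiagonal_eq_sum_range_succ_mk, phi32, mul_sum, Int.toNat_natCast]
  refine sum_congr rfl fun i hi => ?_
  exact key i (by simpa [Nat.lt_succ_iff] using hi)

theorem Generic.an_shift (h : Generic a c q) (k m : ℤ) (i : ℤ) :
    a * q ^ (k - m + 1) / c * q ^ i ≠ 1 := by
  have := h.an' (k - m + i)
  rwa [show a * q / c * q ^ (k - m + i) = a * q ^ (k - m + 1) / c * q ^ i by
    rw [zpow_add₀ h.q0, zpow_add_one₀ h.q0]; ring] at this

theorem Generic.second_num_ne_zero (h : Generic a c q) (k m : ℤ) :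
    a * q ^ (k - m + 1) / c ≠ 0 :=
  div_ne_zero (mul_ne_zero h.a0 (zpow_ne_zero _ h.q0)) h.c0

theorem Generic.second_den_ne_zero (h : Generic a c q) (m : ℤ) : q ^ (2 - m) / c ≠ 0 :=
  div_ne_zero (zpow_ne_zero _ h.q0) h.c0

theorem coeff_serPhi_succ (a z : K) (hq : ∀ i : ℕ, q ^ (i + 1) ≠ 1)
    (hc : ∀ i : ℕ, c * q ^ i ≠ 1) (j : ℕ) :
    (1 - q ^ (j + 1)) * (1 - c * q ^ j) * coeff (j + 1) (serPhi a c q z)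
      = -((1 - a * q ^ j) * q ^ j * z) * coeff j (serPhi a c q z) := by
  simpa [serPhi] using phiTerm_one_one_succ a z hq hc j

/-- The prefactor of B_j: the ₁φ₁ form of the second solution replaces (c/q;q)_{-j} by a factorial
in q²/c. -/
theorem secondCoeff_zero_eq (h : Generic a c q) (j : ℕ) : secondCoeff a c q 0 0 0 j
    = qPoch (a * q / c) q j / (qPoch q q j * qPoch (q ^ 2 / c) q j)
      * (-1) ^ j * c ^ (-(j : ℤ)) * q ^ (((j : ℤ) + 1).toNat.choose 2) := by
  have e := congrArg (coeff j) (serSecond_eq h 0 0 0)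
  simp only [serSecond, coeff_mk, coeff_C_mul, serPhi, phiTerm_one_one] at e
  have e0 : secondCoeff a c q 0 0 0 0 = 1 := by simp [secondCoeff]
  rw [e, e0, show ((j : ℤ) + 1).toNat = j + 1 by omega, Nat.choose_succ_succ' j 1,
    Nat.choose_one_right, pow_add, zpow_neg, zpow_natCast]
  simp only [sub_zero, zero_add, zpow_one, div_pow]
  rw [show q ^ (2 : ℤ) = q ^ 2 from zpow_ofNat q 2, one_mul]
  simp only [div_eq_mul_inv]
  ring

/-- The coefficients `A_j` are those of a product of the two solutions. -/
theorem coeff_mul_eq_coeffA (h : Generic a c q) (k m n : ℤ) (j : ℕ) :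
    coeff j (serPhi a c q 1 * (C (secondCoeff a c q k m n 0) * serEuler (a * q ^ (k - m + 1) / c)
      (q ^ (2 - m) / c) q (q ^ (n - m + 1) / c))) = coeffA k m n a c q j := by
  have ha := h.a0
  have hc := h.c0
  have hq := h.q0
  have e1 : q ^ (2 - m) / c / (a * q ^ (k - m + 1) / c) = q ^ (1 - k) / a := by
    rw [show (2 : ℤ) - m = (1 - k) + (k - m + 1) by ring, zpow_add₀ hq]
    have := zpow_ne_zero (k - m + 1) hq
    field_simp
  have e2 : a * q ^ (k - m + 1) / c * (q ^ (n - m + 1) / c) / (q ^ (2 - m) / c)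
      = a * q ^ (k - m + n) / c := by
    have : q ^ (k - m + 1) * q ^ (n - m + 1) = q ^ (k - m + n) * q ^ (2 - m) := by
      rw [← zpow_add₀ hq, ← zpow_add₀ hq]; ring_nf
    have := zpow_ne_zero (2 - m) hq
    field_simp
    linear_combination ‹q ^ (k - m + 1) * q ^ (n - m + 1) = _›
  have hδ : ∀ i : ℤ, q ^ (1 - k) / a * q ^ i ≠ 1 := by
    intro i h'
    apply h.an (k - 1 - i)
    have : q ^ (k - 1 - i) * (q ^ (1 - k) * q ^ i) = 1 := by
      rw [← zpow_add₀ hq, ← zpow_add₀ hq]; ring_nf; simp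
    field_simp at h'
    rwa [h', mul_comm] at this
  have hU : ∀ i : ℕ, (1 - q ^ (i + 1)) * (1 - q ^ (2 - m) / c * q ^ i)
      * (coeff (i + 1) (C (secondCoeff a c q k m n 0) * serEuler (a * q ^ (k - m + 1) / c)
      (q ^ (2 - m) / c) q (q ^ (n - m + 1) / c)))
      = (1 - q ^ (1 - k) / a * q ^ i) * (a * q ^ (k - m + n) / c)
      * (coeff i (C (secondCoeff a c q k m n 0) * serEuler (a * q ^ (k - m + 1) / c)
      (q ^ (2 - m) / c) q (q ^ (n - m + 1) / c))) := by
    intro i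
    have := coeff_serEuler_succ (a * q ^ (k - m + 1) / c) (q ^ (n - m + 1) / c) h.pow_ne
      (h.second_cn m) i
    rw [e1, e2] at this
    rw [coeff_C_mul, coeff_C_mul]
    linear_combination secondCoeff a c q k m n 0 * this
  -- Heine's form has factorials in q^(1-k)/a and q^(2-m)/c. Reversing their factors gives
  -- (a;q)_{k-i} in the denominator and (c/q;q)_{m-i} in the numerator, as in A_j.
  have hpre : ∀ i : ℕ, coeff i (C (secondCoeff a c q k m n 0) * serEuler (a * q ^ (k - m + 1) / c)
      (q ^ (2 - m) / c) q (q ^ (n - m + 1) / c))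
      = qPoch (a * q / c) q (k - m) * qPoch c q m * qPoch (c / q) q (m - i)
      / (qPoch q q i * qPoch a q (k - i))
      * c ^ (-n) * q ^ ((i - m + 1) * (n - 1) + 1) := by
    intro i
    induction i with
    | zero =>
      rw [coeff_C_mul, coeff_serEuler_zero, mul_one]
      simp [secondCoeff]
    | succ i ih =>
      have n1 : 1 - q ^ (i + 1) ≠ 0 := sub_ne_zero.mpr (h.pow_ne i).symm
      have n2 : 1 - q ^ (2 - m) / c * q ^ i ≠ 0 := sub_ne_zero.mpr (h.second_cn m i).symm
      apply mul_left_cancel₀ (mul_ne_zero n1 n2)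
      rw [hU, ih]
      have h1 := qPoch_succ q q i
      have h2 := qPoch_add_one h.an (k - (i + 1))
      have h3 := qPoch_add_one h.cn' (m - (i + 1))
      have n3 := qPoch_self_ne_zero h.pow_ne i
      have n4 := qPoch_ne_zero h.an (k - (i + 1))
      have n5 : 1 - a * q ^ (k - (i + 1)) ≠ 0 := sub_ne_zero.mpr (h.an _).symm
      have x1 : q ^ (((i : ℤ) + 1 - m + 1) * (n - 1) + 1)
          = q ^ (((i : ℤ) - m + 1) * (n - 1) + 1) * q ^ (n - 1) := by
        rw [← zpow_add₀ hq]; ring_nf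
      have x2 : q ^ (1 - k) / a * q ^ i * (a * q ^ (k - ((i : ℤ) + 1))) = 1 := by
        have : q ^ (1 - k) * q ^ i * q ^ (k - ((i : ℤ) + 1)) = 1 := by
          rw [← zpow_natCast, ← zpow_add₀ hq, ← zpow_add₀ hq]; ring_nf; simp
        field_simp
        linear_combination this
      have x3 : q ^ (2 - m) / c * q ^ i * (c / q * q ^ (m - ((i : ℤ) + 1))) = 1 := by
        have : q ^ (2 - m) * q ^ i * q ^ (m - ((i : ℤ) + 1)) = q := by
          rw [← zpow_natCast, ← zpow_add₀ hq, ← zpow_add₀ hq]; ring_nf; simp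
        field_simp
        linear_combination this
      have x4 : q ^ (1 - k) / a * q ^ i * (a * q ^ (k - m + n) / c)
          = q ^ (2 - m) / c * q ^ i * q ^ (n - 1) := by
        have : q ^ (1 - k) * q ^ (k - m + n) = q ^ (2 - m) * q ^ (n - 1) := by
          rw [← zpow_add₀ hq, ← zpow_add₀ hq]; ring_nf
        field_simp
        linear_combination this
      rw [show k - ((i : ℤ) + 1) + 1 = k - i by ring] at h2
      rw [show m - ((i : ℤ) + 1) + 1 = m - i by ring] at h3
      push_cast
      rw [h1, h2, h3, x1, ← pow_succ']
      generalize 1 - q ^ (i + 1) = r at *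
      generalize q ^ (1 - k) / a * q ^ i = y1 at *
      generalize q ^ (2 - m) / c * q ^ i = y2 at *
      generalize c / q * q ^ (m - ((i : ℤ) + 1)) = y3 at *
      generalize a * q ^ (k - ((i : ℤ) + 1)) = y4 at *
      generalize a * q ^ (k - m + n) / c = y5 at *
      generalize q ^ (((i : ℤ) - m + 1) * (n - 1) + 1) = y6 at *
      have t1 : 1 - y1 = -(y1 * (1 - y4)) := by linear_combination -x2
      have t2 : 1 - y2 = -(y2 * (1 - y3)) := by linear_combination -x3
      rw [t1, t2]
      field_simp
      linear_combination -(1 - y3) * qPoch (a * q / c) q (k - m) * qPoch c q m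
        * qPoch (c / q) q (m - (i + 1)) * y6 * x4
  rw [coeff_mul]
  rw [sum_antidiagonal_eq_phi32 (γ := q ^ (2 - m) / c) (δ := q ^ (1 - k) / a) (e := c) (d := a)
    (v := fun i => -q ^ i) (ρ := fun _ => a * q ^ (k - m + n) / c) (b := c * q ^ (m - j - 1))
    (f := a * q ^ (k - j)) (z := q ^ ((j : ℤ) - n + 1)) (U := fun i => coeff i _)
    (V := fun i => coeff i _) hq h.pow_ne (coeff_serPhi_zero _ _ _ _) hU]
  · rw [coeffA, if_neg (by omega), hpre]
  · intro i
    rw [coeff_serPhi_succ _ _ h.pow_ne (by simpa using h.cn_shift 0)]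
    ring
  · simpa using h.cn_shift 0
  · exact hδ
  · intro i
    exact div_ne_zero (mul_ne_zero ha (zpow_ne_zero _ hq)) hc
  · have : q ^ (m - j - 1) * q ^ (2 - m) * q ^ j = q := by
      rw [← zpow_natCast, ← zpow_add₀ hq, ← zpow_add₀ hq]; ring_nf; simp
    field_simp
    linear_combination this
  · have : q ^ (k - j) * q ^ (1 - k) * q ^ j = q := by
      rw [← zpow_natCast, ← zpow_add₀ hq, ← zpow_add₀ hq]; ring_nf; simp
    field_simp
    linear_combination this
  · intro i N hN
    have : q ^ ((j : ℤ) - n + 1) * q ^ (1 - k) * q ^ (k - m + n)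
        = q ^ (N + 1) * q ^ (2 - m) * q ^ i := by
      rw [← hN]; push_cast
      simp only [← zpow_natCast, ← zpow_add₀ hq]; congr 1; push_cast; ring
    field_simp
    linear_combination this

/-- The coefficients `B_j` are those of a product of the two solutions. -/
theorem coeff_mul_eq_coeffB (h : Generic a c q) (k m n : ℤ) (j : ℕ) :
    coeff j (serEuler (a * q ^ k) (c * q ^ m) q (q ^ n) * serSecond a c q 0 0 0)
      = coeffB k m n a c q j := by
  have ha := h.a0
  have hc := h.c0
  have hq := h.q0
  have hk := zpow_ne_zero k hq
  have hm := zpow_ne_zero m hq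
  have e1 : c * q ^ m / (a * q ^ k) = c * q ^ (m - k) / a := by
    rw [zpow_sub₀ hq]; field_simp
  have e2 : a * q ^ k * q ^ n / (c * q ^ m) = a * q ^ (k - m + n) / c := by
    rw [zpow_add₀ hq, zpow_sub₀ hq]; field_simp
  rw [coeff_mul]
  rw [sum_antidiagonal_eq_phi32 (γ := q ^ 2 / c) (δ := a * q / c) (e := c * q ^ m)
    (d := c * q ^ (m - k) / a) (v := fun i => a * q ^ (k - m + n) / c)
    (ρ := fun i => -(q ^ i * (q / c))) (b := c * q ^ (-(j : ℤ) - 1))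
    (f := c * q ^ (-(j : ℤ)) / a) (z := q ^ (k - m + n + 1)) (U := fun i => coeff i _)
    (V := fun i => coeff i _) hq h.pow_ne (coeff_serEuler_zero _ _ _ _)]
  · rw [coeffB, if_neg (by omega), serSecond, coeff_mk, secondCoeff_zero_eq h,
      zpow_natCast (-1 : K)]
  · intro i
    have := secondCoeff_succ h 0 0 0 i
    simp only [serSecond, coeff_mk]
    push_cast
    simp only [sub_zero, zero_add, zpow_one] at this
    rw [show q ^ (2 : ℤ) = q ^ 2 from zpow_ofNat q 2] at this
    rw [this]
    ring
  · intro i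
    rw [coeff_serEuler_succ _ _ h.pow_ne (h.cn_shift m), e1, e2]
  · exact h.cn_shift m
  · exact h.an'
  · intro i
    exact neg_ne_zero.mpr (mul_ne_zero (pow_ne_zero _ hq) (div_ne_zero hq hc))
  · have : q ^ (-(j : ℤ) - 1) * q * q ^ j = 1 := by
      rw [← zpow_natCast, ← zpow_add_one₀ hq, ← zpow_add₀ hq]; simp
    field_simp
    linear_combination this
  · have : q ^ (-(j : ℤ)) * q ^ j = 1 := by
      rw [← zpow_natCast, ← zpow_add₀ hq]; simp
    field_simp
    linear_combination this
  · intro i N hN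
    rw [zpow_add_one₀ hq]
    field_simp
    ring

/-- The coefficients `Ã_j` are those of a product of the two solutions. -/
theorem coeff_mul_eq_coeffA' (h : Generic a c q) (k m n : ℤ) (j : ℕ) :
    coeff j (serEuler a c q 1 * serSecond a c q k m n) = coeffA' k m n a c q j := by
  have ha := h.a0
  have hc := h.c0
  have hq := h.q0
  rw [coeff_mul]
  rw [sum_antidiagonal_eq_phi32 (γ := q ^ (2 - m) / c) (δ := a * q ^ (k - m + 1) / c) (e := c)
    (d := c / a) (v := fun i => a / c)
    (ρ := fun i => -(q ^ i * (q ^ (n - m + 1) / c))) (b := c * q ^ (m - j - 1))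
    (f := c * q ^ (m - k - j) / a) (z := q ^ (m - k - n + 1)) (U := fun i => coeff i _)
    (V := fun i => coeff i _) hq h.pow_ne (coeff_serEuler_zero _ _ _ _)]
  · rw [coeffA', if_neg (by omega), serSecond, coeff_mk, secondCoeff]
  · intro i
    have := secondCoeff_succ h k m n i
    simp only [serSecond, coeff_mk]
    push_cast
    rw [this]
    ring
  · intro i
    rw [coeff_serEuler_succ _ _ h.pow_ne (by simpa using h.cn_shift 0), mul_one]
  · simpa using h.cn_shift 0
  · exact h.an_shift k m
  · intro i
    exact neg_ne_zero.mpr (mul_ne_zero (pow_ne_zero _ hq)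
      (div_ne_zero (zpow_ne_zero _ hq) hc))
  · have : q ^ (m - j - 1) * q ^ (2 - m) * q ^ j = q := by
      rw [← zpow_natCast, ← zpow_add₀ hq, ← zpow_add₀ hq]; ring_nf; simp
    field_simp
    linear_combination this
  · have : q ^ (m - k - j) * q ^ (k - m + 1) * q ^ j = q := by
      rw [← zpow_natCast, ← zpow_add₀ hq, ← zpow_add₀ hq]; ring_nf; simp
    field_simp
    linear_combination this
  · intro i N hN
    have : q ^ (m - k - n + 1) * q ^ (k - m + 1) * q ^ (n - m + 1) = q * q ^ (2 - m) := by
      rw [← zpow_one_add₀ hq, ← zpow_add₀ hq, ← zpow_add₀ hq]; ring_nf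
    rw [pow_succ]
    field_simp
    linear_combination -this

/-- The coefficients `B̃_j` are those of a product of the two solutions. -/
theorem coeff_mul_eq_coeffB' (h : Generic a c q) (k m n : ℤ) (j : ℕ) :
    coeff j (serPhi (a * q ^ k) (c * q ^ m) q (q ^ n)
      * serEuler (a * q / c) (q ^ 2 / c) q (q / c)) = coeffB' k m n a c q j := by
  have ha := h.a0
  have hc := h.c0
  have hq := h.q0
  have e1 : q ^ 2 / c / (a * q / c) = q / a := by field_simp
  have e2 : a * q / c * (q / c) / (q ^ 2 / c) = a / c := by field_simp
  have hγ : ∀ i : ℕ, q ^ 2 / c * q ^ i ≠ 1 := by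
    have := h.second_cn 0
    rwa [sub_zero, show q ^ (2 : ℤ) = q ^ 2 from zpow_ofNat q 2] at this
  rw [coeff_mul]
  rw [sum_antidiagonal_eq_phi32 (γ := q ^ 2 / c) (δ := q / a) (e := c * q ^ m)
    (d := a * q ^ k) (v := fun i => -(q ^ i * q ^ n))
    (ρ := fun i => a / c) (b := c * q ^ (-(j : ℤ) - 1))
    (f := a * q ^ (-(j : ℤ))) (z := q ^ ((j : ℤ) + n + 1)) (U := fun i => coeff i _)
    (V := fun i => coeff i _) hq h.pow_ne (coeff_serPhi_zero _ _ _ _)]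
  · rw [coeffB', if_neg (by omega), serEuler, coeff_mk, e1, e2, div_pow, zpow_neg c, zpow_natCast c,
      zpow_natCast a]
    simp only [div_eq_mul_inv]
    ring
  · intro i
    rw [coeff_serEuler_succ _ _ h.pow_ne hγ, e1, e2]
  · intro i
    rw [coeff_serPhi_succ _ _ h.pow_ne (h.cn_shift m)]
    ring
  · exact h.cn_shift m
  · intro i h'
    apply h.an (-1 - i)
    have : q ^ (-1 - i) * (q * q ^ i) = 1 := by
      rw [← zpow_one_add₀ hq, ← zpow_add₀ hq]; ring_nf; simp
    field_simp at h'
    rwa [h', mul_comm] at this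
  · intro i
    exact div_ne_zero ha hc
  · have : q ^ (-(j : ℤ) - 1) * q * q ^ j = 1 := by
      rw [← zpow_natCast, ← zpow_add_one₀ hq, ← zpow_add₀ hq]; simp
    field_simp
    linear_combination this
  · have : q ^ (-(j : ℤ)) * q ^ j = 1 := by
      rw [← zpow_natCast, ← zpow_add₀ hq]; simp
    field_simp
    linear_combination this
  · intro i N hN
    have : q ^ ((j : ℤ) + n + 1) = q ^ (N + 1) * q * (q ^ i * q ^ n) := by
      rw [← hN]
      simp only [← zpow_natCast, ← zpow_add₀ hq, ← zpow_add_one₀ hq]; congr 1; push_cast; ring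
    field_simp
    linear_combination this

end
end QHyp

/-! ### The Casoratian and its power series. -/

namespace QHyp

open Finset PowerSeries

section
variable {K : Type*} [Field K] {a c q : K} {L : Type*} [Field L]

/-- The Casoratian of the two formal solutions, divided by `(a X / c; q)_∞`. -/
def casoratian (ι : K⟦X⟧ →+* L) (a c q : K) (k m n : ℤ) : L :=
  (ι (expSer q (a / c)))⁻¹ * (ι (serPhi a c q 1) * (ι X ^ (-m) * ι (serSecond a c q k m n)))
    + -(ι (expSer q (a / c)))⁻¹
      * (ι (serSecond a c q 0 0 0) * ι (serPhi (a * q ^ k) (c * q ^ m) q (q ^ n)))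

variable {ι : K⟦X⟧ →+* L}

theorem isContig_casoratian (h : Generic a c q) (hι : Function.Injective ι) :
    IsContig (ι (C a)) (ι (C c)) (ι (C q)) (ι X) (casoratian ι a c q) := by
  have hX : ι X ≠ 0 := (map_ne_zero_iff ι hι).mpr X_ne_zero
  exact ((((isContig_serSecond ι h hX).smul (ι (serPhi a c q 1))).smul _).add
    (((isContig_serPhi ι h).smul (ι (serSecond a c q 0 0 0))).smul _))

theorem casoratian_zero (a c q : K) : casoratian ι a c q 0 0 0 = 0 := by
  simp only [casoratian, neg_zero, zpow_zero, mul_one]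
  ring

theorem serPhi_rescale (a c q z y : K) : rescale y (serPhi a c q z) = serPhi a c q (z * y) := by
  ext j
  simp only [coeff_rescale, serPhi, coeff_mk, phiTerm_one_one_mul_right]

theorem serSecond_succ (h : Generic a c q) (n : ℤ) :
    serSecond a c q 0 0 (n + 1) = C (q / c) * rescale q (serSecond a c q 0 0 n) := by
  ext j
  simp only [coeff_C_mul, coeff_rescale, serSecond, coeff_mk, secondCoeff_scale h]
  rw [sub_zero, zpow_add_one₀ h.q0, zpow_natCast]
  ring

theorem serPhi_succ (h : Generic a c q) (n : ℤ) :
    serPhi a c q (q ^ (n + 1)) = rescale q (serPhi a c q (q ^ n)) := by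
  rw [serPhi_rescale, zpow_add_one₀ h.q0]

/-- The Casoratian W of a second order q-difference equation satisfies a first order one, here W(X)
= (1 - aqX/c)W(qX). Hence W is its constant term q/c - 1 times (aqX/c;q)_∞, and division by
(aX/c;q)_∞ leaves a single linear factor in the denominator. -/
theorem casoratian_zero_zero_one (h : Generic a c q) (hι : Function.Injective ι) :
    casoratian ι a c q 0 0 1 * ι (1 - C (a / c) * X) = ι (C (q / c - 1)) := by
  have hX : ι X ≠ 0 := (map_ne_zero_iff ι hι).mpr X_ne_zero
  have hc := h.c0
  have hq := h.q0
  set s := serSecond a c q 0 0 0 with hs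
  set f := serPhi a c q 1 with hf
  set W : K⟦X⟧ := C (q / c) * rescale q s * f - rescale q f * s with hW
  have d1 := (isContig_serPhi ι h).difference 0 0 0
  have d2 := (isContig_serSecond ι h hX).difference 0 0 0
  have s1 := serSecond_succ h 0
  have s2 := serSecond_succ h (0 + 1)
  have f1 := serPhi_succ h 0
  have f2 := serPhi_succ h (0 + 1)
  rw [add_assoc, one_add_one_eq_two] at s2 f2
  simp only [zpow_zero, mul_one, neg_zero, one_mul] at d1 d2 f1 f2
  have eqc : ι (C c) * ι (C q) ^ ((0 : ℤ) - 1) = ι (C (c / q)) := by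
    have : (ι (C q))⁻¹ = ι (C q⁻¹) := (map_inv₀ (ι.comp C) q).symm
    rw [zero_sub, zpow_neg_one, div_eq_mul_inv, map_mul, map_mul, this]
  rw [f2, f1, eqc] at d1
  rw [s2, s1, eqc] at d2
  rw [← hf] at d1
  rw [← hs] at d2
  simp only [← map_mul, ← map_sub, ← map_add, ← map_one ι] at d1 d2
  have d1' := hι (d1.trans (map_zero ι).symm)
  have d2' := hι (d2.trans (map_zero ι).symm)
  have cc : C (c / q) * C (q / c) = (1 : K⟦X⟧) := by
    rw [← map_mul, ← map_one C]; congr 1; field_simp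
  have ac : C a * C (q / c) = (C (a / c * q) : K⟦X⟧) := by
    rw [← map_mul]; congr 1; field_simp
  have hr : rescale q (C (q / c)) = C (q / c) := by
    ext j; rw [coeff_rescale, coeff_C]; split_ifs with hj <;> simp [hj]
  simp only [map_mul (rescale q), hr] at d2'
  have hWeq : W = (1 - C (a / c * q) * X) * rescale q W := by
    rw [hW, map_sub]
    simp only [map_mul (rescale q), hr]
    linear_combination C (q / c) * rescale q s * d1' - rescale q f * d2'
      + (C (q / c) * rescale q f * rescale q (rescale q s)
        - rescale q (rescale q f) * rescale q s) * (cc - X * ac)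
  have hW0 : coeff 0 W = q / c - 1 := by
    have h1 : constantCoeff s = 1 := by
      rw [hs, ← coeff_zero_eq_constantCoeff_apply, serSecond, coeff_mk]
      simp [secondCoeff]
    have h2 : constantCoeff f = 1 := by
      rw [hf, ← coeff_zero_eq_constantCoeff_apply, coeff_serPhi_zero]
    have h3 : ∀ g : K⟦X⟧, constantCoeff (rescale q g) = constantCoeff g := fun g => by
      rw [← coeff_zero_eq_constantCoeff_apply, coeff_rescale]; simp
    rw [hW, coeff_zero_eq_constantCoeff_apply]
    simp [h1, h2, h3]
  have := eq_expSer h.pow_ne hWeq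
  rw [hW0] at this
  have he := expSer_eq h.pow_ne (a / c)
  have he0 : ι (expSer q (a / c)) ≠ 0 := (map_ne_zero_iff ι hι).mpr (expSer_ne_zero _ _)
  have hcas : casoratian ι a c q 0 0 1 * ι (expSer q (a / c)) = ι W := by
    rw [casoratian, ← hs, ← hf, ← zero_add (1 : ℤ), s1, zpow_zero, mul_one, mul_one, f1, hW, ← hs,
      ← hf]
    simp only [map_sub, map_mul, neg_zero, zpow_zero]
    field_simp
    ring
  apply mul_right_cancel₀ he0
  rw [mul_right_comm, hcas, this, ← map_mul, ← map_mul, he]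
  congr 1
  ring

theorem expSer_eq_prod (hq : ∀ i : ℕ, q ^ (i + 1) ≠ 1) (z : K) (l : ℕ) :
    expSer q z = (∏ i ∈ range l, (1 - C (z * q ^ i) * X)) * expSer q (z * q ^ l) := by
  induction l with
  | zero => simp
  | succ l ih => rw [prod_range_succ, mul_assoc, pow_succ, ← mul_assoc z, ← expSer_eq hq, ← ih]

/-- The power series whose truncation is `P^{(1,1)}`. -/
def serP (k m n : ℤ) (a c q : K) : K⟦X⟧ := PowerSeries.mk fun j =>
  if 0 ≤ k - m + n then
    coeffA k m n a c q ((j : ℤ) + min m 0) - coeffB k m n a c q ((j : ℤ) - max m 0)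
  else
    coeffA' k m n a c q ((j : ℤ) + min m 0) - coeffB' k m n a c q ((j : ℤ) - max m 0)

theorem X_pow_mul_mk (f : ℤ → K) (hf : ∀ j < 0, f j = 0) (l : ℕ) :
    X ^ l * PowerSeries.mk (fun j : ℕ => f j) = PowerSeries.mk (fun j : ℕ => f ((j : ℤ) - l)) := by
  ext j
  rw [coeff_X_pow_mul']
  simp only [coeff_mk]
  split_ifs with hj
  · rw [Nat.cast_sub hj]
  · rw [hf _ (by omega)]

/-- With l = max(k-m+n, 0), the factors (aX/c;q)_l cleared here leave E = (aq^l X/c;q)_∞ in the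
denominator, and Heine's transformation extracts the same E from both products. For k-m+n ≥ 0 it is
applied to the two series at (k,m,n), for k-m+n < 0 to the two series at (0,0,0). This is the origin
of the two cases in P^(1,1). -/
theorem casoratian_eq (h : Generic a c q) (hι : Function.Injective ι) (k m n : ℤ) :
    casoratian ι a c q k m n * ι X ^ (max m 0)
        * ι (∏ i ∈ range (max (k - m + n) 0).toNat, (1 - C (a / c * q ^ i) * X))
      = ι (serP k m n a c q) := by
  have hX : ι X ≠ 0 := (map_ne_zero_iff ι hι).mpr X_ne_zero
  have he0 : ι (expSer q (a / c)) ≠ 0 := (map_ne_zero_iff ι hι).mpr (expSer_ne_zero _ _)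
  have hc := h.c0
  have ha := h.a0
  have hq := h.q0
  set l := (max (k - m + n) 0).toNat with hl
  have hz1 : a * q ^ k * q ^ n / (c * q ^ m) = a / c * q ^ (k - m + n) := by
    have := zpow_ne_zero m hq
    rw [zpow_add₀ hq, zpow_sub₀ hq]; field_simp
  have hz2 : a * q ^ (k - m + 1) / c * (q ^ (n - m + 1) / c) / (q ^ (2 - m) / c)
      = a / c * q ^ (k - m + n) := by
    have : q ^ (k - m + 1) * q ^ (n - m + 1) = q ^ (k - m + n) * q ^ (2 - m) := by
      rw [← zpow_add₀ hq, ← zpow_add₀ hq]; ring_nf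
    have := zpow_ne_zero (2 - m) hq
    field_simp
    linear_combination ‹q ^ (k - m + 1) * q ^ (n - m + 1) = _›
  -- The powers of X left on the two products are X^(-min(m,0)) and X^(max(m,0)); they become the
  -- index shifts of A and B.
  have hpow : ι X ^ (-m) * ι X ^ (max m 0) = ι (X ^ (-min m 0).toNat) := by
    rw [← zpow_add₀ hX, map_pow, ← zpow_natCast]; congr 1; omega
  have hpow2 : ι X ^ (max m 0) = ι (X ^ (max m 0).toNat) := by
    rw [map_pow, ← zpow_natCast]; congr 1; omega
  set E := expSer q (a / c * q ^ l) with hE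
  have hprod : ι (expSer q (a / c)) = ι (∏ i ∈ range l, (1 - C (a / c * q ^ i) * X)) * ι E := by
    rw [← map_mul, ← expSer_eq_prod h.pow_ne]
  rw [hprod] at he0
  have hE0 := right_ne_zero_of_mul he0
  have hP0 := left_ne_zero_of_mul he0
  suffices hs : X ^ (-min m 0).toNat * (serPhi a c q 1 * serSecond a c q k m n)
      - X ^ (max m 0).toNat * (serPhi (a * q ^ k) (c * q ^ m) q (q ^ n) * serSecond a c q 0 0 0)
      = E * serP k m n a c q by
    have hs' := congrArg ι hs
    simp only [map_sub, map_mul, ← hpow, ← hpow2] at hs'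
    rw [casoratian, hprod]
    apply mul_left_cancel₀ hE0
    rw [← hs']
    generalize ι (∏ i ∈ range l, (1 - C (a / c * q ^ i) * X)) = R at *
    field_simp
    ring
  have hshift : ∀ (f g : ℤ → K), (∀ j < 0, f j = 0) → (∀ j < 0, g j = 0) →
      X ^ (-min m 0).toNat * PowerSeries.mk (fun j : ℕ => f j) - X ^ (max m 0).toNat * PowerSeries.mk (fun j : ℕ => g j)
      = PowerSeries.mk fun j : ℕ => f ((j : ℤ) + min m 0) - g ((j : ℤ) - max m 0) := by
    intro f g hf hg
    rw [X_pow_mul_mk f hf, X_pow_mul_mk g hg]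
    ext j
    rw [LinearMap.map_sub, coeff_mk, coeff_mk, coeff_mk]
    congr 2 <;> omega
  by_cases hL : 0 ≤ k - m + n
  · have hl' : a / c * q ^ (k - m + n) = a / c * q ^ l := by
      rw [← zpow_natCast]; congr 2; omega
    have e1 := serSecond_eq h k m n
    rw [serPhi_eq_expSer_mul (h.second_num_ne_zero k m) (h.second_den_ne_zero m) hq _ h.pow_ne
      (h.second_cn m), hz2, hl', ← hE] at e1
    have e2 := serPhi_eq_expSer_mul (mul_ne_zero ha (zpow_ne_zero k hq))
      (mul_ne_zero hc (zpow_ne_zero m hq)) hq (q ^ n) h.pow_ne (h.cn_shift m)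
    rw [hz1, hl', ← hE] at e2
    have eA : serPhi a c q 1 * (C (secondCoeff a c q k m n 0)
        * serEuler (a * q ^ (k - m + 1) / c) (q ^ (2 - m) / c) q (q ^ (n - m + 1) / c))
        = PowerSeries.mk fun j : ℕ => coeffA k m n a c q j := by
      ext j
      rw [coeff_mul_eq_coeffA h, coeff_mk]
    have eB : serEuler (a * q ^ k) (c * q ^ m) q (q ^ n) * serSecond a c q 0 0 0
        = PowerSeries.mk fun j : ℕ => coeffB k m n a c q j := by
      ext j
      rw [coeff_mul_eq_coeffB h, coeff_mk]
    rw [e1, e2]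
    simp only [serP, hL, if_true]
    rw [← hshift _ _ (fun j hj => by rw [coeffA, if_pos hj])
      (fun j hj => by rw [coeffB, if_pos hj]), ← eA, ← eB]
    ring
  · have hl0 : l = 0 := by omega
    rw [hl0, pow_zero, mul_one] at hE
    have e1 := serPhi_eq_expSer_mul ha hc hq 1 h.pow_ne (by simpa using h.cn_shift 0)
    rw [mul_one, ← hE] at e1
    have e2 := serSecond_eq h 0 0 0
    have e3 : secondCoeff a c q 0 0 0 0 = 1 := by simp [secondCoeff]
    simp only [sub_zero, zero_add, zpow_one] at e2
    rw [show q ^ (2 : ℤ) = q ^ 2 from zpow_ofNat q 2, e3, map_one, one_mul,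
      serPhi_eq_expSer_mul (by simpa using h.second_num_ne_zero 0 0)
      (by simpa [hq] using hc) hq _ h.pow_ne
      (by simpa [show q ^ (2 : ℤ) = q ^ 2 from zpow_ofNat q 2] using h.second_cn 0),
      show a * q / c * (q / c) / (q ^ 2 / c) = a / c by field_simp, ← hE] at e2
    have eA : serEuler a c q 1 * serSecond a c q k m n
        = PowerSeries.mk fun j : ℕ => coeffA' k m n a c q j := by
      ext j
      rw [coeff_mul_eq_coeffA' h, coeff_mk]
    have eB : serPhi (a * q ^ k) (c * q ^ m) q (q ^ n)
        * serEuler (a * q / c) (q ^ 2 / c) q (q / c)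
        = PowerSeries.mk fun j : ℕ => coeffB' k m n a c q j := by
      ext j
      rw [coeff_mul_eq_coeffB' h, coeff_mk]
    rw [e1, e2]
    simp only [serP, hL, if_false]
    rw [← hshift _ _ (fun j hj => by rw [coeffA', if_pos hj])
      (fun j hj => by rw [coeffB', if_pos hj]), ← eA, ← eB]
    ring

end
end QHyp

/-! ### Rationality of the Casoratian: control of the poles. -/

namespace QHyp

open Finset Polynomial

section
variable {K : Type*} [Field K] {a c q : K} {L : Type*} [Field L]

/-- The subring of Laurent polynomials in the image of `X`. -/
def laurentSubring (j : K[X] →+* L) : Subring L := Subring.closure (Set.range j ∪ {(j X)⁻¹})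

variable {j : K[X] →+* L}

theorem map_mem_laurentSubring (p : K[X]) : j p ∈ laurentSubring j :=
  Subring.subset_closure (Or.inl ⟨p, rfl⟩)

theorem inv_X_mem_laurentSubring : (j X)⁻¹ ∈ laurentSubring j :=
  Subring.subset_closure (Or.inr rfl)

theorem exists_of_mem_laurentSubring (hX : j X ≠ 0) {f : L} (hf : f ∈ laurentSubring j) :
    ∃ (N : ℕ) (p : K[X]), f * j X ^ N = j p := by
  induction hf using Subring.closure_induction with
  | mem x hx =>
    rcases hx with ⟨p, rfl⟩ | hx
    · exact ⟨0, p, by simp⟩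
    · rw [Set.mem_singleton_iff] at hx
      exact ⟨1, 1, by rw [hx, pow_one, inv_mul_cancel₀ hX, map_one]⟩
  | zero => exact ⟨0, 0, by simp⟩
  | one => exact ⟨0, 1, by simp⟩
  | add x y _ _ hx hy =>
    obtain ⟨N, p, h1⟩ := hx
    obtain ⟨M, r, h2⟩ := hy
    refine ⟨N + M, p * X ^ M + r * X ^ N, ?_⟩
    simp only [map_add, map_mul, map_pow, ← h1, ← h2]
    ring
  | neg x _ hx =>
    obtain ⟨N, p, h1⟩ := hx
    exact ⟨N, -p, by rw [map_neg, ← h1]; ring⟩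
  | mul x y _ _ hx hy =>
    obtain ⟨N, p, h1⟩ := hx
    obtain ⟨M, r, h2⟩ := hy
    refine ⟨N + M, p * r, ?_⟩
    simp only [map_mul, ← h1, ← h2]
    ring

theorem map_C_zpow (q : K) (n : ℤ) : j (C q) ^ n = j (C (q ^ n)) :=
  (map_zpow₀ (j.comp (C : K →+* K[X])) q n).symm

theorem map_C_ne_zero {r : K} (hr : r ≠ 0) : j (C r) ≠ 0 :=
  (map_ne_zero_iff (j.comp (C : K →+* K[X])) (RingHom.injective _)).mpr hr

theorem eq_of_map_C_mul {r : K} (hr : r ≠ 0) {f g : L} (h : j (C r) * f = g) :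
    f = j (C r⁻¹) * g := by
  rw [← h, ← mul_assoc, ← map_mul, ← C_mul, inv_mul_cancel₀ hr, map_one, map_one, one_mul]

theorem Generic.sub_ne_zero (h : Generic a c q) (k m : ℤ) : c * q ^ m - a * q ^ k ≠ 0 := by
  intro h'
  apply h.acn (k - m)
  rw [zpow_sub₀ h.q0]
  have := zpow_ne_zero m h.q0
  field_simp
  linear_combination -h'

variable {u : ℤ → ℤ → ℤ → L}

theorem Generic.map_C (h : Generic a c q) :
    Generic (j (C a)) (j (C c)) (j (C q)) := by
  have hi : Function.Injective (j.comp (C : K →+* K[X])) := RingHom.injective _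
  refine ⟨map_C_ne_zero h.a0, map_C_ne_zero h.c0, map_C_ne_zero h.q0, fun i hi' => ?_, fun i => ?_,
    fun i => ?_, fun i => ?_⟩
  · rw [map_C_zpow]
    exact fun e => h.qn i hi' (hi (e.trans (map_one _).symm))
  · rw [map_C_zpow, ← map_mul, ← C_mul]
    exact fun e => h.an i (hi (e.trans (map_one _).symm))
  · rw [map_C_zpow, ← map_mul, ← C_mul]
    exact fun e => h.cn i (hi (e.trans (map_one _).symm))
  · rw [map_C_zpow, ← map_mul, ← C_mul]
    exact fun e => h.acn i (hi e)

/-- In the half-space k-m+n ≤ 0 all values can be reached without dividing by a factor of the form c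
- aXq^i; the only nonconstant division is by X, in raising all three indices. -/
theorem IsContig.mem_laurentSubring (h : Generic a c q) (hj : Function.Injective j)
    (hu : IsContig (j (C a)) (j (C c)) (j (C q)) (j X) u) (h0 : u 0 0 0 = 0) {κ : K}
    (h1 : u 0 0 1 * j (1 - C (a / c) * X) = j (C κ)) (k m n : ℤ) (hL : k - m + n ≤ 0) :
    u k m n ∈ laurentSubring j := by
  have hX : j X ≠ 0 := (map_ne_zero_iff j hj).mpr X_ne_zero
  have hc := h.c0
  have hq := h.q0
  have hG := h.map_C (j := j)
  set S := laurentSubring j with hS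
  suffices H : ∀ k m : ℤ, ∀ n, k - m + n ≤ 0 → u k m n ∈ S from H k m n hL
  apply int_pair_induction
  · have base : ∀ i : ℕ, u 0 0 (-i) ∈ S ∧ u 0 0 (-i - 1) ∈ S := by
      intro i
      induction i with
      | zero =>
        refine ⟨by simp [h0, S.zero_mem], ?_⟩
        have := hu.difference 0 0 (-1)
        norm_num [h0] at this
        -- At n = -1 the leading coefficient is (c/q)(1 - aX/c), which cancels exactly the pole of
        -- u(0,0,1).
        have e : u 0 0 (-1) = j (-(C (c / q) * C κ)) := by
          rw [map_neg, map_mul, ← h1]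
          have e1 : j (C c) * (j (C q))⁻¹ = j (C (c / q)) := by
            rw [← zpow_neg_one, map_C_zpow, ← map_mul, ← C_mul, zpow_neg_one, div_eq_mul_inv]
          have e2 : j (C a) * (j X * (j (C q))⁻¹) = j (C (c / q)) * j (C (a / c) * X) := by
            rw [← zpow_neg_one, map_C_zpow, ← map_mul, ← map_mul, ← map_mul]
            congr 1
            rw [mul_left_comm, ← C_mul, ← mul_assoc, ← C_mul, zpow_neg_one, mul_comm X]
            congr 2
            field_simp
          rw [e1, e2] at this
          simp only [map_sub, map_one]
          linear_combination this
        simpa [e] using map_mem_laurentSubring (j := j) (-(C (c / q) * C κ))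
      | succ i ih =>
        push_cast
        rw [show -((i : ℤ) + 1) = -i - 1 by ring]
        refine ⟨ih.2, ?_⟩
        have := hu.difference 0 0 (-i - 1 - 1)
        rw [sub_add_cancel, show -(i : ℤ) - 1 - 1 + 2 = -i by ring] at this
        rw [eq_neg_of_add_eq_zero_right this]
        simp only [map_C_zpow]
        refine S.neg_mem (S.add_mem (S.mul_mem ?_ ih.1) (S.mul_mem ?_ ih.2)) <;>
        · simp only [← map_mul, ← map_sub, ← map_one j]
          exact map_mem_laurentSubring _
    intro n hn
    obtain ⟨i, hi⟩ : ∃ i : ℕ, n = -i := ⟨(-n).toNat, by omega⟩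
    rw [hi]
    exact (base i).1
  · intro k m H n hn
    have := hu.raise_all k m (n - 1)
    rw [sub_add_cancel] at this
    have e : u (k + 1) (m + 1) n = (j X)⁻¹ * j (C (-(q ^ (n - 1) * (1 - a * q ^ k)))⁻¹)
        * (j (1 - C (c * q ^ m)) * (u k m (n - 1) - u k m n)) := by
      have hne : -(q ^ (n - 1) * (1 - a * q ^ k)) ≠ 0 :=
        neg_ne_zero.mpr (mul_ne_zero (zpow_ne_zero _ hq) (_root_.sub_ne_zero.mpr (h.an k).symm))
      simp only [map_C_zpow] at this
      rw [mul_assoc, ← eq_of_map_C_mul hne (f := j X * u (k + 1) (m + 1) n)]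
      · field_simp
      · simp only [map_sub, map_mul, map_one, map_neg] at this ⊢
        linear_combination -this
    rw [e]
    refine S.mul_mem (S.mul_mem inv_X_mem_laurentSubring (map_mem_laurentSubring _))
      (S.mul_mem (map_mem_laurentSubring _) (S.sub_mem (H _ ?_) (H _ ?_))) <;> omega
  · intro k m H n hn
    have := hu.lower_den k m n
    simp only [map_C_zpow] at this
    have hne : 1 - c * q ^ (m - 1) ≠ 0 := _root_.sub_ne_zero.mpr (h.cn _).symm
    rw [eq_of_map_C_mul hne (f := u k (m - 1) n)
      (g := u k m n - j (C (c * q ^ (m - 1))) * u k m (n + 1)) (by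
        simp only [map_sub, map_mul, map_one] at this ⊢
        linear_combination -this)]
    refine S.mul_mem (map_mem_laurentSubring _) (S.sub_mem (H _ ?_)
      (S.mul_mem (map_mem_laurentSubring _) (H _ ?_))) <;> omega
  · intro k m H n hn
    have e1 := hu.lower_num' hG.q0 k m n (hG.an k)
    -- The term u(k+1,m,n) may lie just outside the half-space. Its coefficient is the leading
    -- coefficient of the difference equation at n - 2, so it can be replaced by values at n - 1 and
    -- n - 2.
    have e2 := hu.difference (k + 1) m (n - 2)
    rw [sub_add_cancel, show n - 2 + 1 = n - 1 by ring] at e2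
    have x1 : j (C a) * j (C q) ^ (k + 1) * (j X * j (C q) ^ (n - 2))
        = j (C a) * j (C q) ^ k * (j X * j (C q) ^ (n - 1)) := by
      rw [zpow_add_one₀ hG.q0, show n - 1 = n - 2 + 1 by ring, zpow_add_one₀ hG.q0]; ring
    rw [x1] at e2
    simp only [map_C_zpow] at e1 e2
    rw [eq_of_map_C_mul (h.sub_ne_zero k (m - 1)) (f := u k m n)
      (g := j (1 + C (c * q ^ (m - 1)) - C (a * q ^ k) - X * C (q ^ (n - 2))) * u (k + 1) m (n - 1)
        - u (k + 1) m (n - 2)) (by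
        simp only [map_sub, map_mul, map_one, map_add] at e1 e2 ⊢
        linear_combination e1 + e2)]
    refine S.mul_mem (map_mem_laurentSubring _) (S.sub_mem
      (S.mul_mem (map_mem_laurentSubring _) (H _ ?_)) (H _ ?_)) <;> omega

/-- The denominator `(a X / c; q)_l`. -/
def pochPoly (a c q : K) (l : ℕ) : K[X] := ∏ i ∈ range l, (1 - C (a / c * q ^ i) * X)

theorem pochPoly_succ (a c q : K) (l : ℕ) :
    pochPoly a c q (l + 1) = pochPoly a c q l * (1 - C (a / c * q ^ l) * X) :=
  prod_range_succ _ _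

theorem IsContig.mul_pochPoly_mem (h : Generic a c q) (hj : Function.Injective j)
    (hu : IsContig (j (C a)) (j (C c)) (j (C q)) (j X) u) (h0 : u 0 0 0 = 0) {κ : K}
    (h1 : u 0 0 1 * j (1 - C (a / c) * X) = j (C κ)) (k m n : ℤ) :
    u k m n * j (pochPoly a c q (max (k - m + n) 0).toNat) ∈ laurentSubring j := by
  have hc := h.c0
  have hq := h.q0
  set S := laurentSubring j with hS
  rcases le_total (k - m + n) 0 with hL | hL
  · rw [max_eq_right hL]
    simpa [pochPoly] using hu.mem_laurentSubring h hj h0 h1 k m n hL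
  · have key : ∀ i : ℕ, u k m (m - k + i - 1) * j (pochPoly a c q (i - 1)) ∈ S
        ∧ u k m (m - k + i) * j (pochPoly a c q i) ∈ S := by
      intro i
      induction i with
      | zero =>
        constructor <;>
        · simp only [Nat.cast_zero, pochPoly, zero_tsub, range_zero, prod_empty, map_one, mul_one]
          exact hu.mem_laurentSubring h hj h0 h1 _ _ _ (by omega)
      | succ i ih =>
        push_cast
        rw [show m - k + ((i : ℤ) + 1) - 1 = m - k + i by ring]
        refine ⟨ih.2, ?_⟩
        have := hu.difference k m (m - k + i - 1)
        rw [sub_add_cancel, show m - k + (i : ℤ) - 1 + 2 = m - k + (i + 1) by ring] at this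
        simp only [map_C_zpow] at this
        have hne : c * q ^ (m - 1) ≠ 0 := mul_ne_zero hc (zpow_ne_zero _ hq)
        have e1 : C a * C (q ^ k) * (X * C (q ^ (m - k + i - 1)))
            = C (c * q ^ (m - 1)) * (C (a / c * q ^ i) * X) := by
          rw [mul_comm X, ← C_mul, ← mul_assoc, ← mul_assoc, ← C_mul, ← C_mul]
          congr 2
          have : q ^ k * q ^ (m - k + i - 1) = q ^ (m - 1) * q ^ i := by
            rw [← zpow_natCast, ← zpow_add₀ hq, ← zpow_add₀ hq]; ring_nf
          field_simp
          linear_combination a * this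
        have e1' := congrArg j e1
        simp only [map_mul] at e1'
        rw [e1'] at this
        have e2 : ∃ r : K[X], pochPoly a c q i = pochPoly a c q (i - 1) * r := by
          rcases i with _ | i
          · exact ⟨1, by simp⟩
          · exact ⟨_, pochPoly_succ a c q i⟩
        obtain ⟨r, hr⟩ := e2
        rw [eq_of_map_C_mul hne
          (g := -(j (X * C (q ^ (m - k + i - 1)) - 1 - C (c * q ^ (m - 1)))
            * (u k m (m - k + i) * j (pochPoly a c q i))
            + j r * (u k m (m - k + i - 1) * j (pochPoly a c q (i - 1)))))
          (f := u k m (m - k + (i + 1)) * j (pochPoly a c q (i + 1))) (by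
            have hr' := congrArg j hr
            rw [pochPoly_succ]
            simp only [map_sub, map_mul, map_one] at this hr' ⊢
            linear_combination j (pochPoly a c q i) * this - u k m (m - k + i - 1) * hr')]
        exact S.mul_mem (map_mem_laurentSubring _) (S.neg_mem (S.add_mem
          (S.mul_mem (map_mem_laurentSubring _) ih.2) (S.mul_mem (map_mem_laurentSubring _) ih.1)))
    have := (key (k - m + n).toNat).2
    rw [show m - k + (((k - m + n).toNat : ℕ) : ℤ) = n by omega] at this
    rwa [max_eq_left hL]

end
end QHyp

/-! ### Rationality of the Casoratian: growth at infinity. -/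

namespace QHyp

open Finset Polynomial

section
variable {K : Type*} [Field K] {a c q : K} {L : Type*} [Field L] {j : K[X] →+* L}

/-- `f` is the image of a rational function of degree at most `e`. -/
def DegLE (j : K[X] →+* L) (f : L) (e : ℤ) : Prop :=
  ∃ u v : K[X], v ≠ 0 ∧ f * j v = j u ∧ (u.natDegree : ℤ) ≤ v.natDegree + e

theorem DegLE.mono {f : L} {e e' : ℤ} (hf : DegLE j f e) (h : e ≤ e') : DegLE j f e' := by
  obtain ⟨u, v, hv, h1, h2⟩ := hf
  exact ⟨u, v, hv, h1, by omega⟩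

theorem DegLE.add {f g : L} {e : ℤ} (hf : DegLE j f e) (hg : DegLE j g e) :
    DegLE j (f + g) e := by
  obtain ⟨u, v, hv, h1, h2⟩ := hf
  obtain ⟨u', v', hv', h1', h2'⟩ := hg
  refine ⟨u * v' + u' * v, v * v', mul_ne_zero hv hv', ?_, ?_⟩
  · simp only [map_add, map_mul, ← h1, ← h1']; ring
  · rw [natDegree_mul hv hv']
    have a1 := natDegree_add_le (u * v') (u' * v)
    have a2 := natDegree_mul_le (p := u) (q := v')
    have a3 := natDegree_mul_le (p := u') (q := v)
    push_cast
    omega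

theorem DegLE.mul {f g : L} {e e' : ℤ} (hf : DegLE j f e) (hg : DegLE j g e') :
    DegLE j (f * g) (e + e') := by
  obtain ⟨u, v, hv, h1, h2⟩ := hf
  obtain ⟨u', v', hv', h1', h2'⟩ := hg
  refine ⟨u * u', v * v', mul_ne_zero hv hv', ?_, ?_⟩
  · simp only [map_mul, ← h1, ← h1']; ring
  · rw [natDegree_mul hv hv']
    have a2 := natDegree_mul_le (p := u) (q := u')
    push_cast
    omega

theorem DegLE.poly {p : K[X]} {e : ℕ} (hp : p.natDegree ≤ e) : DegLE j (j p) e :=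
  ⟨p, 1, one_ne_zero, by simp, by simpa using hp⟩

theorem DegLE.poly_mul {p : K[X]} {d : ℕ} (hp : p.natDegree ≤ d) {f : L} {e : ℤ}
    (hf : DegLE j f (e - d)) : DegLE j (j p * f) e := by
  have := (DegLE.poly (j := j) hp).mul hf
  rwa [add_sub_cancel] at this

theorem DegLE.neg {f : L} {e : ℤ} (hf : DegLE j f e) : DegLE j (-f) e := by
  obtain ⟨u, v, hv, h1, h2⟩ := hf
  exact ⟨-u, v, hv, by rw [map_neg, ← h1]; ring, by rwa [natDegree_neg]⟩

theorem DegLE.sub {f g : L} {e : ℤ} (hf : DegLE j f e) (hg : DegLE j g e) :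
    DegLE j (f - g) e := by
  rw [sub_eq_add_neg]; exact hf.add hg.neg

theorem DegLE.zero (e : ℤ) : DegLE j 0 e :=
  ⟨0, X ^ (-e).toNat, pow_ne_zero _ X_ne_zero, by simp, by rw [natDegree_X_pow]; simp; omega⟩

theorem DegLE.of_mul {p : K[X]} (hp : p ≠ 0) {f : L} {e : ℤ}
    (hf : DegLE j (f * j p) (e + p.natDegree)) : DegLE j f e := by
  obtain ⟨u, v, hv, h1, h2⟩ := hf
  refine ⟨u, p * v, mul_ne_zero hp hv, by rw [map_mul, ← mul_assoc, h1], ?_⟩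
  rw [natDegree_mul hp hv]
  push_cast
  omega

theorem DegLE.natDegree_le (hj : Function.Injective j) {p : K[X]} {e : ℤ} (h : DegLE j (j p) e)
    (hp : p ≠ 0) : (p.natDegree : ℤ) ≤ e := by
  obtain ⟨u, v, hv, h1, h2⟩ := h
  rw [← map_mul] at h1
  rw [← hj h1, natDegree_mul hp hv] at h2
  push_cast at h2
  omega

variable {u : ℤ → ℤ → ℤ → L}

theorem natDegree_C_add_X_mul_C_le {s t : K} : (C s + X * C t).natDegree ≤ 1 := by
  compute_degree

/-- Every step respects this bound: a linear coefficient costs one degree, while division by X or by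
a linear factor with nonzero slope gains one. The start is u(0,0,1), which has degree at most -1;
the value u(0,0,0) = 0 satisfies every bound. -/
theorem IsContig.degLE (h : Generic a c q) (hj : Function.Injective j)
    (hu : IsContig (j (C a)) (j (C c)) (j (C q)) (j X) u) (h0 : u 0 0 0 = 0) {κ : K}
    (h1 : u 0 0 1 * j (1 - C (a / c) * X) = j (C κ)) (k m n : ℤ) :
    DegLE j (u k m n) (max (-k) (-n) - 1) := by
  have hX : j X ≠ 0 := (map_ne_zero_iff j hj).mpr X_ne_zero
  have hc := h.c0
  have ha := h.a0
  have hq := h.q0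
  have hlin : ∀ {s t : K}, t ≠ 0 → (C s - C t * X).natDegree = 1 := by
    intro s t ht
    rw [sub_eq_add_neg, ← neg_mul, ← C_neg, add_comm]
    exact natDegree_linear (neg_ne_zero.mpr ht)
  have hlin0 : ∀ {s t : K}, t ≠ 0 → (C s - C t * X) ≠ 0 := by
    intro s t ht h'
    have := hlin (s := s) ht
    simp [h'] at this
  suffices H : ∀ k m : ℤ, ∀ n, DegLE j (u k m n) (max (-k) (-n) - 1) from H k m n
  apply int_pair_induction
  · have b0 : ∀ e, DegLE j (u 0 0 0) e := fun e => by rw [h0]; exact DegLE.zero e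
    have b1 : DegLE j (u 0 0 1) (-1) := by
      have hne : a / c ≠ 0 := div_ne_zero ha hc
      have := DegLE.of_mul (p := 1 - C (a / c) * X) (j := j) (e := -1) (f := u 0 0 1)
      rw [← C_1, hlin hne] at this
      refine this (hlin0 hne) ?_
      rw [C_1, h1]
      exact DegLE.poly (natDegree_C _).le
    have up : ∀ i : ℕ, DegLE j (u 0 0 i) (-1) ∧ DegLE j (u 0 0 (i + 1)) (-1) := by
      intro i
      induction i with
      | zero => simpa using ⟨b0 _, b1⟩
      | succ i ih =>
        push_cast
        refine ⟨ih.2, ?_⟩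
        have := hu.difference 0 0 i
        simp only [map_C_zpow] at this
        have hne : a * q ^ i ≠ 0 := mul_ne_zero ha (pow_ne_zero _ hq)
        refine DegLE.of_mul (p := C (c / q) - C (a * q ^ i) * X) (hlin0 hne) ?_
        have e : u 0 0 (i + 1 + 1) * j (C (c / q) - C (a * q ^ i) * X)
            = -(j (C (-1 - c / q) + X * C (q ^ i)) * u 0 0 (i + 1) + u 0 0 i) := by
          rw [zero_sub, zpow_neg_one, zpow_zero, zpow_natCast] at this
          rw [add_assoc, one_add_one_eq_two]
          simp only [map_sub, map_mul, map_one, map_neg, div_eq_mul_inv, map_add] at this ⊢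
          linear_combination this
        rw [e, hlin hne]
        refine (DegLE.add (DegLE.poly_mul natDegree_C_add_X_mul_C_le ?_) (ih.1.mono (by simp))).neg
        exact ih.2.mono (by simp)
    have down : ∀ i : ℕ, DegLE j (u 0 0 (-i)) (i - 1) ∧
        DegLE j (u 0 0 (-i + 1)) (max (i - 1) 0 - 1) := by
      intro i
      induction i with
      | zero => simpa using ⟨b0 _, b1⟩
      | succ i ih =>
        push_cast
        rw [show -((i : ℤ) + 1) = -i - 1 by ring, sub_add_cancel]
        refine ⟨?_, ih.1.mono (by omega)⟩
        have := hu.difference 0 0 (-i - 1)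
        rw [sub_add_cancel, show -(i : ℤ) - 1 + 2 = -i + 1 by ring] at this
        simp only [map_C_zpow] at this
        have e : u 0 0 (-i - 1)
            = -(j (C (c / q) + X * C (-(a * q ^ (-(i : ℤ) - 1)))) * u 0 0 (-i + 1)
              + j (C (-1 - c / q) + X * C (q ^ (-(i : ℤ) - 1))) * u 0 0 (-i)) := by
          rw [zero_sub, zpow_neg_one, zpow_zero] at this
          simp only [map_sub, map_mul, map_one, map_neg, div_eq_mul_inv, map_add] at this ⊢
          linear_combination this
        rw [e]
        refine (DegLE.add (DegLE.poly_mul natDegree_C_add_X_mul_C_le (ih.2.mono ?_))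
          (DegLE.poly_mul natDegree_C_add_X_mul_C_le (ih.1.mono ?_))).neg <;> push_cast <;> omega
    intro n
    obtain ⟨i, rfl | rfl⟩ := n.eq_nat_or_neg
    · exact (up i).1.mono (by omega)
    · exact (down i).1.mono (by omega)
  · intro k m H n
    have := hu.raise_all k m (n - 1)
    rw [sub_add_cancel] at this
    have hne : -(q ^ (n - 1) * (1 - a * q ^ k)) ≠ 0 :=
      neg_ne_zero.mpr (mul_ne_zero (zpow_ne_zero _ hq) (_root_.sub_ne_zero.mpr (h.an k).symm))
    simp only [map_C_zpow] at this
    refine DegLE.of_mul X_ne_zero ?_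
    rw [natDegree_X, eq_of_map_C_mul hne (f := u (k + 1) (m + 1) n * j X)
      (g := j (C (1 - c * q ^ m)) * (u k m (n - 1) - u k m n)) (by
        simp only [map_sub, map_mul, map_one, map_neg] at this ⊢
        linear_combination -this)]
    refine DegLE.poly_mul (natDegree_C _).le (DegLE.poly_mul (natDegree_C _).le
      (DegLE.sub ((H _).mono ?_) ((H _).mono ?_))) <;> push_cast <;> omega
  · intro k m H n
    have := hu.lower_den k m n
    simp only [map_C_zpow] at this
    have hne : 1 - c * q ^ (m - 1) ≠ 0 := _root_.sub_ne_zero.mpr (h.cn _).symm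
    rw [eq_of_map_C_mul hne (f := u k (m - 1) n)
      (g := u k m n - j (C (c * q ^ (m - 1))) * u k m (n + 1)) (by
        simp only [map_sub, map_mul, map_one] at this ⊢
        linear_combination -this)]
    refine DegLE.poly_mul (natDegree_C _).le (DegLE.sub ((H _).mono ?_)
      (DegLE.poly_mul (natDegree_C _).le ((H _).mono ?_))) <;> push_cast <;> omega
  · intro k m H n
    -- Here the linear coefficient must multiply the value at n + 1, where the bound is strong
    -- enough to absorb it; in `lower_num'` it multiplies the value at n.
    have e1 := hu.lower_num k m n ((h.map_C (j := j)).an k)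
    simp only [map_C_zpow] at e1
    rw [eq_of_map_C_mul (h.sub_ne_zero k (m - 1)) (f := u k m n)
      (g := j (C (c * q ^ (m - 1) - a * q ^ k - a * q ^ k * (c * q ^ (m - 1)))) * u (k + 1) m n
        + j (C (a * q ^ k * (c * q ^ (m - 1))) + X * C (-(a * q ^ k * (a * q ^ k * q ^ n))))
          * u (k + 1) m (n + 1)) (by
        simp only [map_sub, map_mul, map_add, map_neg] at e1 ⊢
        linear_combination e1)]
    refine DegLE.poly_mul (natDegree_C _).le (DegLE.add
      (DegLE.poly_mul (natDegree_C _).le ((H _).mono ?_))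
      (DegLE.poly_mul natDegree_C_add_X_mul_C_le ((H _).mono ?_))) <;> push_cast <;> omega

end

/-! ### Identification of the Casoratian with P^(1,1). -/

section
open PowerSeries
variable {K : Type*} [Field K] {a c q : K} {L : Type*} [Field L] {ι : K⟦X⟧ →+* L}

/-- The left side is a power series and also a Laurent polynomial, hence a polynomial. Its degree is
at most max(-k,-n) - 1 + max(m,0) + max(k-m+n,0), which is d, so truncating the series after x^d
loses nothing. -/
theorem casoratian_mul_eq (h : Generic a c q) (hι : Function.Injective ι) (k m n : ℤ) :
    casoratian ι a c q k m n * ι PowerSeries.X ^ (max m 0)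
        * ι (pochPoly a c q (max (k - m + n) 0).toNat)
      = ι (P11 k m n a c q : K[X]) := by
  set j : K[X] →+* L := ι.comp (Polynomial.coeToPowerSeries.ringHom : K[X] →+* K⟦X⟧) with hjdef
  have hj : Function.Injective j :=
    hι.comp (Polynomial.coe_injective K)
  have jC : ∀ r : K, j (Polynomial.C r) = ι (PowerSeries.C r) := fun r => by simp [hjdef]
  have jX : j Polynomial.X = ι PowerSeries.X := by simp [hjdef]
  have jp : ∀ p : K[X], j p = ι (p : K⟦X⟧) := fun p => by simp [hjdef]
  have hX : j Polynomial.X ≠ 0 := (map_ne_zero_iff j hj).mpr Polynomial.X_ne_zero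
  have hu := isContig_casoratian h hι
  rw [← jC, ← jC, ← jC, ← jX] at hu
  have h1 := casoratian_zero_zero_one h hι
  have e : (1 - PowerSeries.C (a / c) * PowerSeries.X : K⟦X⟧)
      = ((1 - Polynomial.C (a / c) * Polynomial.X : K[X]) : K⟦X⟧) := by simp
  rw [e, ← jp, ← jC] at h1
  have hP : ι (pochPoly a c q (max (k - m + n) 0).toNat)
      = ι (∏ i ∈ range (max (k - m + n) 0).toNat, (1 - PowerSeries.C (a / c * q ^ i)
        * PowerSeries.X)) := by
    congr 1
    rw [pochPoly, ← Polynomial.coeToPowerSeries.ringHom_apply, map_prod]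
    simp
  have hser := casoratian_eq h hι k m n
  have hmem := hu.mul_pochPoly_mem h hj (casoratian_zero a c q) h1 k m n
  obtain ⟨N, p, hp⟩ := exists_of_mem_laurentSubring hX hmem
  set l := (max (k - m + n) 0).toNat with hl
  rw [← hP] at hser
  obtain ⟨M, hM⟩ : ∃ M : ℕ, (M : ℤ) = max m 0 := ⟨(max m 0).toNat, by omega⟩
  rw [← hM, zpow_natCast] at hser
  -- the power series is a polynomial
  have hpoly : serP k m n a c q * PowerSeries.X ^ N = ((p * Polynomial.X ^ M : K[X]) : K⟦X⟧) := by
    apply hι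
    rw [← jp, map_mul, ← hser, map_mul, ← hp, map_pow, map_pow, jX, jp]
    ring
  have hcoef : ∀ i, PowerSeries.coeff i (serP k m n a c q)
      = (p * Polynomial.X ^ M).coeff (i + N) := by
    intro i
    rw [← Polynomial.coeff_coe, ← hpoly, PowerSeries.coeff_mul_X_pow]
  obtain ⟨r, hr⟩ : ∃ r : K[X], (r : K⟦X⟧) = serP k m n a c q := by
    refine ⟨PowerSeries.trunc ((p * Polynomial.X ^ M).natDegree + 1) (serP k m n a c q), ?_⟩
    ext i
    rw [Polynomial.coeff_coe, PowerSeries.coeff_trunc]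
    split_ifs with hi
    · rfl
    · rw [hcoef, Polynomial.coeff_eq_zero_of_natDegree_lt (by omega)]
  -- its degree
  have hdeg : DegLE j (j r) (max (-k) (-n) - 1 + M + l) := by
    rw [jp, hr, ← hser, ← jX, ← map_pow, ← jp]
    refine ((hu.degLE h hj (casoratian_zero a c q) h1 k m n).mul
      (DegLE.poly (Polynomial.natDegree_X_pow_le M))).mul (DegLE.poly ?_)
    refine (Polynomial.natDegree_prod_le _ _).trans ?_
    refine (sum_le_card_nsmul _ _ 1 fun i _ => ?_).trans (by simp)
    compute_degree
  have hr0 : ∀ i : ℕ, ((max (k - m + n) 0 + max m 0 - min k n).toNat ≤ i) → r.coeff i = 0 := by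
    intro i hi
    by_cases h0 : r = 0
    · simp [h0]
    · have := hdeg.natDegree_le hj h0
      exact Polynomial.coeff_eq_zero_of_natDegree_lt (by omega)
  have hP11 : P11 k m n a c q = r := by
    ext i
    rw [P11, Polynomial.finsetSum_coeff]
    simp only [Polynomial.coeff_monomial, sum_ite_eq', mem_range]
    split_ifs with h2 h3
    · rw [← Polynomial.coeff_coe, hr, serP, PowerSeries.coeff_mk, if_pos h3]
    · rw [← Polynomial.coeff_coe, hr, serP, PowerSeries.coeff_mk, if_neg h3]
    · rw [hr0 i (by omega)]
  rw [hP11, hr, ← hser, ← hM, zpow_natCast]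

end
end QHyp

/-! ### Evaluation at a point and the three-term relation. -/

namespace QHyp

open Finset Polynomial

section
variable {K : Type*} [Field K] {a c q x : K} {L : Type*} [Field L] {j : K[X] →+* L}

/-- `f` is the image of a rational function that takes the value `v` at `x`. -/
def EvalsTo (j : K[X] →+* L) (x : K) (f : L) (v : K) : Prop :=
  ∃ N D : K[X], D.eval x ≠ 0 ∧ f * j D = j N ∧ v * D.eval x = N.eval x

theorem EvalsTo.unique (hj : Function.Injective j) {f : L} {v v' : K} (h : EvalsTo j x f v)
    (h' : EvalsTo j x f v') : v = v' := by
  obtain ⟨N, D, h0, h1, h2⟩ := h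
  obtain ⟨N', D', h0', h1', h2'⟩ := h'
  have e : N * D' = N' * D := by
    apply hj
    rw [map_mul, map_mul, ← h1, ← h1']
    ring
  have e' := congrArg (Polynomial.eval x) e
  rw [eval_mul, eval_mul, ← h2, ← h2'] at e'
  apply mul_right_cancel₀ (mul_ne_zero h0 h0')
  linear_combination e'

theorem EvalsTo.add {f g : L} {v w : K} (hf : EvalsTo j x f v) (hg : EvalsTo j x g w) :
    EvalsTo j x (f + g) (v + w) := by
  obtain ⟨N, D, h0, h1, h2⟩ := hf
  obtain ⟨N', D', h0', h1', h2'⟩ := hg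
  refine ⟨N * D' + N' * D, D * D', by simpa using ⟨h0, h0'⟩, ?_, ?_⟩
  · simp only [map_add, map_mul, ← h1, ← h1']; ring
  · simp only [eval_add, eval_mul, ← h2, ← h2']; ring

theorem EvalsTo.mul {f g : L} {v w : K} (hf : EvalsTo j x f v) (hg : EvalsTo j x g w) :
    EvalsTo j x (f * g) (v * w) := by
  obtain ⟨N, D, h0, h1, h2⟩ := hf
  obtain ⟨N', D', h0', h1', h2'⟩ := hg
  refine ⟨N * N', D * D', by simpa using ⟨h0, h0'⟩, ?_, ?_⟩
  · simp only [map_mul, ← h1, ← h1']; ring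
  · simp only [eval_mul, ← h2, ← h2']; ring

theorem EvalsTo.poly (p : K[X]) : EvalsTo j x (j p) (p.eval x) :=
  ⟨p, 1, by simp, by simp, by simp⟩

theorem EvalsTo.poly_mul (p : K[X]) {f : L} {v : K} (hf : EvalsTo j x f v) :
    EvalsTo j x (j p * f) (p.eval x * v) :=
  (EvalsTo.poly p).mul hf

/-- A solution with values in rational functions can be evaluated. -/
theorem IsContig.eval (hj : Function.Injective j) {u : ℤ → ℤ → ℤ → L}
    {v : ℤ → ℤ → ℤ → K} (hu : IsContig (j (C a)) (j (C c)) (j (C q)) (j X) u)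
    (huv : ∀ k m n, EvalsTo j x (u k m n) (v k m n)) : IsContig a c q x v := by
  refine ⟨fun k m n => ?_, fun k m n => ?_, fun k m n => ?_⟩
  · have e1 := (huv k m n).add (EvalsTo.poly_mul (-(C a * C (q ^ k))) (huv k m (n + 1)))
    have e2 := EvalsTo.poly_mul (1 - C a * C (q ^ k)) (huv (k + 1) m n)
    have := hu.raise_num k m n
    rw [map_C_zpow] at this
    simp only [map_neg, map_mul, map_sub, map_one] at e1 e2
    rw [← this, sub_eq_add_neg, ← neg_mul] at e2
    have := e1.unique hj e2
    simp only [eval_neg, eval_mul, eval_C, eval_sub, eval_one] at this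
    linear_combination this
  · have e1 := (huv k m n).add (EvalsTo.poly_mul (-(C c * C (q ^ (m - 1)))) (huv k m (n + 1)))
    have e2 := EvalsTo.poly_mul (1 - C c * C (q ^ (m - 1))) (huv k (m - 1) n)
    have := hu.lower_den k m n
    rw [map_C_zpow] at this
    simp only [map_neg, map_mul, map_sub, map_one] at e1 e2
    rw [← this, sub_eq_add_neg, ← neg_mul] at e2
    have := e1.unique hj e2
    simp only [eval_neg, eval_mul, eval_C, eval_sub, eval_one] at this
    linear_combination this
  · have e1 := EvalsTo.poly_mul (1 - C c * C (q ^ m))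
      ((huv k m n).add (EvalsTo.poly_mul (-1) (huv k m (n + 1))))
    have e2 := EvalsTo.poly_mul (-(X * C (q ^ n) * (1 - C a * C (q ^ k))))
      (huv (k + 1) (m + 1) (n + 1))
    have := hu.raise_all k m n
    simp only [map_C_zpow] at this
    simp only [map_neg, map_mul, map_sub, map_one] at e1 e2
    rw [← this, sub_eq_add_neg (u k m n), ← neg_one_mul (u k m (n + 1))] at e2
    have := e1.unique hj e2
    simp only [eval_neg, eval_mul, eval_C, eval_X, eval_sub, eval_one] at this
    linear_combination this

/-- The parameters and the argument avoid the zeros of all denominators. -/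
structure GenericPoint {F : Type*} [Field F] (a c x q : F) : Prop where
  param : Generic a c q
  x0 : x ≠ 0
  axn : ∀ i : ℤ, a * x * q ^ i ≠ c

/-- The coefficient `S(k, m, n; a, c, x; q)`. -/
def formS {F : Type*} [Field F] (k m n : ℤ) (a c x q : F) : F :=
  (1 - a) * (c - a * x) / ((q - c) * (1 - c))
    * (x ^ (1 - max m 0) / qPoch (a * x / c) q (max (k - m + n) 0))
    * (P11 k m n a c q).eval x

/-- The coefficient `T(k, m, n; a, c, x; q)`. -/
def formT {F : Type*} [Field F] (k m n : ℤ) (a c x q : F) : F :=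
  -((1 - c) * (1 - c * q) / ((1 - a * q) * (c - a * x * q) * x * q))
    * formS (k - 1) (m - 1) (n - 1) (a * q) (c * q) (x * q) q

theorem eval_pochPoly (a c q x : K) (l : ℕ) :
    (pochPoly a c q l).eval x = qPoch (a * x / c) q l := by
  rw [pochPoly, eval_prod, qPoch_natCast]
  refine prod_congr rfl fun i _ => ?_
  simp only [eval_sub, eval_one, eval_mul, eval_C, eval_X]
  ring

theorem GenericPoint.arg_ne (h : GenericPoint a c x q) (i : ℤ) : a * x / c * q ^ i ≠ 1 := by
  have hc := h.param.c0
  intro h'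
  apply h.axn i
  field_simp at h'
  exact h'

/-- `formS` is a multiple of the evaluated Casoratian. The relation `raise_all` at the origin ties
the value at (1,1,1) to the known value at (0,0,1), and the prefactor is the constant that makes it
1. -/
theorem formS_contig (h : GenericPoint a c x q) :
    IsContig a c q x (fun k m n => formS k m n a c x q) ∧ formS 0 0 0 a c x q = 0
      ∧ formS 1 1 1 a c x q = 1 := by
  have hG := h.param
  have hc := hG.c0
  have hx := h.x0
  have hac : c - a * x ≠ 0 := sub_ne_zero.mpr fun e => h.axn 0 (by simpa using e.symm)
  have hqc : q - c ≠ 0 := sub_ne_zero.mpr fun e => hG.cn (-1) (by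
    rw [zpow_neg_one, ← e, mul_inv_cancel₀ hG.q0])
  have h1c : 1 - c ≠ 0 := sub_ne_zero.mpr fun e => hG.cn 0 (by simpa using e.symm)
  have h1a : 1 - a ≠ 0 := sub_ne_zero.mpr fun e => hG.an 0 (by simpa using e.symm)
  let L := FractionRing (PowerSeries K)
  -- The Casoratian lives in the fraction field of formal power series, where X and the
  -- q-exponential are invertible; polynomials embed there through `j`.
  let ι : PowerSeries K →+* L := algebraMap _ _
  have hι : Function.Injective ι := IsFractionRing.injective (PowerSeries K) L
  set j : K[X] →+* L := ι.comp (Polynomial.coeToPowerSeries.ringHom : K[X] →+* PowerSeries K)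
    with hjdef
  have hj : Function.Injective j := hι.comp (Polynomial.coe_injective K)
  have jC : ∀ r : K, j (C r) = ι (PowerSeries.C r) := fun r => by simp [hjdef]
  have jX : j X = ι PowerSeries.X := by simp [hjdef]
  have jp : ∀ p : K[X], j p = ι (p : PowerSeries K) := fun p => by simp [hjdef]
  have hu := isContig_casoratian hG hι
  rw [← jC, ← jC, ← jC, ← jX] at hu
  set v : ℤ → ℤ → ℤ → K := fun k m n => (P11 k m n a c q).eval x
    / (x ^ (max m 0) * qPoch (a * x / c) q (max (k - m + n) 0)) with hv
  have huv : ∀ k m n, EvalsTo j x (casoratian ι a c q k m n) (v k m n) := by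
    intro k m n
    have hp : qPoch (a * x / c) q (max (k - m + n) 0) ≠ 0 := qPoch_ne_zero h.arg_ne _
    have hxm := zpow_ne_zero (max m 0) hx
    have e1 : (X ^ (max m 0).toNat * pochPoly a c q (max (k - m + n) 0).toNat).eval x
        = x ^ (max m 0) * qPoch (a * x / c) q (max (k - m + n) 0) := by
      rw [eval_mul, eval_pow, eval_X, eval_pochPoly, ← zpow_natCast, Int.toNat_of_nonneg (by omega),
        Int.toNat_of_nonneg (by omega)]
    refine ⟨P11 k m n a c q, X ^ (max m 0).toNat * pochPoly a c q (max (k - m + n) 0).toNat,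
      ?_, ?_, ?_⟩
    · rw [e1]; exact mul_ne_zero hxm hp
    · rw [jp (P11 k m n a c q), ← casoratian_mul_eq hG hι, map_mul, map_pow, jX, jp, ← zpow_natCast,
        Int.toNat_of_nonneg (by omega), mul_assoc]
    · rw [e1]; exact div_mul_cancel₀ _ (mul_ne_zero hxm hp)
  have hvc := IsContig.eval hj hu huv
  have hS : ∀ k m n, formS k m n a c x q
      = (1 - a) * (c - a * x) * x / ((q - c) * (1 - c)) * v k m n := by
    intro k m n
    have hp : qPoch (a * x / c) q (max (k - m + n) 0) ≠ 0 := qPoch_ne_zero h.arg_ne _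
    have hxm := zpow_ne_zero (max m 0) hx
    rw [formS, zpow_sub₀ hx, zpow_one]
    simp only [hv]
    field_simp
  have v0 : v 0 0 0 = 0 := by simp [hv, P11]
  have v1 : v 0 0 1 * (1 - a / c * x) = q / c - 1 := by
    have e1 := casoratian_zero_zero_one hG hι
    rw [← Polynomial.coe_one, ← Polynomial.coe_X, ← Polynomial.coe_C, ← Polynomial.coe_mul,
      ← Polynomial.coe_sub, ← jp, ← jC] at e1
    have e2 := (huv 0 0 1).mul (EvalsTo.poly (j := j) (1 - C (a / c) * X))
    rw [e1] at e2
    simpa using e2.unique hj (EvalsTo.poly _)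
  have v2 := hvc.raise_all 0 0 0
  simp only [v0, zero_add, zpow_zero, mul_one, zero_sub] at v2
  refine ⟨?_, ?_, ?_⟩
  · simp only [hS]
    exact hvc.smul _
  · rw [hS, v0, mul_zero]
  · rw [hS, div_mul_eq_mul_div, div_eq_one_iff_eq (mul_ne_zero hqc h1c)]
    field_simp at v1
    linear_combination (1 - c) * v1 + (c - a * x) * v2

theorem GenericPoint.shift (h : GenericPoint a c x q) :
    GenericPoint (a * q) (c * q) (x * q) q := by
  have hq := h.param.q0
  refine ⟨⟨mul_ne_zero h.param.a0 hq, mul_ne_zero h.param.c0 hq, hq, h.param.qn, fun i => ?_,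
    fun i => ?_, fun i => ?_⟩, mul_ne_zero h.x0 hq, fun i => ?_⟩
  · rw [mul_assoc, ← zpow_one_add₀ hq]; exact h.param.an _
  · rw [mul_assoc, ← zpow_one_add₀ hq]; exact h.param.cn _
  · intro h'
    apply h.param.acn i
    apply mul_right_cancel₀ hq
    linear_combination h'
  · intro h'
    apply h.axn (i + 1)
    rw [zpow_add_one₀ hq]
    apply mul_right_cancel₀ hq
    linear_combination h'

/-- Every solution of the contiguous relations satisfies the three-term relation. -/
theorem IsContig.three_term (h : GenericPoint a c x q) {u : ℤ → ℤ → ℤ → K}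
    (hu : IsContig a c q x u) (k m n : ℤ) :
    u k m n = formS k m n a c x q * u 1 1 1 + formT k m n a c x q * u 0 0 0 := by
  obtain ⟨s1, s2, s3⟩ := formS_contig h
  obtain ⟨t1, t2, t3⟩ := formS_contig h.shift
  have hq := h.param.q0
  have r1 := IsContig.shift hq t1
  -- The translate of S vanishes at (1,1,1) and is 1 at (2,2,2), so the diagonal relation computes
  -- its value at (0,0,0); the coefficient in `formT` is minus the inverse of that value.
  have d := r1.diagonal h.param h.x0 (by simpa using t2)
  norm_num [t3] at d
  have hne : (1 - a * q) * (c - a * x * q) * x * q ≠ 0 := by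
    refine mul_ne_zero (mul_ne_zero (mul_ne_zero ?_ ?_) h.x0) hq
    · exact sub_ne_zero.mpr fun e => h.param.an 1 (by simpa using e.symm)
    · exact sub_ne_zero.mpr fun e => h.axn 1 (by simpa using e.symm)
  -- The difference of the two sides is a solution that vanishes at (0,0,0) and (1,1,1), hence
  -- everywhere.
  have r2 := ((hu.add ((s1.smul (-u 1 1 1)))).add
    (r1.smul ((1 - c) * (1 - c * q) / ((1 - a * q) * (c - a * x * q) * x * q) * u 0 0 0)))
  have := r2.eq_zero h.param h.x0 h.axn ?_ ?_ k m n
  · simp only [formT] at this ⊢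
    linear_combination this
  · simp only [s2, zero_sub, mul_zero, add_zero]
    rw [div_mul_eq_mul_div, div_mul_eq_mul_div]
    rw [add_eq_zero_iff_eq_neg, eq_comm, ← neg_div, div_eq_iff hne]
    linear_combination u 0 0 0 * d
  · simp [s3, t2]

end
end QHyp

/-! ### Values of rational functions at complex points. -/

namespace QHyp

open Finset

section
variable {a c x q : ℂ} {f g : Rat4} {v w : ℂ}

theorem algebraMap_ne_zero_of_eval {D : Poly4} (h : MvPolynomial.eval ![a, c, x, q] D ≠ 0) :
    algebraMap Poly4 Rat4 D ≠ 0 := by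
  rw [Ne, FaithfulSMul.algebraMap_eq_zero_iff]
  rintro rfl
  simp at h

theorem HasValueAt.add (hf : HasValueAt f a c x q v) (hg : HasValueAt g a c x q w) :
    HasValueAt (f + g) a c x q (v + w) := by
  obtain ⟨N, D, h0, rfl, rfl⟩ := hf
  obtain ⟨N', D', h0', rfl, rfl⟩ := hg
  refine ⟨N * D' + D * N', D * D', by simpa using ⟨h0, h0'⟩, ?_, ?_⟩
  · rw [div_add_div _ _ (algebraMap_ne_zero_of_eval h0) (algebraMap_ne_zero_of_eval h0')]
    simp
  · rw [div_add_div _ _ h0 h0']; simp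

theorem HasValueAt.mul (hf : HasValueAt f a c x q v) (hg : HasValueAt g a c x q w) :
    HasValueAt (f * g) a c x q (v * w) := by
  obtain ⟨N, D, h0, rfl, rfl⟩ := hf
  obtain ⟨N', D', h0', rfl, rfl⟩ := hg
  refine ⟨N * N', D * D', by simpa using ⟨h0, h0'⟩, ?_, ?_⟩
  · rw [div_mul_div_comm]; simp
  · rw [div_mul_div_comm]; simp

theorem HasValueAt.of_poly (p : Poly4) :
    HasValueAt (algebraMap Poly4 Rat4 p) a c x q (MvPolynomial.eval ![a, c, x, q] p) :=
  ⟨p, 1, by simp, by simp, by simp⟩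

theorem HasValueAt.one : HasValueAt 1 a c x q 1 := by
  simpa using HasValueAt.of_poly (a := a) (c := c) (x := x) (q := q) 1

theorem HasValueAt.zero : HasValueAt 0 a c x q 0 := by
  simpa using HasValueAt.of_poly (a := a) (c := c) (x := x) (q := q) 0

theorem HasValueAt.neg (hf : HasValueAt f a c x q v) : HasValueAt (-f) a c x q (-v) := by
  have := (HasValueAt.of_poly (a := a) (c := c) (x := x) (q := q) (-1)).mul hf
  simpa using this

theorem HasValueAt.sub (hf : HasValueAt f a c x q v) (hg : HasValueAt g a c x q w) :
    HasValueAt (f - g) a c x q (v - w) := by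
  rw [sub_eq_add_neg, sub_eq_add_neg]; exact hf.add hg.neg

theorem HasValueAt.inv (hf : HasValueAt f a c x q v) (hv : v ≠ 0) :
    HasValueAt f⁻¹ a c x q v⁻¹ := by
  obtain ⟨N, D, h0, rfl, rfl⟩ := hf
  exact ⟨D, N, left_ne_zero_of_mul hv, by rw [inv_div], by rw [inv_div]⟩

theorem HasValueAt.div (hf : HasValueAt f a c x q v) (hg : HasValueAt g a c x q w) (hw : w ≠ 0) :
    HasValueAt (f / g) a c x q (v / w) := by
  rw [div_eq_mul_inv, div_eq_mul_inv]; exact hf.mul (hg.inv hw)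

theorem HasValueAt.pow (hf : HasValueAt f a c x q v) (n : ℕ) :
    HasValueAt (f ^ n) a c x q (v ^ n) := by
  induction n with
  | zero => simpa using HasValueAt.one
  | succ n ih => rw [pow_succ, pow_succ]; exact ih.mul hf

theorem HasValueAt.zpow (hf : HasValueAt f a c x q v) (hv : v ≠ 0) (n : ℤ) :
    HasValueAt (f ^ n) a c x q (v ^ n) := by
  obtain ⟨n, rfl | rfl⟩ := n.eq_nat_or_neg
  · simpa using hf.pow n
  · simpa using (hf.pow n).inv (pow_ne_zero _ hv)

theorem HasValueAt.sum {ι : Type*} (s : Finset ι) {F : ι → Rat4} {V : ι → ℂ}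
    (h : ∀ i ∈ s, HasValueAt (F i) a c x q (V i)) :
    HasValueAt (∑ i ∈ s, F i) a c x q (∑ i ∈ s, V i) := by
  classical
  induction s using Finset.induction_on with
  | empty => simpa using HasValueAt.zero
  | insert i s hi ih =>
    rw [sum_insert hi, sum_insert hi]
    exact (h i (mem_insert_self _ _)).add (ih fun k hk => h k (mem_insert_of_mem hk))

theorem HasValueAt.prod {ι : Type*} (s : Finset ι) {F : ι → Rat4} {V : ι → ℂ}
    (h : ∀ i ∈ s, HasValueAt (F i) a c x q (V i)) :
    HasValueAt (∏ i ∈ s, F i) a c x q (∏ i ∈ s, V i) := by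
  classical
  induction s using Finset.induction_on with
  | empty => simpa using HasValueAt.one
  | insert i s hi ih =>
    rw [prod_insert hi, prod_insert hi]
    exact (h i (mem_insert_self _ _)).mul (ih fun k hk => h k (mem_insert_of_mem hk))

theorem HasValueAt.unique (hf : HasValueAt f a c x q v) (hg : HasValueAt f a c x q w) :
    v = w := by
  obtain ⟨N, D, h0, rfl, rfl⟩ := hf
  obtain ⟨N', D', h0', h1, rfl⟩ := hg
  rw [div_eq_div_iff (algebraMap_ne_zero_of_eval h0) (algebraMap_ne_zero_of_eval h0'),
    ← map_mul, ← map_mul] at h1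
  have := congrArg (MvPolynomial.eval ![a, c, x, q]) (IsFractionRing.injective Poly4 Rat4 h1)
  rw [div_eq_div_iff h0 h0']
  simpa using this

theorem hasValueAt_va : HasValueAt va a c x q a := by
  simpa [va] using HasValueAt.of_poly (a := a) (c := c) (x := x) (q := q) (MvPolynomial.X 0)

theorem hasValueAt_vc : HasValueAt vc a c x q c := by
  simpa [vc] using HasValueAt.of_poly (a := a) (c := c) (x := x) (q := q) (MvPolynomial.X 1)

theorem hasValueAt_vx : HasValueAt vx a c x q x := by
  simpa [vx] using HasValueAt.of_poly (a := a) (c := c) (x := x) (q := q) (MvPolynomial.X 2)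

theorem hasValueAt_vq : HasValueAt vq a c x q q := by
  simpa [vq] using HasValueAt.of_poly (a := a) (c := c) (x := x) (q := q) (MvPolynomial.X 3)

theorem HasValueAt.qPoch_natCast (hf : HasValueAt f a c x q v) (hg : HasValueAt g a c x q w)
    (j : ℕ) : HasValueAt (qPoch f g j) a c x q (qPoch v w j) :=
  HasValueAt.prod _ fun i _ => HasValueAt.one.sub (hf.mul (hg.pow i))

theorem HasValueAt.qPoch (hf : HasValueAt f a c x q v) (hg : HasValueAt g a c x q w)
    (hw : w ≠ 0) (h : ∀ i : ℤ, v * w ^ i ≠ 1) (j : ℤ) :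
    HasValueAt (qPoch f g j) a c x q (qPoch v w j) := by
  obtain j | j := j
  · exact hf.qPoch_natCast hg j
  · rw [qPoch_negSucc, qPoch_negSucc]
    refine HasValueAt.inv (HasValueAt.prod _ fun i _ => HasValueAt.one.sub (hf.mul (hg.zpow hw _)))
      (prod_ne_zero_iff.mpr fun i _ => sub_ne_zero.mpr (h _).symm)

theorem HasValueAt.phi32 {b d e f z : Rat4} {b' d' e' f' z' : ℂ} (hq : Generic a c q) (j : ℤ)
    (hb : HasValueAt b a c x q b') (hd : HasValueAt d a c x q d') (he : HasValueAt e a c x q e')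
    (hf : HasValueAt f a c x q f') (hz : HasValueAt z a c x q z')
    (he' : ∀ i : ℕ, e' * q ^ i ≠ 1) (hf' : ∀ i : ℕ, f' * q ^ i ≠ 1) :
    HasValueAt (phi32 j b d e f vq z) a c x q (phi32 j b' d' e' f' q z') := by
  refine HasValueAt.sum _ fun i _ => ?_
  rw [phiTerm_three_two, phiTerm_three_two]
  have hvq := hasValueAt_vq (a := a) (c := c) (x := x) (q := q)
  refine HasValueAt.mul (HasValueAt.div ?_ ?_ ?_) (hz.pow i)
  · exact (((hvq.zpow hq.q0 _).qPoch_natCast hvq i).mul (hb.qPoch_natCast hvq i)).mul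
      (hd.qPoch_natCast hvq i)
  · exact ((hvq.qPoch_natCast hvq i).mul (he.qPoch_natCast hvq i)).mul (hf.qPoch_natCast hvq i)
  · exact mul_ne_zero (mul_ne_zero (qPoch_self_ne_zero hq.pow_ne i)
      (qPoch_natCast_ne_zero fun i _ => he' i)) (qPoch_natCast_ne_zero fun i _ => hf' i)

theorem Generic.ca_shift (h : Generic a c q) (k : ℤ) (i : ℕ) : c * q ^ k / a * q ^ i ≠ 1 := by
  have ha := h.a0
  have hq := h.q0
  intro h'
  apply h.acn (-(k + i))
  have : q ^ (-(k + i)) * (q ^ k * q ^ i) = 1 := by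
    rw [← zpow_natCast, ← zpow_add₀ hq, ← zpow_add₀ hq]; simp
  field_simp at h'
  rw [← h', mul_right_comm, mul_assoc, mul_comm, mul_assoc, mul_comm (q ^ i), mul_assoc] 
  linear_combination c * this

theorem Generic.an_nat (h : Generic a c q) (k : ℤ) (i : ℕ) : a * q ^ k * q ^ i ≠ 1 := by
  have := h.an (k + i)
  rwa [zpow_add₀ h.q0, zpow_natCast, ← mul_assoc] at this

theorem Generic.den_ne_zero (h : Generic a c q) (j : ℕ) : qPoch (q ^ 2 / c) q j ≠ 0 := by
  have := h.second_cn 0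
  rw [sub_zero, show q ^ (2 : ℤ) = q ^ 2 from zpow_ofNat q 2] at this
  exact qPoch_natCast_ne_zero fun i _ => this i

theorem hasValueAt_coeffA (h : Generic a c q) (k m n j : ℤ) :
    HasValueAt (coeffA k m n va vc vq j) a c x q (coeffA k m n a c q j) := by
  have ha := hasValueAt_va (a := a) (c := c) (x := x) (q := q)
  have hc := hasValueAt_vc (a := a) (c := c) (x := x) (q := q)
  have hq := hasValueAt_vq (a := a) (c := c) (x := x) (q := q)
  have c0 := h.c0
  have q0 := h.q0
  rw [coeffA, coeffA]
  split_ifs with hj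
  · exact HasValueAt.zero
  obtain ⟨j, rfl⟩ := Int.eq_ofNat_of_zero_le (not_lt.mp hj)
  refine HasValueAt.mul (HasValueAt.mul (HasValueAt.mul (HasValueAt.div ?_ ?_ ?_)
    (hc.zpow c0 _)) (hq.zpow q0 _)) ?_
  · exact ((((ha.mul hq).div hc c0).qPoch hq q0 h.an' _).mul (hc.qPoch hq q0 h.cn _)).mul
      ((hc.div hq q0).qPoch hq q0 h.cn' _)
  · exact (hq.qPoch_natCast hq j).mul (ha.qPoch hq q0 h.an _)
  · exact mul_ne_zero (qPoch_self_ne_zero h.pow_ne j) (qPoch_ne_zero h.an _)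
  · exact HasValueAt.phi32 h _ (hc.mul (hq.zpow q0 _)) ha hc (ha.mul (hq.zpow q0 _))
      (hq.zpow q0 _) (by simpa using h.cn_shift 0) (h.an_nat _)

theorem hasValueAt_coeffB (h : Generic a c q) (k m n j : ℤ) :
    HasValueAt (coeffB k m n va vc vq j) a c x q (coeffB k m n a c q j) := by
  have ha := hasValueAt_va (a := a) (c := c) (x := x) (q := q)
  have hc := hasValueAt_vc (a := a) (c := c) (x := x) (q := q)
  have hq := hasValueAt_vq (a := a) (c := c) (x := x) (q := q)
  have c0 := h.c0
  have q0 := h.q0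
  rw [coeffB, coeffB]
  split_ifs with hj
  · exact HasValueAt.zero
  obtain ⟨j, rfl⟩ := Int.eq_ofNat_of_zero_le (not_lt.mp hj)
  refine HasValueAt.mul (HasValueAt.mul (HasValueAt.mul (HasValueAt.mul (HasValueAt.div ?_ ?_ ?_)
    (HasValueAt.one.neg.zpow (by norm_num) _)) (hc.zpow c0 _)) (hq.pow _)) ?_
  · exact ((ha.mul hq).div hc c0).qPoch_natCast hq j
  · exact (hq.qPoch_natCast hq j).mul (((hq.pow 2).div hc c0).qPoch_natCast hq j)
  · exact mul_ne_zero (qPoch_self_ne_zero h.pow_ne j) (h.den_ne_zero j)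
  · exact HasValueAt.phi32 h _ (hc.mul (hq.zpow q0 _)) ((hc.mul (hq.zpow q0 _)).div ha h.a0)
      (hc.mul (hq.zpow q0 _)) ((hc.mul (hq.zpow q0 _)).div ha h.a0)
      (hq.zpow q0 _) (h.cn_shift _) (h.ca_shift _)

theorem hasValueAt_coeffA' (h : Generic a c q) (k m n j : ℤ) :
    HasValueAt (coeffA' k m n va vc vq j) a c x q (coeffA' k m n a c q j) := by
  have ha := hasValueAt_va (a := a) (c := c) (x := x) (q := q)
  have hc := hasValueAt_vc (a := a) (c := c) (x := x) (q := q)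
  have hq := hasValueAt_vq (a := a) (c := c) (x := x) (q := q)
  have c0 := h.c0
  have q0 := h.q0
  rw [coeffA', coeffA']
  split_ifs with hj
  · exact HasValueAt.zero
  obtain ⟨j, rfl⟩ := Int.eq_ofNat_of_zero_le (not_lt.mp hj)
  refine HasValueAt.mul (HasValueAt.mul (HasValueAt.mul (HasValueAt.div ?_ ?_ ?_)
    (hc.zpow c0 _)) (hq.zpow q0 _)) ?_
  · exact ((((ha.mul hq).div hc c0).qPoch hq q0 h.an' _).mul (hc.qPoch hq q0 h.cn _)).mul
      ((hc.div hq q0).qPoch hq q0 h.cn' _)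
  · exact (hq.qPoch_natCast hq j).mul (ha.qPoch hq q0 h.an _)
  · exact mul_ne_zero (qPoch_self_ne_zero h.pow_ne j) (qPoch_ne_zero h.an _)
  · exact HasValueAt.phi32 h _ (hc.mul (hq.zpow q0 _)) (hc.div ha h.a0) hc
      ((hc.mul (hq.zpow q0 _)).div ha h.a0)
      (hq.zpow q0 _) (by simpa using h.cn_shift 0) (h.ca_shift _)

theorem hasValueAt_coeffB' (h : Generic a c q) (k m n j : ℤ) :
    HasValueAt (coeffB' k m n va vc vq j) a c x q (coeffB' k m n a c q j) := by
  have ha := hasValueAt_va (a := a) (c := c) (x := x) (q := q)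
  have hc := hasValueAt_vc (a := a) (c := c) (x := x) (q := q)
  have hq := hasValueAt_vq (a := a) (c := c) (x := x) (q := q)
  have c0 := h.c0
  have q0 := h.q0
  rw [coeffB', coeffB']
  split_ifs with hj
  · exact HasValueAt.zero
  obtain ⟨j, rfl⟩ := Int.eq_ofNat_of_zero_le (not_lt.mp hj)
  refine HasValueAt.mul (HasValueAt.mul (HasValueAt.mul (HasValueAt.div ?_ ?_ ?_)
    (ha.zpow h.a0 _)) (hc.zpow c0 _)) ?_
  · exact (hq.div ha h.a0).qPoch_natCast hq j
  · exact (hq.qPoch_natCast hq j).mul (((hq.pow 2).div hc c0).qPoch_natCast hq j)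
  · exact mul_ne_zero (qPoch_self_ne_zero h.pow_ne j) (h.den_ne_zero j)
  · exact HasValueAt.phi32 h _ (hc.mul (hq.zpow q0 _)) (ha.mul (hq.zpow q0 _))
      (hc.mul (hq.zpow q0 _)) (ha.mul (hq.zpow q0 _))
      (hq.zpow q0 _) (h.cn_shift _) (h.an_nat _)

/-- The same formula is read in ℂ(a,c,x,q) and in ℂ. At a generic point no denominator vanishes, so
evaluation commutes with every operation in it. -/
theorem hasValueAt_formS (h : GenericPoint a c x q) (k m n : ℤ) :
    HasValueAt (formS k m n va vc vx vq) a c x q (formS k m n a c x q) := by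
  have ha := hasValueAt_va (a := a) (c := c) (x := x) (q := q)
  have hc := hasValueAt_vc (a := a) (c := c) (x := x) (q := q)
  have hq := hasValueAt_vq (a := a) (c := c) (x := x) (q := q)
  have hx := hasValueAt_vx (a := a) (c := c) (x := x) (q := q)
  have hG := h.param
  have q0 := hG.q0
  have hqc : q - c ≠ 0 := sub_ne_zero.mpr fun e => hG.cn (-1) (by
    rw [zpow_neg_one, ← e, mul_inv_cancel₀ hG.q0])
  have h1c : 1 - c ≠ 0 := sub_ne_zero.mpr fun e => hG.cn 0 (by simpa using e.symm)
  refine HasValueAt.mul (HasValueAt.mul (HasValueAt.div ?_ ?_ (mul_ne_zero hqc h1c))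
    (HasValueAt.div (hx.zpow h.x0 _) ?_ (qPoch_ne_zero h.arg_ne _))) ?_
  · exact (HasValueAt.one.sub ha).mul (hc.sub (ha.mul hx))
  · exact (hq.sub hc).mul (HasValueAt.one.sub hc)
  · exact ((ha.mul hx).div hc hG.c0).qPoch hq q0 h.arg_ne _
  · simp only [P11, Polynomial.eval_finsetSum, Polynomial.eval_monomial]
    refine HasValueAt.sum _ fun i _ => HasValueAt.mul ?_ (hx.pow i)
    split_ifs
    · exact (hasValueAt_coeffA hG _ _ _ _).sub (hasValueAt_coeffB hG _ _ _ _)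
    · exact (hasValueAt_coeffA' hG _ _ _ _).sub (hasValueAt_coeffB' hG _ _ _ _)

theorem eval_shiftPoly (p : Poly4) : MvPolynomial.eval ![a, c, x, q] (shiftPoly p)
    = MvPolynomial.eval ![a * q, c * q, x * q, q] p := by
  have h2 : ((MvPolynomial.aeval (R := ℂ) ![a, c, x, q]).comp shiftPoly)
      = MvPolynomial.aeval (R := ℂ) ![a * q, c * q, x * q, q] := by
    apply MvPolynomial.algHom_ext
    intro i
    fin_cases i <;> simp [shiftPoly]
  have h3 := DFunLike.congr_fun h2 p
  simpa only [AlgHom.comp_apply, MvPolynomial.aeval_eq_eval] using h3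

theorem HasValueAt.shift (hf : HasValueAt f (a * q) (c * q) (x * q) q v) :
    HasValueAt (shift f) a c x q v := by
  obtain ⟨N, D, h0, rfl, rfl⟩ := hf
  refine ⟨shiftPoly N, shiftPoly D, by rwa [eval_shiftPoly], ?_, ?_⟩
  · rw [map_div₀]
    simp [QHyp.shift]
  · rw [eval_shiftPoly, eval_shiftPoly]

/-- The coefficient `T` as a rational function. -/
def ratT (k m n : ℤ) : Rat4 :=
  -((1 - vc) * (1 - vc * vq) / ((1 - va * vq) * (vc - va * vx * vq) * vx * vq))
    * shift (formS (k - 1) (m - 1) (n - 1) va vc vx vq)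

theorem hasValueAt_ratT (h : GenericPoint a c x q) (k m n : ℤ) :
    HasValueAt (ratT k m n) a c x q (formT k m n a c x q) := by
  have ha := hasValueAt_va (a := a) (c := c) (x := x) (q := q)
  have hc := hasValueAt_vc (a := a) (c := c) (x := x) (q := q)
  have hq := hasValueAt_vq (a := a) (c := c) (x := x) (q := q)
  have hx := hasValueAt_vx (a := a) (c := c) (x := x) (q := q)
  refine HasValueAt.mul (HasValueAt.neg (HasValueAt.div ?_ ?_ ?_))
    (hasValueAt_formS h.shift _ _ _).shift
  · exact (HasValueAt.one.sub hc).mul (HasValueAt.one.sub (hc.mul hq))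
  · exact (((HasValueAt.one.sub (ha.mul hq)).mul (hc.sub ((ha.mul hx).mul hq))).mul hx).mul hq
  · refine mul_ne_zero (mul_ne_zero (mul_ne_zero ?_ ?_) h.x0) h.param.q0
    · exact sub_ne_zero.mpr fun e => h.param.an 1 (by simpa using e.symm)
    · exact sub_ne_zero.mpr fun e => h.axn 1 (by simpa using e.symm)

end

/-! ### Field of definition and degree of P^(1,1). -/

section
variable {F : Type*} [Field F] {S : Type*} [SetLike S F] [SubfieldClass S F] {s : S}

theorem qPoch_mem {a q : F} (ha : a ∈ s) (hq : q ∈ s) (j : ℤ) : qPoch a q j ∈ s := by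
  obtain j | j := j
  · exact prod_mem fun i _ => sub_mem (one_mem s) (mul_mem ha (pow_mem hq i))
  · exact inv_mem (prod_mem fun i _ => sub_mem (one_mem s) (mul_mem ha (zpow_mem hq _)))

theorem phi32_mem {b d e f q z : F} (j : ℤ) (hb : b ∈ s) (hd : d ∈ s) (he : e ∈ s) (hf : f ∈ s)
    (hq : q ∈ s) (hz : z ∈ s) : phi32 j b d e f q z ∈ s := by
  refine sum_mem fun i _ => ?_
  rw [phiTerm_three_two]
  exact mul_mem (div_mem (mul_mem (mul_mem (qPoch_mem (zpow_mem hq _) hq _) (qPoch_mem hb hq _))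
    (qPoch_mem hd hq _)) (mul_mem (mul_mem (qPoch_mem hq hq _) (qPoch_mem he hq _))
    (qPoch_mem hf hq _))) (pow_mem hz i)

theorem coeff_P11_mem {a c q : F} (ha : a ∈ s) (hc : c ∈ s) (hq : q ∈ s) (k m n : ℤ) (i : ℕ) :
    (P11 k m n a c q).coeff i ∈ s := by
  have hz : ∀ n : ℤ, q ^ n ∈ s := fun n => zpow_mem hq n
  rw [P11, Polynomial.finsetSum_coeff]
  refine sum_mem fun l _ => ?_
  rw [Polynomial.coeff_monomial]
  split_ifs
  · refine sub_mem ?_ ?_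
    · rw [coeffA]
      split_ifs
      · exact zero_mem s
      · exact mul_mem (mul_mem (mul_mem (div_mem (mul_mem (mul_mem
          (qPoch_mem (div_mem (mul_mem ha hq) hc) hq _) (qPoch_mem hc hq _))
          (qPoch_mem (div_mem hc hq) hq _)) (mul_mem (qPoch_mem hq hq _) (qPoch_mem ha hq _)))
          (zpow_mem hc _)) (hz _)) (phi32_mem _ (mul_mem hc (hz _)) ha hc (mul_mem ha (hz _)) hq
          (hz _))
    · rw [coeffB]
      split_ifs
      · exact zero_mem s
      · exact mul_mem (mul_mem (mul_mem (mul_mem (div_mem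
          (qPoch_mem (div_mem (mul_mem ha hq) hc) hq _) (mul_mem (qPoch_mem hq hq _)
          (qPoch_mem (div_mem (pow_mem hq 2) hc) hq _))) (zpow_mem (neg_mem (one_mem s)) _))
          (zpow_mem hc _)) (pow_mem hq _)) (phi32_mem _ (mul_mem hc (hz _))
          (div_mem (mul_mem hc (hz _)) ha) (mul_mem hc (hz _)) (div_mem (mul_mem hc (hz _)) ha) hq
          (hz _))
  · refine sub_mem ?_ ?_
    · rw [coeffA']
      split_ifs
      · exact zero_mem s
      · exact mul_mem (mul_mem (mul_mem (div_mem (mul_mem (mul_mem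
          (qPoch_mem (div_mem (mul_mem ha hq) hc) hq _) (qPoch_mem hc hq _))
          (qPoch_mem (div_mem hc hq) hq _)) (mul_mem (qPoch_mem hq hq _) (qPoch_mem ha hq _)))
          (zpow_mem hc _)) (hz _)) (phi32_mem _ (mul_mem hc (hz _)) (div_mem hc ha) hc
          (div_mem (mul_mem hc (hz _)) ha) hq (hz _))
    · rw [coeffB']
      split_ifs
      · exact zero_mem s
      · exact mul_mem (mul_mem (mul_mem (div_mem
          (qPoch_mem (div_mem hq ha) hq _) (mul_mem (qPoch_mem hq hq _)
          (qPoch_mem (div_mem (pow_mem hq 2) hc) hq _))) (zpow_mem ha _))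
          (zpow_mem hc _)) (phi32_mem _ (mul_mem hc (hz _))
          (mul_mem ha (hz _)) (mul_mem hc (hz _)) (mul_mem ha (hz _)) hq (hz _))
  · exact zero_mem s

/-- The length of the sum already gives the bound: expanding the maxima, d + 1 is the largest of ±k,
±n, ±(m-k), ±(m-n). -/
theorem coeff_P11_eq_zero {a c q : F} (k m n : ℤ) (i : ℕ)
    (h : max (max |k| |m - k|) (max |n| |m - n|) - 1 < (i : ℤ)) :
    (P11 k m n a c q).coeff i = 0 := by
  rw [P11, Polynomial.finsetSum_coeff]
  refine sum_eq_zero fun l hl => ?_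
  rw [Polynomial.coeff_monomial, if_neg]
  rintro rfl
  rw [mem_range] at hl
  have := le_abs_self k
  have := neg_le_abs k
  have := le_abs_self n
  have := neg_le_abs n
  have := le_abs_self (m - k)
  have := neg_le_abs (m - k)
  have := le_abs_self (m - n)
  have := neg_le_abs (m - n)
  omega

end
end QHyp

/-! ### Convergence, continuity, and existence of the pair. -/

namespace QHyp

open Finset Filter Topology

/-- The ratio of consecutive terms is O(|q|^j), uniformly when A, C, x are near their limits. The
resulting geometric majorant provides both summability and, by dominated convergence, continuity of
₁φ₁ in its parameters. -/
theorem exists_phiTerm_bound {α : Type*} {l : Filter α} {A C x : α → ℂ} {A0 C0 x0 q : ℂ}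
    (hq0 : q ≠ 0) (hq : ‖q‖ < 1)
    (hA : Tendsto A l (𝓝 A0)) (hC : Tendsto C l (𝓝 C0)) (hx : Tendsto x l (𝓝 x0))
    (hCe : ∀ᶠ e in l, ∀ j : ℕ, C e * q ^ j ≠ 1) (hC0 : ∀ j : ℕ, C0 * q ^ j ≠ 1) :
    (∀ j, Tendsto (fun e => phiTerm [A e] [C e] q (x e) j) l (𝓝 (phiTerm [A0] [C0] q x0 j))) ∧
    ∃ B : ℝ, ∀ᶠ e in l, ∀ j, ‖phiTerm [A e] [C e] q (x e) j‖ ≤ B * (1 / 2) ^ j := by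
  have hqn : ∀ i : ℕ, q ^ (i + 1) ≠ 1 := by
    intro i h
    have := congrArg norm h
    rw [norm_pow, norm_one] at this
    exact (pow_lt_one₀ (norm_nonneg _) hq (by omega)).ne this
  have hterm : ∀ j, Tendsto (fun e => phiTerm [A e] [C e] q (x e) j) l
      (𝓝 (phiTerm [A0] [C0] q x0 j)) := by
    intro j
    simp only [phiTerm_one_one, qPoch_natCast _ _ j]
    refine Tendsto.mul (Tendsto.mul (Tendsto.div ?_ ?_ ?_) tendsto_const_nhds) (hx.pow j)
    · exact tendsto_finsetProd _ fun i _ => tendsto_const_nhds.sub (hA.mul_const _)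
    · exact tendsto_const_nhds.mul
        (tendsto_finsetProd _ fun i _ => tendsto_const_nhds.sub (hC.mul_const _))
    · rw [← qPoch_natCast, ← qPoch_natCast]
      exact mul_ne_zero (qPoch_self_ne_zero hqn j) (qPoch_natCast_ne_zero fun i _ => hC0 i)
  refine ⟨hterm, ?_⟩
  set M : ℝ := ‖A0‖ + ‖C0‖ + ‖x0‖ + 1 with hM
  have hA0 := norm_nonneg A0
  have hC0' := norm_nonneg C0
  have hx0 := norm_nonneg x0
  have hM1 : 1 ≤ M := by linarith
  -- Beyond J both denominator factors have norm at least 1/2, the numerator factor at most 2, and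
  -- |q^j x| is at most 1/16, so the ratio is at most 2·(1/16)·4 = 1/2.
  obtain ⟨J, hJ⟩ : ∃ J : ℕ, 16 * M * ‖q‖ ^ J ≤ 1 := by
    have := (tendsto_pow_atTop_nhds_zero_of_lt_one (norm_nonneg q) hq).const_mul (16 * M)
    rw [mul_zero] at this
    exact ((this.eventually (ge_mem_nhds one_pos)).exists)
  have hratio : ∀ᶠ e in l, ∀ j ≥ J, ‖phiTerm [A e] [C e] q (x e) (j + 1)‖
      ≤ 1 / 2 * ‖phiTerm [A e] [C e] q (x e) j‖ := by
    have eA : ∀ᶠ e in l, ‖A e‖ ≤ M := hA.norm.eventually (ge_mem_nhds (by linarith))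
    have eC : ∀ᶠ e in l, ‖C e‖ ≤ M := hC.norm.eventually (ge_mem_nhds (by linarith))
    have ex : ∀ᶠ e in l, ‖x e‖ ≤ M := hx.norm.eventually (ge_mem_nhds (by linarith))
    filter_upwards [eA, eC, ex, hCe] with e h1 h2 h3 h4 j hj
    have hqj : 16 * M * ‖q‖ ^ j ≤ 1 := by
      refine le_trans ?_ hJ
      gcongr 16 * M * ?_
      exact pow_le_pow_of_le_one (norm_nonneg _) hq.le hj
    have hqj0 : 0 ≤ ‖q‖ ^ j := by positivity
    have key := congrArg norm (phiTerm_one_one_succ (A e) (x e) hqn h4 j)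
    simp only [norm_mul, norm_neg] at key
    have n1 : 1 / 2 ≤ ‖1 - q ^ (j + 1)‖ := by
      have := norm_sub_norm_le 1 (q ^ (j + 1))
      rw [norm_one, norm_pow, pow_succ] at this
      nlinarith [norm_nonneg q]
    have n2 : 1 / 2 ≤ ‖1 - C e * q ^ j‖ := by
      have := norm_sub_norm_le 1 (C e * q ^ j)
      rw [norm_one, norm_mul, norm_pow] at this
      nlinarith [norm_nonneg (C e)]
    have n3 : ‖1 - A e * q ^ j‖ ≤ 2 := by
      have := norm_sub_le 1 (A e * q ^ j)
      rw [norm_one, norm_mul, norm_pow] at this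
      nlinarith [norm_nonneg (A e)]
    have n4 : ‖q ^ j‖ * ‖x e‖ ≤ 1 / 16 := by
      rw [norm_pow]
      nlinarith [norm_nonneg (x e)]
    set t0 := ‖phiTerm [A e] [C e] q (x e) j‖ with ht0
    set t1 := ‖phiTerm [A e] [C e] q (x e) (j + 1)‖ with ht1
    have p0 : 0 ≤ t0 := norm_nonneg _
    have p1 : 0 ≤ t1 := norm_nonneg _
    have l1 : 1 / 4 * t1 ≤ ‖1 - q ^ (j + 1)‖ * ‖1 - C e * q ^ j‖ * t1 := by
      gcongr
      nlinarith
    have l2 : ‖1 - A e * q ^ j‖ * ‖q ^ j‖ * ‖x e‖ * t0 ≤ 1 / 8 * t0 := by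
      gcongr
      rw [mul_assoc]
      have : 0 ≤ ‖q ^ j‖ * ‖x e‖ := by positivity
      nlinarith [norm_nonneg (1 - A e * q ^ j)]
    linarith
  set B : ℝ := ∑ i ∈ range (J + 1), (‖phiTerm [A0] [C0] q x0 i‖ + 1) with hB
  have hB0 : 0 ≤ B := sum_nonneg fun i _ => by positivity
  have hsmall : ∀ᶠ e in l, ∀ i ∈ range (J + 1), ‖phiTerm [A e] [C e] q (x e) i‖ ≤ B := by
    rw [eventually_all_finset]
    intro i hi
    refine ((hterm i).norm.eventually (ge_mem_nhds (lt_add_one _))).mono fun e he => he.trans ?_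
    exact single_le_sum (f := fun i => ‖phiTerm [A0] [C0] q x0 i‖ + 1)
      (fun i _ => by positivity) hi
  -- The factor 2^J makes the geometric bound at least B for the first J + 1 terms, which B
  -- majorises.
  refine ⟨B * 2 ^ J, ?_⟩
  filter_upwards [hratio, hsmall] with e h1 h2 j
  rcases le_total j J with hj | hj
  · refine (h2 j (by simpa [Nat.lt_succ_iff] using hj)).trans ?_
    rw [mul_assoc]
    refine le_mul_of_one_le_right hB0 ?_
    rw [one_div, inv_pow, ← div_eq_mul_inv, one_le_div (by positivity)]
    exact pow_le_pow_right₀ (by norm_num) hj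
  · obtain ⟨i, rfl⟩ := Nat.exists_eq_add_of_le hj
    have e2 : B * 2 ^ J * (1 / 2 : ℝ) ^ (J + i) = B * (1 / 2) ^ i := by
      rw [pow_add, one_div, inv_pow 2 J]; field_simp
    rw [e2]
    clear hj e2
    induction i with
    | zero => simpa using h2 J (by simp)
    | succ i ih =>
      have := h1 (J + i) (by omega)
      rw [pow_succ, ← add_assoc]
      linarith

section
variable {A C q x : ℂ}

theorem summable_phiTerm (hq0 : q ≠ 0) (hq : ‖q‖ < 1) (A x : ℂ)
    (hC : ∀ j : ℕ, C * q ^ j ≠ 1) : Summable fun j => phiTerm [A] [C] q x j := by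
  -- A constant family over a one-point index set turns the uniform bound into a bound for a single
  -- series.
  obtain ⟨-, B, hB⟩ := exists_phiTerm_bound (l := (⊤ : Filter Unit)) (A := fun _ => A)
    (C := fun _ => C) (x := fun _ => x) hq0 hq tendsto_const_nhds tendsto_const_nhds
    tendsto_const_nhds (Eventually.of_forall fun _ => hC) hC
  obtain ⟨-, hB⟩ := hB.exists
  exact Summable.of_norm_bounded (summable_geometric_two.mul_left B) hB

theorem tendsto_phi {α : Type*} {l : Filter α} {A C x : α → ℂ} {A0 C0 x0 q : ℂ}
    (hq0 : q ≠ 0) (hq : ‖q‖ < 1)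
    (hA : Tendsto A l (𝓝 A0)) (hC : Tendsto C l (𝓝 C0)) (hx : Tendsto x l (𝓝 x0))
    (hCe : ∀ᶠ e in l, ∀ j : ℕ, C e * q ^ j ≠ 1) (hC0 : ∀ j : ℕ, C0 * q ^ j ≠ 1) :
    Tendsto (fun e => phi [A e] [C e] q (x e)) l (𝓝 (phi [A0] [C0] q x0)) := by
  obtain ⟨h1, B, h2⟩ := exists_phiTerm_bound hq0 hq hA hC hx hCe hC0
  exact tendsto_tsum_of_dominated_convergence (summable_geometric_two.mul_left B) h1 h2

theorem isContig_phi {a c q : ℂ} (h : Generic a c q) (hq : ‖q‖ < 1) (x : ℂ) :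
    IsContig a c q x (fun k m n => phi [a * q ^ k] [c * q ^ m] q (x * q ^ n)) := by
  have hs : ∀ k m n : ℤ, Summable fun j => phiTerm [a * q ^ k] [c * q ^ m] q (x * q ^ n) j :=
    fun k m n => summable_phiTerm h.q0 hq _ _ (h.cn_shift m)
  have hn : ∀ (k m n : ℤ) (j : ℕ), phiTerm [a * q ^ k] [c * q ^ m] q (x * q ^ (n + 1)) j
      = q ^ j * phiTerm [a * q ^ k] [c * q ^ m] q (x * q ^ n) j := by
    intro k m n j
    rw [zpow_add_one₀ h.q0, ← mul_assoc, phiTerm_one_one_mul_right]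
  refine ⟨fun k m n => ?_, fun k m n => ?_, fun k m n => ?_⟩
  · simp only [phi]
    rw [← tsum_mul_left, ← tsum_mul_left, ← (hs k m n).tsum_sub ((hs k m (n + 1)).mul_left _)]
    refine tsum_congr fun j => ?_
    rw [hn, zpow_add_one₀ h.q0, ← mul_assoc a]
    linear_combination phiTerm_one_one_raise_num (a * q ^ k) (c * q ^ m) q (x * q ^ n) j
  · have e : c * q ^ m = c * q ^ (m - 1) * q := by
      rw [mul_assoc, ← zpow_add_one₀ h.q0, sub_add_cancel]
    simp only [phi]
    rw [← tsum_mul_left, ← tsum_mul_left, ← (hs k m n).tsum_sub ((hs k m (n + 1)).mul_left _)]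
    refine tsum_congr fun j => ?_
    rw [hn, e]
    linear_combination phiTerm_one_one_lower_den (a * q ^ k) q (x * q ^ n) (h.cn_shift (m - 1)) j
  · simp only [phi]
    rw [← (hs k m n).tsum_sub (hs k m (n + 1)), ← tsum_mul_left, ← tsum_mul_left,
      (((hs k m n).sub (hs k m (n + 1))).mul_left _).tsum_eq_zero_add]
    simp only [hn k m n]
    rw [pow_zero, one_mul, sub_self, mul_zero, zero_add]
    refine tsum_congr fun j => ?_
    rw [zpow_add_one₀ h.q0, zpow_add_one₀ h.q0, zpow_add_one₀ h.q0, ← mul_assoc, ← mul_assoc,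
      ← mul_assoc]
    linear_combination phiTerm_one_one_raise_all (a * q ^ k) (x * q ^ n) h.pow_ne (h.cn_shift m) j

theorem phi_three_term {a c x q : ℂ} (h : GenericPoint a c x q) (hq : ‖q‖ < 1) (k m n : ℤ) :
    phi [a * q ^ k] [c * q ^ m] q (x * q ^ n)
      = formS k m n a c x q * phi [a * q] [c * q] q (x * q)
        + formT k m n a c x q * phi [a] [c] q x := by
  simpa using (isContig_phi h.param hq x).three_term h k m n

/-- A curve through any point that is generic outside a countable set. -/
theorem genericPoint_curve_neBot {q : ℂ} (hq0 : q ≠ 0) (hq : ‖q‖ < 1) (a c x : ℂ) :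
    (𝓝[{e : ℂ | GenericPoint (a + e) (c + e ^ 3) (x + e) q}] (0 : ℂ)).NeBot := by
  rw [← mem_closure_iff_nhdsWithin_neBot]
  have hroots : ∀ p : Polynomial ℂ, p ≠ 0 → {e : ℂ | p.eval e = 0}.Countable := by
    intro p hp
    refine Set.Finite.countable ((Polynomial.rootSet_finite p ℂ).subset fun e he => ?_)
    rw [Polynomial.mem_rootSet]
    exact ⟨hp, by simpa using he⟩
  have hz : ∀ i : ℤ, q ^ i ≠ 0 := fun i => zpow_ne_zero i hq0
  have h1 := hroots (Polynomial.X + Polynomial.C a) (Polynomial.X_add_C_ne_zero _)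
  have h2 := hroots (Polynomial.X ^ 3 + Polynomial.C c)
    (Polynomial.monic_X_pow_add_C c (by norm_num)).ne_zero
  have h3 := hroots (Polynomial.X + Polynomial.C x) (Polynomial.X_add_C_ne_zero _)
  have h4 : (⋃ i : ℤ, {e : ℂ | (a + e) * q ^ i = 1}).Countable := by
    refine Set.countable_iUnion fun i => (hroots (Polynomial.C (q ^ i) * Polynomial.X
      + Polynomial.C (a * q ^ i - 1)) fun h => hz i ?_).mono fun e he => ?_
    · simpa [Polynomial.coeff_C, -map_sub, -map_neg] using congrArg (Polynomial.coeff · 1) h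
    · simp only [Set.mem_ofPred_eq] at he
      simp
      linear_combination he
  have h5 : (⋃ i : ℤ, {e : ℂ | (c + e ^ 3) * q ^ i = 1}).Countable := by
    refine Set.countable_iUnion fun i => (hroots (Polynomial.C (q ^ i) * Polynomial.X ^ 3
      + Polynomial.C (c * q ^ i - 1)) fun h => hz i ?_).mono fun e he => ?_
    · simpa [Polynomial.coeff_C, -map_sub, -map_neg] using congrArg (Polynomial.coeff · 3) h
    · simp only [Set.mem_ofPred_eq] at he
      simp
      linear_combination he
  have h6 : (⋃ i : ℤ, {e : ℂ | (a + e) * q ^ i = c + e ^ 3}).Countable := by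
    refine Set.countable_iUnion fun i => (hroots (Polynomial.X ^ 3 + Polynomial.C (-q ^ i)
      * Polynomial.X + Polynomial.C (c - a * q ^ i)) fun h => ?_).mono fun e he => ?_
    · simpa [Polynomial.coeff_C, Polynomial.coeff_X, -map_neg, -map_sub]
        using congrArg (Polynomial.coeff · 3) h
    · simp only [Set.mem_ofPred_eq] at he
      simp
      linear_combination -he
  -- The exponent 3 on the c-coordinate is chosen for this condition: the cubic outgrows (a+e)(x+e),
  -- so for no i can the equation hold identically in e.
  have h7 : (⋃ i : ℤ, {e : ℂ | (a + e) * (x + e) * q ^ i = c + e ^ 3}).Countable := by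
    refine Set.countable_iUnion fun i => (hroots (Polynomial.X ^ 3
      + Polynomial.C (-q ^ i) * Polynomial.X ^ 2 + Polynomial.C (-((a + x) * q ^ i))
      * Polynomial.X + Polynomial.C (c - a * x * q ^ i)) fun h => ?_).mono fun e he => ?_
    · simpa [Polynomial.coeff_C, Polynomial.coeff_X, -map_neg, -map_sub]
        using congrArg (Polynomial.coeff · 3) h
    · simp only [Set.mem_ofPred_eq] at he
      simp
      linear_combination -he
  have hc := ((((((h1.union h2).union h3).union h4).union h5).union h6).union h7)
  refine (hc.dense_compl ℂ).closure_eq.symm.subset.trans (closure_mono fun e he => ?_) trivial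
  simp only [Set.mem_compl_iff, Set.mem_union, Set.mem_iUnion, Set.mem_ofPred_eq, not_or,
    not_exists, Polynomial.eval_add, Polynomial.eval_pow, Polynomial.eval_X,
    Polynomial.eval_C] at he
  obtain ⟨⟨⟨⟨⟨⟨g1, g2⟩, g3⟩, g4⟩, g5⟩, g6⟩, g7⟩ := he
  refine ⟨⟨by rwa [add_comm], by rwa [add_comm], hq0, fun i hi h => ?_, g4, g5, g6⟩,
    by rwa [add_comm], g7⟩
  have := congrArg norm h
  rw [norm_zpow, norm_one] at this
  exact hi ((zpow_eq_one_iff_right₀ (norm_nonneg q) hq.ne).mp this)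

end

theorem norm_lt_one_mul_pow_ne {c q : ℂ} (hc : ‖c‖ < 1) (hq : ‖q‖ < 1) (j : ℕ) :
    c * q ^ j ≠ 1 := by
  intro h
  have := congrArg norm h
  rw [norm_mul, norm_pow, norm_one] at this
  have : ‖q‖ ^ j ≤ 1 := pow_le_one₀ (norm_nonneg _) hq.le
  nlinarith [norm_nonneg c]

theorem tendsto_add_pow {a : ℂ} (n : ℕ) (hn : n ≠ 0) (s : Set ℂ) :
    Tendsto (fun e : ℂ => a + e ^ n) (𝓝[s] 0) (𝓝 a) := by
  have : Tendsto (fun e : ℂ => a + e ^ n) (𝓝 0) (𝓝 (a + 0 ^ n)) :=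
    (Continuous.tendsto (by fun_prop) 0)
  rw [zero_pow hn, add_zero] at this
  exact this.mono_left nhdsWithin_le_nhds

theorem tendsto_eval {l : Filter ℂ} {A C X : ℂ → ℂ} {a c x q : ℂ} (hA : Tendsto A l (𝓝 a))
    (hC : Tendsto C l (𝓝 c)) (hX : Tendsto X l (𝓝 x)) (p : Poly4) :
    Tendsto (fun e => MvPolynomial.eval ![A e, C e, X e, q] p) l
      (𝓝 (MvPolynomial.eval ![a, c, x, q] p)) := by
  have h1 : Tendsto (fun e => (![A e, C e, X e, q] : Fin 4 → ℂ)) l (𝓝 ![a, c, x, q]) := by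
    rw [tendsto_pi_nhds]
    intro i
    fin_cases i
    · exact hA
    · exact hC
    · exact hX
    · exact tendsto_const_nhds
  exact ((MvPolynomial.continuous_eval p).tendsto _).comp h1

/-- The relation is known at generic points only. Any admissible point is a limit of generic ones
along the curve; the chosen fractions for S and T stay defined nearby and agree there with the
explicit formulas, and all three series are continuous at the point. -/
theorem threeTerm_form (k m n : ℤ) : ThreeTerm k m n (formS k m n va vc vx vq) (ratT k m n) := by
  intro a c x q s t hq0 hq hc hcm hS hT
  obtain ⟨N, D, hD, hN, rfl⟩ := hS
  obtain ⟨N', D', hD', hN', rfl⟩ := hT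
  set G := {e : ℂ | GenericPoint (a + e) (c + e ^ 3) (x + e) q} with hG
  have hne : (𝓝[G] (0 : ℂ)).NeBot := genericPoint_curve_neBot hq0 hq a c x
  have hA : Tendsto (fun e : ℂ => a + e) (𝓝[G] 0) (𝓝 a) := by
    simpa using tendsto_add_pow (a := a) 1 one_ne_zero G
  have hC : Tendsto (fun e : ℂ => c + e ^ 3) (𝓝[G] 0) (𝓝 c) := tendsto_add_pow 3 (by norm_num) G
  have hX : Tendsto (fun e : ℂ => x + e) (𝓝[G] 0) (𝓝 x) := by
    simpa using tendsto_add_pow (a := x) 1 one_ne_zero G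
  have hmem : ∀ᶠ e in 𝓝[G] (0 : ℂ), GenericPoint (a + e) (c + e ^ 3) (x + e) q :=
    eventually_mem_nhdsWithin
  have hphi : ∀ k m n : ℤ, (∀ j : ℕ, c * q ^ m * q ^ j ≠ 1) →
      Tendsto (fun e => phi [(a + e) * q ^ k] [(c + e ^ 3) * q ^ m] q ((x + e) * q ^ n)) (𝓝[G] 0)
      (𝓝 (phi [a * q ^ k] [c * q ^ m] q (x * q ^ n))) := fun k m n h =>
    tendsto_phi hq0 hq (hA.mul_const _) (hC.mul_const _) (hX.mul_const _)
      (hmem.mono fun e he j => he.param.cn_shift m j) h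
  have l0 := hphi k m n hcm
  have l1 := hphi 1 1 1 (fun j => by
    rw [zpow_one, mul_assoc, ← pow_succ']; exact hc (j + 1))
  have l2 := hphi 0 0 0 (by simpa using hc)
  simp only [zpow_one, zpow_zero, mul_one] at l1 l2
  have lS := (tendsto_eval (q := q) hA hC hX N).div (tendsto_eval hA hC hX D) hD
  have lT := (tendsto_eval (q := q) hA hC hX N').div (tendsto_eval hA hC hX D') hD'
  refine tendsto_nhds_unique l0 (((lS.mul l1).add (lT.mul l2)).congr' ?_)
  filter_upwards [hmem, (tendsto_eval hA hC hX D).eventually_ne hD,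
    (tendsto_eval hA hC hX D').eventually_ne hD'] with e he h1 h2
  rw [phi_three_term he hq]
  congr 2
  · exact HasValueAt.unique ⟨N, D, h1, hN, rfl⟩ (hasValueAt_formS he k m n)
  · exact HasValueAt.unique ⟨N', D', h2, hN', rfl⟩ (hasValueAt_ratT he k m n)

end QHyp

/-! ### Uniqueness of the pair. -/

namespace QHyp

open Finset Filter Topology

section
open Polynomial

theorem eq_zero_of_tsum_pow_eq_zero {u : ℕ → ℂ} (hu : ∀ x : ℂ, Summable fun n => u n * x ^ n)
    (h : ∀ x : ℂ, ∑' n, u n * x ^ n = 0) (n : ℕ) : u n = 0 := by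
  have key : HasFPowerSeriesAt (0 : ℂ → ℂ) (FormalMultilinearSeries.ofScalars ℂ u) 0 := by
    rw [hasFPowerSeriesAt_iff]
    refine Eventually.of_forall fun x => ?_
    have := (hu x).hasSum
    rw [h x] at this
    simpa [FormalMultilinearSeries.coeff_ofScalars, mul_comm] using this
  rw [← FormalMultilinearSeries.coeff_ofScalars (𝕜 := ℂ) (p := u) (n := n), key.eq_zero]
  rfl

theorem tendsto_ratio_shift {e : ℕ → ℂ} (he : ∀ i, e i ≠ 0)
    (hr : Tendsto (fun i => e (i + 1) / e i) atTop (𝓝 0)) (s : ℕ) :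
    Tendsto (fun i => e (i + s) / e i) atTop (𝓝 (if s = 0 then 1 else 0)) := by
  induction s with
  | zero =>
    refine tendsto_const_nhds.congr fun i => ?_
    rw [add_zero, div_self (he i), if_pos rfl]
  | succ s ih =>
    have := (hr.comp (tendsto_add_atTop_nat s)).mul ih
    rw [zero_mul] at this
    rw [if_neg s.succ_ne_zero]
    refine this.congr fun i => ?_
    simp only [Function.comp_apply]
    rw [div_mul_div_cancel₀ (he _), add_assoc]

/-- A power series whose coefficients decay faster than geometrically is not rational. -/
theorem eq_zero_of_mul_tsum_add_eq_zero {e : ℕ → ℂ} (he : ∀ i, e i ≠ 0)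
    (hr : Tendsto (fun i => e (i + 1) / e i) atTop (𝓝 0))
    (hs : ∀ x : ℂ, Summable fun n => e n * x ^ n) {p r : ℂ[X]}
    (h : ∀ x : ℂ, p.eval x * ∑' n, e n * x ^ n + r.eval x = 0) : p = 0 ∧ r = 0 := by
  have hpoly : ∀ (p : ℂ[X]) (x : ℂ), HasSum (fun n => p.coeff n * x ^ n) (p.eval x) := by
    intro p x
    rw [eval_eq_sum, Polynomial.sum]
    refine hasSum_sum_of_ne_finset_zero fun n hn => ?_
    rw [notMem_support_iff.mp hn, zero_mul]
  set u : ℕ → ℂ := fun n => ∑ kl ∈ antidiagonal n, p.coeff kl.1 * e kl.2 with hu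
  have hterm : ∀ (x : ℂ) (n : ℕ), ∑ kl ∈ antidiagonal n,
      p.coeff kl.1 * x ^ kl.1 * (e kl.2 * x ^ kl.2) = u n * x ^ n := by
    intro x n
    rw [hu, sum_mul]
    refine sum_congr rfl fun kl hkl => ?_
    rw [← mem_antidiagonal.mp hkl, pow_add]
    ring
  have hus : ∀ x : ℂ, HasSum (fun n => u n * x ^ n) (p.eval x * ∑' n, e n * x ^ n) := by
    intro x
    have h1 := (hpoly p x).summable.norm
    have h2 := (hs x).norm
    have h3 := (summable_norm_sum_mul_antidiagonal_of_summable_norm h1 h2).of_norm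
    have h4 := tsum_mul_tsum_eq_tsum_sum_antidiagonal_of_summable_norm h1 h2
    rw [(hpoly p x).tsum_eq] at h4
    simp only [hterm] at h3 h4
    rw [h4]
    exact h3.hasSum
  have hcoef : ∀ n, u n + r.coeff n = 0 := by
    have hsum : ∀ x : ℂ, HasSum (fun n => (u n + r.coeff n) * x ^ n) 0 := by
      intro x
      have := (hus x).add (hpoly r x)
      rw [h x] at this
      simpa only [add_mul] using this
    exact eq_zero_of_tsum_pow_eq_zero (fun x => (hsum x).summable) fun x => (hsum x).tsum_eq
  have hp : p = 0 := by
    rw [← leadingCoeff_eq_zero, leadingCoeff]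
    set D := p.natDegree with hD
    -- For i beyond the degree of r, the coefficient of x^(i+D) in the product with p is zero.
    -- Divided by e_i it tends to the leading coefficient of p, because e_(i+s)/e_i → 0 for s > 0.
    have hlim : Tendsto (fun i => ∑ l ∈ range (D + 1), p.coeff l * (e (i + (D - l)) / e i)) atTop
        (𝓝 (∑ l ∈ range (D + 1), p.coeff l * (if D - l = 0 then 1 else 0))) :=
      tendsto_finsetSum _ fun l _ => (tendsto_ratio_shift he hr _).const_mul _
    have hval : ∑ l ∈ range (D + 1), p.coeff l * (if D - l = 0 then (1 : ℂ) else 0)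
        = p.coeff D := by
      rw [sum_range_succ, sum_eq_zero, Nat.sub_self, if_pos rfl, zero_add, mul_one]
      intro l hl
      rw [mem_range] at hl
      rw [if_neg (by omega), mul_zero]
    rw [hval] at hlim
    refine tendsto_nhds_unique hlim (tendsto_const_nhds.congr' ?_)
    filter_upwards [eventually_gt_atTop r.natDegree] with i hi
    have h1 := hcoef (i + D)
    rw [coeff_eq_zero_of_natDegree_lt (p := r) (by omega), add_zero, hu] at h1
    simp only [Nat.sum_antidiagonal_eq_sum_range_succ_mk] at h1
    have h2 : ∑ l ∈ range (D + 1), p.coeff l * e (i + (D - l)) = 0 := by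
      rw [← h1]
      refine (sum_congr rfl fun l hl => ?_).trans
        (sum_subset (range_mono (by omega)) fun l _ hl => ?_)
      · rw [mem_range] at hl
        rw [show i + (D - l) = i + D - l by omega]
      · rw [mem_range] at hl
        rw [coeff_eq_zero_of_natDegree_lt (by omega), zero_mul]
    rw [← zero_div (e i), ← h2, sum_div]
    exact sum_congr rfl fun l _ => (mul_div_assoc _ _ _)
  refine ⟨hp, Polynomial.funext fun x => ?_⟩
  have := h x
  rwa [hp, eval_zero, zero_mul, zero_add, ← eval_zero (x := x)] at this

end

theorem phi_one_left {c q : ℂ} (x : ℂ) : phi [1] [c] q x = 1 := by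
  rw [phi, tsum_eq_single 0]
  · simp [phiTerm, qPoch]
  · intro j hj
    rw [phiTerm_one_one, qPoch_natCast, prod_eq_zero (i := 0) (by simpa [Nat.pos_iff_ne_zero])]
    · simp
    · simp

/-- At a = 1 one series is the constant 1. In the other the factors (q;q)_j cancel, leaving nonzero
coefficients with ratio -q^(j+1)/(1 - cq^(j+1)) → 0, so it is not rational in x. -/
theorem eq_zero_of_relation_at_one {c q : ℂ} (hc : ‖c‖ < 1) (hq0 : q ≠ 0) (hq : ‖q‖ < 1)
    {p r : Polynomial ℂ}
    (h : ∀ x : ℂ, p.eval x * phi [1 * q] [c * q] q (x * q) + r.eval x * phi [1] [c] q x = 0) :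
    p = 0 ∧ r = 0 := by
  have hcq : ∀ j : ℕ, c * q * q ^ j ≠ 1 := fun j => by
    rw [mul_assoc, ← pow_succ']; exact norm_lt_one_mul_pow_ne hc hq _
  have hqn : ∀ i : ℕ, q ^ (i + 1) ≠ 1 := fun i => by
    rw [pow_succ']; exact norm_lt_one_mul_pow_ne hq hq _
  set e : ℕ → ℂ := fun j => phiTerm [1 * q] [c * q] q q j with he
  have hrec : ∀ j, (1 - c * q ^ (j + 1)) * e (j + 1) = -q ^ (j + 1) * e j := by
    intro j
    have := phiTerm_one_one_succ (1 * q) q hqn hcq j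
    apply mul_left_cancel₀ (sub_ne_zero.mpr (hqn j).symm)
    simp only [he]
    linear_combination this
  have hden : ∀ j : ℕ, 1 - c * q ^ j ≠ 0 := fun j =>
    sub_ne_zero.mpr (norm_lt_one_mul_pow_ne hc hq j).symm
  have hne : ∀ i, e i ≠ 0 := by
    intro i
    induction i with
    | zero => simp [he, phiTerm, qPoch]
    | succ i ih =>
      intro h0
      have := hrec i
      rw [h0, mul_zero] at this
      exact mul_ne_zero (neg_ne_zero.mpr (pow_ne_zero _ hq0)) ih this.symm
  have hphi : ∀ (x : ℂ) (j : ℕ), phiTerm [1 * q] [c * q] q (x * q) j = e j * x ^ j := by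
    intro x j
    rw [mul_comm x q, phiTerm_one_one_mul_right, mul_comm]
  refine eq_zero_of_mul_tsum_add_eq_zero (e := e) hne ?_ (fun x => ?_) fun x => ?_
  · have hpow : Tendsto (fun i : ℕ => q ^ (i + 1)) atTop (𝓝 0) :=
      (tendsto_pow_atTop_nhds_zero_of_norm_lt_one hq).comp (tendsto_add_atTop_nat 1)
    have := (hpow.neg).div (tendsto_const_nhds.sub (hpow.const_mul c))
      (show (1 : ℂ) - c * 0 ≠ 0 by simp)
    simp only [neg_zero, zero_div] at this
    refine this.congr fun i => ?_
    simp only [Pi.div_apply]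
    rw [div_eq_div_iff (hden _) (hne i)]
    linear_combination -hrec i
  · simpa only [hphi] using summable_phiTerm hq0 hq (1 * q) (x * q) hcq
  · have := h x
    rw [phi_one_left, mul_one, phi] at this
    simpa only [hphi] using this

theorem eval_aeval_line (P : Poly4) (a c x q : ℂ) :
    (MvPolynomial.aeval ![Polynomial.C a, Polynomial.C c, Polynomial.X, Polynomial.C q] P).eval x
      = MvPolynomial.eval ![a, c, x, q] P := by
  have h2 : (Polynomial.aeval (R := ℂ) x).comp (MvPolynomial.aeval (R := ℂ)
      ![Polynomial.C a, Polynomial.C c, Polynomial.X, Polynomial.C q])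
      = MvPolynomial.aeval (R := ℂ) ![a, c, x, q] := by
    apply MvPolynomial.algHom_ext
    intro i
    fin_cases i <;> simp
  have h3 := DFunLike.congr_fun h2 P
  simpa only [AlgHom.comp_apply, MvPolynomial.aeval_eq_eval, Polynomial.coe_aeval_eq_eval] using h3

/-- Substituting 1 for the first variable gives a polynomial that vanishes on a product of infinite
sets, hence zero; and the substitution is the identity modulo X₀ - 1. -/
theorem X_sub_one_dvd {P : Poly4}
    (h : ∀ c x q : ℂ, ‖c‖ < 1 → q ≠ 0 → ‖q‖ < 1 → MvPolynomial.eval ![1, c, x, q] P = 0) :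
    (MvPolynomial.X 0 - 1 : Poly4) ∣ P := by
  let φ : Poly4 →ₐ[ℂ] Poly4 :=
    MvPolynomial.aeval ![1, MvPolynomial.X 1, MvPolynomial.X 2, MvPolynomial.X 3]
  have hφ : φ P = 0 := by
    have hball : {z : ℂ | z ≠ 0 ∧ ‖z‖ < 1}.Infinite := by
      have : Metric.ball (0 : ℂ) 1 \ {0} ⊆ {z : ℂ | z ≠ 0 ∧ ‖z‖ < 1} :=
        fun z hz => ⟨hz.2, by simpa using hz.1⟩
      exact ((infinite_of_mem_nhds 0 (Metric.ball_mem_nhds (0 : ℂ) one_pos)).sdiff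
        (Set.finite_singleton 0)).mono this
    -- One punctured unit disc serves for all coordinates, although only c and q are constrained.
    refine MvPolynomial.funext_set (fun _ => {z : ℂ | z ≠ 0 ∧ ‖z‖ < 1}) (fun _ => hball)
      fun v hv => ?_
    have hv' : ∀ i, v i ≠ 0 ∧ ‖v i‖ < 1 := fun i => hv i (Set.mem_univ i)
    rw [map_zero, ← h (v 1) (v 2) (v 3) (hv' 1).2 (hv' 3).1 (hv' 3).2]
    have h2 : (MvPolynomial.aeval (R := ℂ) v).comp φ
        = MvPolynomial.aeval (R := ℂ) ![1, v 1, v 2, v 3] := by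
      apply MvPolynomial.algHom_ext
      intro i
      fin_cases i <;> simp [φ]
    have h3 := DFunLike.congr_fun h2 P
    simpa only [AlgHom.comp_apply, MvPolynomial.aeval_eq_eval] using h3
  rw [← Ideal.mem_span_singleton, ← Ideal.Quotient.eq_zero_iff_mem]
  set I : Ideal Poly4 := Ideal.span {MvPolynomial.X 0 - 1}
  have h2 : (Ideal.Quotient.mkₐ ℂ I).comp φ = Ideal.Quotient.mkₐ ℂ I := by
    apply MvPolynomial.algHom_ext
    intro i
    fin_cases i
    · simp only [φ, Fin.zero_eta, AlgHom.comp_apply, MvPolynomial.aeval_X, Matrix.cons_val_zero]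
      rw [map_one, eq_comm, ← sub_eq_zero, ← map_one (Ideal.Quotient.mkₐ ℂ I), ← map_sub]
      exact Ideal.Quotient.eq_zero_iff_mem.mpr (Ideal.mem_span_singleton_self _)
    all_goals simp [φ]
  have h3 := DFunLike.congr_fun h2 P
  rw [AlgHom.comp_apply, hφ, map_zero] at h3
  exact h3.symm

/-- A linear relation between the two contiguous series with polynomial coefficients. -/
def IsRelation (P R : Poly4) : Prop :=
  ∀ a c x q : ℂ, ‖c‖ < 1 → q ≠ 0 → ‖q‖ < 1 →
    MvPolynomial.eval ![a, c, x, q] P * phi [a * q] [c * q] q (x * q)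
      + MvPolynomial.eval ![a, c, x, q] R * phi [a] [c] q x = 0

theorem tendsto_relation {l : Filter ℂ} {A C X : ℂ → ℂ} {a c x q : ℂ} (hA : Tendsto A l (𝓝 a))
    (hC : Tendsto C l (𝓝 c)) (hX : Tendsto X l (𝓝 x)) (hc : ‖c‖ < 1) (hq0 : q ≠ 0)
    (hq : ‖q‖ < 1) (P R : Poly4) :
    Tendsto (fun e => MvPolynomial.eval ![A e, C e, X e, q] P * phi [A e * q] [C e * q] q (X e * q)
      + MvPolynomial.eval ![A e, C e, X e, q] R * phi [A e] [C e] q (X e)) l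
      (𝓝 (MvPolynomial.eval ![a, c, x, q] P * phi [a * q] [c * q] q (x * q)
        + MvPolynomial.eval ![a, c, x, q] R * phi [a] [c] q x)) := by
  have hCe : ∀ᶠ e in l, ‖C e‖ < 1 := hC.norm.eventually_lt_const hc
  have hne : ∀ {c : ℂ}, ‖c‖ < 1 → ∀ j : ℕ, c * q * q ^ j ≠ 1 := fun hc j => by
    rw [mul_assoc, ← pow_succ']; exact norm_lt_one_mul_pow_ne hc hq _
  exact ((tendsto_eval hA hC hX P).mul (tendsto_phi hq0 hq (hA.mul_const q) (hC.mul_const q)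
      (hX.mul_const q) (hCe.mono fun e he => hne he) (hne hc))).add
    ((tendsto_eval hA hC hX R).mul (tendsto_phi hq0 hq hA hC hX
      (hCe.mono fun e he => norm_lt_one_mul_pow_ne he hq) (norm_lt_one_mul_pow_ne hc hq)))

/-- Genericity is traded for the open condition |c| < 1, which keeps every series defined and stable
under limits, so that the special value a = 1 becomes available. -/
theorem isRelation_of_generic {P R : Poly4}
    (h : ∀ a c x q : ℂ, GenericPoint a c x q → ‖q‖ < 1 →
      MvPolynomial.eval ![a, c, x, q] P * phi [a * q] [c * q] q (x * q)
        + MvPolynomial.eval ![a, c, x, q] R * phi [a] [c] q x = 0) : IsRelation P R := by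
  intro a c x q hc hq0 hq
  set G := {e : ℂ | GenericPoint (a + e) (c + e ^ 3) (x + e) q} with hG
  have hne : (𝓝[G] (0 : ℂ)).NeBot := genericPoint_curve_neBot hq0 hq a c x
  have hA : Tendsto (fun e : ℂ => a + e) (𝓝[G] 0) (𝓝 a) := by
    simpa using tendsto_add_pow (a := a) 1 one_ne_zero G
  have hC : Tendsto (fun e : ℂ => c + e ^ 3) (𝓝[G] 0) (𝓝 c) := tendsto_add_pow 3 (by norm_num) G
  have hX : Tendsto (fun e : ℂ => x + e) (𝓝[G] 0) (𝓝 x) := by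
    simpa using tendsto_add_pow (a := x) 1 one_ne_zero G
  refine tendsto_nhds_unique (tendsto_relation hA hC hX hc hq0 hq P R)
    (tendsto_const_nhds.congr' ?_)
  have hmem : ∀ᶠ e in 𝓝[G] (0 : ℂ), GenericPoint (a + e) (c + e ^ 3) (x + e) q :=
    eventually_mem_nhdsWithin
  filter_upwards [hmem] with e he
  exact (h _ _ _ _ he hq).symm

/-- Off a = 1 the factor cancels; at a = 1 the relation follows by continuity in a. -/
theorem IsRelation.of_mul_X_sub_one {P R : Poly4}
    (h : IsRelation ((MvPolynomial.X 0 - 1) * P) ((MvPolynomial.X 0 - 1) * R)) :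
    IsRelation P R := by
  have off : ∀ a c x q : ℂ, a ≠ 1 → ‖c‖ < 1 → q ≠ 0 → ‖q‖ < 1 →
      MvPolynomial.eval ![a, c, x, q] P * phi [a * q] [c * q] q (x * q)
      + MvPolynomial.eval ![a, c, x, q] R * phi [a] [c] q x = 0 := by
    intro a c x q ha hc hq0 hq
    have := h a c x q hc hq0 hq
    simp only [map_mul, map_sub, MvPolynomial.eval_X, map_one, Matrix.cons_val_zero] at this
    apply mul_left_cancel₀ (sub_ne_zero.mpr ha)
    linear_combination this
  intro a c x q hc hq0 hq
  by_cases ha : a = 1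
  · subst ha
    have hA : Tendsto (fun e : ℂ => 1 + e) (𝓝[≠] 0) (𝓝 1) := by
      simpa using tendsto_add_pow (a := 1) 1 one_ne_zero {0}ᶜ
    refine tendsto_nhds_unique (tendsto_relation hA tendsto_const_nhds tendsto_const_nhds
      hc hq0 hq P R) (tendsto_const_nhds.congr' ?_)
    filter_upwards [self_mem_nhdsWithin] with e he
    exact (off _ _ _ _ (by simpa using he) hc hq0 hq).symm
  · exact off a c x q ha hc hq0 hq

theorem totalDegree_X_sub_one : (MvPolynomial.X 0 - 1 : Poly4).totalDegree ≠ 0 := by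
  intro h
  rw [MvPolynomial.totalDegree_eq_zero_iff_eq_C] at h
  have h0 := congrArg (MvPolynomial.eval ![0, 0, 0, 0]) h
  have h1 := congrArg (MvPolynomial.eval ![1, 0, 0, 0]) h
  simp only [map_sub, MvPolynomial.eval_X, map_one, MvPolynomial.eval_C,
    Matrix.cons_val_zero] at h0 h1
  rw [← h0] at h1
  norm_num at h1

/-- Infinite descent on the total degree: specialising at a = 1 makes both coefficients divisible by
a - 1, and the quotients form a relation of smaller degree. -/
theorem IsRelation.eq_zero {P R : Poly4} (h : IsRelation P R) : P = 0 ∧ R = 0 := by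
  induction hN : P.totalDegree + R.totalDegree using Nat.strong_induction_on generalizing P R with
  | _ N ih =>
    have hz : ∀ c q : ℂ, ‖c‖ < 1 → q ≠ 0 → ‖q‖ < 1 → ∀ x : ℂ,
        MvPolynomial.eval ![1, c, x, q] P = 0 ∧ MvPolynomial.eval ![1, c, x, q] R = 0 := by
      intro c q hc hq0 hq x
      simp only [← eval_aeval_line]
      obtain ⟨h1, h2⟩ := eq_zero_of_relation_at_one hc hq0 hq fun x => by
        have := h 1 c x q hc hq0 hq
        rwa [← eval_aeval_line P, ← eval_aeval_line R] at this
      rw [h1, h2]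
      simp
    obtain ⟨P', rfl⟩ := X_sub_one_dvd (P := P) fun c x q hc hq0 hq => (hz c q hc hq0 hq x).1
    obtain ⟨R', rfl⟩ := X_sub_one_dvd (P := R) fun c x q hc hq0 hq => (hz c q hc hq0 hq x).2
    by_cases hPR : P' = 0 ∧ R' = 0
    · rw [hPR.1, hPR.2]; simp
    have hX0 : (MvPolynomial.X 0 - 1 : Poly4) ≠ 0 := by
      intro h0
      apply totalDegree_X_sub_one
      rw [h0, MvPolynomial.totalDegree_zero]
    have hX := totalDegree_X_sub_one
    have hle : ∀ Q : Poly4, Q.totalDegree ≤ ((MvPolynomial.X 0 - 1) * Q).totalDegree ∧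
        (Q ≠ 0 → Q.totalDegree < ((MvPolynomial.X 0 - 1) * Q).totalDegree) := by
      intro Q
      by_cases hQ : Q = 0
      · simp [hQ]
      · rw [MvPolynomial.totalDegree_mul_of_isDomain hX0 hQ]
        omega
    have hlt : P'.totalDegree + R'.totalDegree < N := by
      have h1 := hle P'
      have h2 := hle R'
      by_cases hP' : P' = 0
      · have := h2.2 fun h => hPR ⟨hP', h⟩
        omega
      · have := h1.2 hP'
        omega
    exact absurd (ih _ hlt h.of_mul_X_sub_one rfl) hPR

theorem ThreeTerm.unique {k m n : ℤ} {S T : Rat4} (h : ThreeTerm k m n S T) :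
    S = formS k m n va vc vx vq ∧ T = ratT k m n := by
  obtain ⟨N1, D1, hD1, hS⟩ := IsFractionRing.div_surjective (A := Poly4) S
  obtain ⟨N2, D2, hD2, hT⟩ := IsFractionRing.div_surjective (A := Poly4) T
  obtain ⟨Nf, Df, hDf, hf⟩ := IsFractionRing.div_surjective (A := Poly4)
    (S - formS k m n va vc vx vq)
  obtain ⟨Ng, Dg, hDg, hg⟩ := IsFractionRing.div_surjective (A := Poly4) (T - ratT k m n)
  rw [mem_nonZeroDivisors_iff_ne_zero] at hD1 hD2 hDf hDg
  -- Subtract the explicit relation and clear denominators. The additional factor D1·D2·Df·Dg makes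
  -- the identity trivial at points where one of the chosen fractions is undefined.
  have hrel : IsRelation (Nf * Dg * (D1 * D2 * Df * Dg)) (Ng * Df * (D1 * D2 * Df * Dg)) := by
    refine isRelation_of_generic fun a c x q hG hq => ?_
    simp only [map_mul]
    set ev := MvPolynomial.eval (R := ℂ) ![a, c, x, q] with hev
    by_cases h0 : ev D1 = 0 ∨ ev D2 = 0 ∨ ev Df = 0 ∨ ev Dg = 0
    · rcases h0 with h0 | h0 | h0 | h0 <;> simp [h0]
    push Not at h0
    obtain ⟨e1, e2, e3, e4⟩ := h0
    have v1 : HasValueAt S a c x q (ev N1 / ev D1) := ⟨N1, D1, e1, hS.symm, rfl⟩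
    have v2 : HasValueAt T a c x q (ev N2 / ev D2) := ⟨N2, D2, e2, hT.symm, rfl⟩
    have v3 := HasValueAt.unique ⟨Nf, Df, e3, hf.symm, rfl⟩ (v1.sub (hasValueAt_formS hG k m n))
    have v4 := HasValueAt.unique ⟨Ng, Dg, e4, hg.symm, rfl⟩ (v2.sub (hasValueAt_ratT hG k m n))
    have r1 := h a c x q _ _ hG.param.q0 hq (fun j => by simpa using hG.param.cn_shift 0 j)
      (hG.param.cn_shift m) v1 v2
    rw [phi_three_term hG hq k m n] at r1
    rw [← hev, div_eq_iff e3] at v3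
    rw [← hev, div_eq_iff e4] at v4
    rw [v3, v4]
    linear_combination (-(ev Df) * ev Dg * (ev D1 * ev D2 * ev Df * ev Dg)) * r1
  obtain ⟨h1, h2⟩ := hrel.eq_zero
  have hE : D1 * D2 * Df * Dg ≠ 0 := mul_ne_zero (mul_ne_zero (mul_ne_zero hD1 hD2) hDf) hDg
  have h1' : Nf = 0 := by simpa [hE, hDg] using h1
  have h2' : Ng = 0 := by simpa [hE, hDf] using h2
  rw [h1', map_zero, zero_div, eq_comm, sub_eq_zero] at hf
  rw [h2', map_zero, zero_div, eq_comm, sub_eq_zero] at hg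
  exact ⟨hf, hg⟩

end QHyp

end

theorem theorem1 :
    (∀ k m n : ℤ, ∃! p : QHyp.Rat4 × QHyp.Rat4, QHyp.ThreeTerm k m n p.1 p.2) ∧
    ∀ S T : ℤ → ℤ → ℤ → QHyp.Rat4,
      (∀ k m n : ℤ, QHyp.ThreeTerm k m n (S k m n) (T k m n)) →
      ∀ k m n : ℤ,
        T k m n =
          -((1 - QHyp.vc) * (1 - QHyp.vc * QHyp.vq)
              / ((1 - QHyp.va * QHyp.vq) * (QHyp.vc - QHyp.va * QHyp.vx * QHyp.vq)
                  * QHyp.vx * QHyp.vq))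
            * QHyp.shift (S (k - 1) (m - 1) (n - 1)) ∧
        S k m n =
          (1 - QHyp.va) * (QHyp.vc - QHyp.va * QHyp.vx) / ((QHyp.vq - QHyp.vc) * (1 - QHyp.vc))
            * (QHyp.vx ^ (1 - max m 0)
                / QHyp.qPoch (QHyp.va * QHyp.vx / QHyp.vc) QHyp.vq (max (k - m + n) 0))
            * (QHyp.P11 k m n QHyp.va QHyp.vc QHyp.vq).eval QHyp.vx ∧
        (∀ i : ℕ, (QHyp.P11 k m n QHyp.va QHyp.vc QHyp.vq).coeff i ∈
          IntermediateField.adjoin ℂ {QHyp.va, QHyp.vc, QHyp.vq}) ∧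
        (∀ i : ℕ, max (max |k| |m - k|) (max |n| |m - n|) - 1 < (i : ℤ) →
          (QHyp.P11 k m n QHyp.va QHyp.vc QHyp.vq).coeff i = 0) := by
  refine ⟨fun k m n => ⟨(QHyp.formS k m n QHyp.va QHyp.vc QHyp.vx QHyp.vq, QHyp.ratT k m n),
    QHyp.threeTerm_form k m n, fun p hp => Prod.ext hp.unique.1 hp.unique.2⟩,
    fun S T h k m n => ⟨?_, (h k m n).unique.1, fun i => ?_, QHyp.coeff_P11_eq_zero k m n⟩⟩
  · rw [(h k m n).unique.2, (h (k - 1) (m - 1) (n - 1)).unique.1]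
    rfl
  · have hs := IntermediateField.subset_adjoin ℂ {QHyp.va, QHyp.vc, QHyp.vq}
    exact QHyp.coeff_P11_mem (hs (by simp)) (hs (by simp)) (hs (by simp)) k m n i
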